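/- Let $A=(A_{ij})_{i,j\in I}$ be the Cartan matrix of one of the Dynkin diagrams $A_n$ ($n\ge1$), $B_n,C_n$ ($n\ge2$), $D_n$ ($n\ge4$), $E_6,E_7,E_8,F_4,G_2$, let $\operatorname{rk}A=|I|$ be its number of nodes, and let $R$ be a commutative ring. Suppose that either (i) $\operatorname{rk}A\ge2$ and $R$ is finitely generated as a ring, or (ii) $\operatorname{rk}A\ge1$ and $R$ is finitely generated as a module over a subring generated by finitely many units of $R$. Then the Steinberg group $\mathrm{St}_A(R)$ is finitely generated. Here $\mathrm{St}_A(R)$ is defined as follows. Let $W$ be the Weyl group, acting on $\mathbb Z^I$ (with basis the simple roots $\alpha_i$) by $s_i\alpha_j=\alpha_j-A_{ij}\alpha_i$; let $\Phi=W\{\alpha_i\}$ be the set of roots, and $\alpha^\vee$ the coroot of $\alpha\in\Phi$, so that $\langle\alpha_i^\vee,\alpha_j\rangle=A_{ij}$. Let $\mathfrak g$ be the complex Lie algebra given by the Chevalley–Serre presentation of $A$, with generators $e_i,f_i,h_i$ normalized by $[e_i,f_i]=-h_i$ and $[h_i,e_j]=A_{ij}e_j$, and with root spaces $\mathfrak g_\alpha$.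 Let $W^*\subseteq\operatorname{Aut}\mathfrak g$ be the group generated by the automorphisms $(\exp\operatorname{ad}e_i)(\exp\operatorname{ad}f_i)(\exp\operatorname{ad}e_i)$. For $\alpha\in\Phi$ let $E_\alpha$ be the set of the vectors $\pm w(e_i)$ ($w\in W^*$, $i\in I$) that lie in $\mathfrak g_\alpha$. For $e\in E_\alpha$ let $f\in E_{-\alpha}$ be the element such that $s_e^*=(\exp\operatorname{ad}e)(\exp\operatorname{ad}f)(\exp\operatorname{ad}e)$ exchanges $\mathfrak g_\alpha$ and $\mathfrak g_{-\alpha}$. The group $\mathrm{St}_A(R)$ is generated by symbols $X_e(t)$, for $e\in E_\alpha$, $\alpha\in\Phi$ and $t\in R$, with the following defining relations. * $X_e(t)X_e(u)=X_e(t+u)$ and $X_{-e}(t)=X_e(-t)$. * The Chevalley relations $[X_e(t),X_{e'}(u)]=\prod_\gamma X_{e_\gamma}(C_\gamma t^{m}u^{n})$ for $e\in E_\alpha$, $e'\in E_\beta$, where $[x,y]=xyx^{-1}y^{-1}$. Here $\alpha,\beta$ is any pair of roots that is prenilpotent (some element of $W$ makes both positive and some element of $W$ makes both negative); $\gamma=m\alpha+n\beta$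 runs, in any order, over the roots other than $\alpha,\beta$ that are combinations of $\alpha$ and $\beta$ with coefficients $m,n\in\{0,1,2,\dots\}$; $e_\gamma\in E_\gamma$; and the integers $C_\gamma$ are those for which the relation holds for all $t,u\in\mathbb C$ in $\operatorname{Aut}\mathfrak g$ with $X_e(t)$ read as $\exp(t\operatorname{ad}e)$. * $\tilde s_e(r)\,X_{e'}(t)\,\tilde s_e(r)^{-1}=X_{s_e^*(e')}\bigl(r^{\langle\alpha^\vee,s_\alpha\beta\rangle}t\bigr)$ for $e\in E_\alpha$, $e'\in E_\beta$, $\alpha,\beta\in\Phi$, every unit $r$ of $R$ and every $t\in R$, where $\tilde s_e(r)=X_e(r)X_f(1/r)X_e(r)$ and $s_\alpha\beta=\beta-\langle\alpha^\vee,\beta\rangle\alpha$. -/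

import Mathlib

namespace SteinbergGroup

/-! ### The ABCDEFG Dynkin diagrams -/

/-- `A` is, up to the labelling of the nodes, the Cartan matrix of one of the Dynkin diagrams
`A_n (n ≥ 1)`, `B_n, C_n (n ≥ 2)`, `D_n (n ≥ 4)`, `E₆, E₇, E₈, F₄, G₂`.  (This list is closed under
transposition, so it does not depend on the convention relating matrices and diagrams.) -/
inductive IsABCDEFG {I : Type*} (A : Matrix I I ℤ) : Prop
  | typeA (n : ℕ) (hn : 1 ≤ n) (e : I ≃ Fin n) (h : A.reindex e e = CartanMatrix.A n)
  | typeB (n : ℕ) (hn : 2 ≤ n) (e : I ≃ Fin n) (h : A.reindex e e = CartanMatrix.B n)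
  | typeC (n : ℕ) (hn : 2 ≤ n) (e : I ≃ Fin n) (h : A.reindex e e = CartanMatrix.C n)
  | typeD (n : ℕ) (hn : 4 ≤ n) (e : I ≃ Fin n) (h : A.reindex e e = CartanMatrix.D n)
  | typeE6 (e : I ≃ Fin 6) (h : A.reindex e e = CartanMatrix.E₆)
  | typeE7 (e : I ≃ Fin 7) (h : A.reindex e e = CartanMatrix.E₇)
  | typeE8 (e : I ≃ Fin 8) (h : A.reindex e e = CartanMatrix.E₈)
  | typeF4 (e : I ≃ Fin 4) (h : A.reindex e e = CartanMatrix.F₄)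
  | typeG2 (e : I ≃ Fin 2) (h : A.reindex e e = CartanMatrix.G₂)

noncomputable section

variable {I : Type*} [Fintype I] [DecidableEq I] (A : Matrix I I ℤ)

/-! ### Weyl group, roots and coroots

`I → ℤ` is the lattice with basis the simple roots `α_i = Pi.single i 1`.  The simple reflections
are involutions when `A` has diagonal entries `2`, so an element of the Weyl group is represented
by a word in the simple reflections.  The dual lattice (with basis the simple coroots) is also
`I → ℤ`; there the simple reflections are those of the transposed matrix. -/

/-- The simple reflection `s_i`, with `s_i α_j = α_j - A_ij α_i`. -/
def simpleReflection (i : I) (v : I → ℤ) : I → ℤ :=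
  v - (∑ j, A i j * v j) • Pi.single i 1

/-- The action of the Weyl group element `s_{i₁} ⋯ s_{i_k}` represented by `w = [i₁, …, i_k]`. -/
def weylAct (w : List I) (v : I → ℤ) : I → ℤ :=
  w.foldr (simpleReflection A) v

/-- The set `Φ` of (real) roots: all `w α_i`. -/
def roots : Set (I → ℤ) :=
  {α | ∃ (w : List I) (i : I), α = weylAct A w (Pi.single i 1)}

/-- `c` is the coroot of `α`: the two are `w α_i^∨` and `w α_i` for the same `w` and `i`. -/
def IsCoroot (α c : I → ℤ) : Prop :=
  ∃ (w : List I) (i : I),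
    α = weylAct A w (Pi.single i 1) ∧ c = weylAct A.transpose w (Pi.single i 1)

/-- The pairing of the dual lattice with the root lattice, with `⟨α_i^∨, α_j⟩ = A_ij`. -/
def pairing (c v : I → ℤ) : ℤ := ∑ i, ∑ j, c i * A i j * v j

/-- The pair `α, β` is prenilpotent: some element of the Weyl group makes both positive, and some
element makes both negative. -/
def IsPrenilpotent (α β : I → ℤ) : Prop :=
  (∃ w : List I, 0 ≤ weylAct A w α ∧ 0 ≤ weylAct A w β) ∧
    ∃ w : List I, weylAct A w α ≤ 0 ∧ weylAct A w β ≤ 0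

/-- `θ(α, β) = (ℕ α + ℕ β) ∩ Φ`. -/
def theta (α β : I → ℤ) : Set (I → ℤ) :=
  {γ | γ ∈ roots A ∧ ∃ m n : ℕ, γ = m • α + n • β}

/-! ### The Lie algebra and the group `W*` -/

/-- The complex Lie algebra of `A`, given by the Chevalley–Serre presentation. -/
abbrev 𝔤 : Type _ := Matrix.ToLieAlgebra ℂ A

open CartanMatrix in
/-- The image of a generator of the free Lie algebra. -/
def gen (x : Generators I) : 𝔤 A :=
  LieSubmodule.Quotient.mk (N := Relations.toIdeal ℂ A) (FreeLieAlgebra.of ℂ x)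

/-- The generator `h_i`. -/
def h (i : I) : 𝔤 A := gen A (.H i)

/-- The generator `e_i`. -/
def e (i : I) : 𝔤 A := gen A (.E i)

/-- The generator `f_i`, normalized so that `[e_i, f_i] = -h_i`: in terms of the generators
`E_i, F_i, H_i` with `[E_i, F_i] = H_i`, it is `-F_i`. -/
def f (i : I) : 𝔤 A := -gen A (.F i)

/-- The space of weight `α`.  For `A` nonsingular, as it is for the ABCDEFG diagrams, this is the
component of degree `α` of the grading with `deg e_i = α_i`, `deg f_i = -α_i`, `deg h_i = 0`. -/
def rootSpace (α : I → ℤ) : Set (𝔤 A) :=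
  {x | ∀ i, ⁅h A i, x⁆ = (∑ j, A i j * α j) • x}

variable {A}

/-- `exp (ad x)`, for `ad x` locally nilpotent (the sum is then finite at each `y`). -/
def expAd (x y : 𝔤 A) : 𝔤 A :=
  ∑ᶠ n : ℕ, ((n.factorial : ℂ)⁻¹) • ((LieAlgebra.ad ℂ (𝔤 A) x) ^ n) y

/-- `(exp ad x)(exp ad y)(exp ad x)`. -/
def sStar (x y : 𝔤 A) : 𝔤 A → 𝔤 A :=
  expAd x ∘ expAd y ∘ expAd x

variable (A)

/-- The group `W*` of automorphisms of the Lie algebra generated by the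
`s_i^* = (exp ad e_i)(exp ad f_i)(exp ad e_i)`.  (These preserve the Lie bracket, so that the group
they generate may be formed inside the group of all linear automorphisms.) -/
def WStar : Subgroup (𝔤 A ≃ₗ[ℂ] 𝔤 A) :=
  Subgroup.closure {φ | ∃ i, (φ : 𝔤 A → 𝔤 A) = sStar (e A i) (f A i)}

/-- A pair consisting of a root `α` and an element of `E_α`, the set of the vectors in the root
space of `α` that are, up to sign, in the `W*`-orbit of some `e_i`. -/
structure RootVec where
  root : I → ℤ
  vec : 𝔤 A
  root_mem : root ∈ roots A
  vec_mem : vec ∈ rootSpace A root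
  vec_orbit : ∃ φ ∈ WStar A, ∃ i, vec = φ (e A i) ∨ vec = -φ (e A i)

variable {A}

/-- `f` is the distinguished element of `E_{-α}` that belongs to `e ∈ E_α`: the automorphism
`s_e^* = (exp ad e)(exp ad f)(exp ad e)` exchanges the root spaces of `α` and `-α`. -/
def IsOpposite (e f : RootVec A) : Prop :=
  f.root = -e.root ∧
    sStar e.vec f.vec '' rootSpace A e.root = rootSpace A (-e.root) ∧
    sStar e.vec f.vec '' rootSpace A (-e.root) = rootSpace A e.root

/-! ### The Steinberg group -/

/-- A factor `X_{e_γ}(C t^m u^n)` of the right hand side of a Chevalley relation. -/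
structure ChevalleyTerm (A : Matrix I I ℤ) where
  vec : RootVec A
  m : ℕ
  n : ℕ
  C : ℤ

/-- `[X_a(t), X_b(u)] = ∏_k X_{e_k}(C_k t^{m_k} u^{n_k})`, where `k` runs over the list `L`, is a
Chevalley relation for `a ∈ E_α`, `b ∈ E_β`: the pair `α, β` is prenilpotent, the list runs, in some
order and with some choice of `e_γ ∈ E_γ`, over the roots `γ = m α + n β` of `θ(α, β) - {α, β}`,
and the integers `C_k` are such that the relation holds over `ℂ`, where `X_e(t)` is `exp (t e)`. -/
structure IsChevalley (a b : RootVec A) (L : List (ChevalleyTerm A)) : Prop where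
  prenilpotent : IsPrenilpotent A a.root b.root
  nodup : (L.map fun k => k.vec.root).Nodup
  mem_iff : ∀ γ : I → ℤ, γ ∈ (L.map fun k => k.vec.root) ↔
    γ ∈ theta A a.root b.root \ {a.root, b.root}
  root_eq : ∀ k ∈ L, k.vec.root = k.m • a.root + k.n • b.root
  holds : ∀ t u : ℂ,
    expAd (t • a.vec) ∘ expAd (u • b.vec) ∘ expAd (-(t • a.vec)) ∘ expAd (-(u • b.vec)) =
      (L.map fun k => expAd (((k.C : ℂ) * t ^ k.m * u ^ k.n) • k.vec.vec)).foldr (· ∘ ·) id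

variable (A) (R : Type*) [CommRing R]

variable {A R} in
/-- The generator `X_e(t)`, as an element of the free group. -/
def X (e : RootVec A) (t : R) : FreeGroup (RootVec A × R) := FreeGroup.of (e, t)

variable {A R} in
/-- `s̃_e(r) = X_e(r) X_f(1/r) X_e(r)`; here `f` is to be the vector opposite to `e`. -/
def sTilde (e f : RootVec A) (r : Rˣ) : FreeGroup (RootVec A × R) :=
  X e (r : R) * X f ((r⁻¹ : Rˣ) : R) * X e (r : R)

/-- The defining relators of the Steinberg group. The first two make the `X_e(t)` with `e ∈ E_α`
into a group `U_α(R) = ℤ E_α ⊗ R ≅ R`, with `X_e(t) = e ⊗ t`; then come the Chevalley relations; and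
the last says that `s̃_e(r)` acts on `U_β` by `h_α(r) ∘ s_e^*`, where `h_α(r)` acts on `U_γ` as
multiplication by `r ^ ⟨α^∨, γ⟩`. -/
inductive IsRelator : FreeGroup (RootVec A × R) → Prop
  | add (e : RootVec A) (t u : R) : IsRelator (X e t * X e u * (X e (t + u))⁻¹)
  | neg (e e' : RootVec A) (hroot : e'.root = e.root) (hvec : e'.vec = -e.vec) (t : R) :
      IsRelator (X e' t * (X e (-t))⁻¹)
  | chevalley (a b : RootVec A) (L : List (ChevalleyTerm A)) (hL : IsChevalley a b L) (t u : R) :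
      IsRelator (X a t * X b u * (X a t)⁻¹ * (X b u)⁻¹ *
        ((L.map fun k => X k.vec ((k.C : R) * t ^ k.m * u ^ k.n)).prod)⁻¹)
  | conj (e f : RootVec A) (hf : IsOpposite e f) (c : I → ℤ) (hc : IsCoroot A e.root c)
      (b b' : RootVec A) (hroot : b'.root = b.root - pairing A c b.root • e.root)
      (hvec : b'.vec = sStar e.vec f.vec b.vec) (r : Rˣ) (t : R) :
      IsRelator (sTilde e f r * X b t * (sTilde e f r)⁻¹ *
        (X b' (((r ^ pairing A c b'.root : Rˣ) : R) * t))⁻¹)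

/-- The Steinberg group `St_A(R)`. -/
abbrev St : Type _ := PresentedGroup {x | IsRelator A R x}

end

end SteinbergGroup

namespace SteinbergGroup

/-! ### Exponentials of locally nilpotent operators -/

section LocallyNilpotent

variable {V : Type*} [AddCommGroup V] [Module ℂ V]

/-! The elements s̃_i(1) conjugate X_e(t) to X_{s_i^*(e)}(t), and every root vector is, up to sign,
a W*-translate of some e_k. So a subgroup H that contains all the s̃_i(1) is the whole group as soon
as it contains every X_{e_k}(t) (`fg_of_simple_mem`). For each k the set T_k of all t with
X_{e_k}(t) ∈ H is an additive subgroup of R, and it remains to choose finitely many generators of H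
that force T_k = R.

If R is finite over a subring generated by units u, add the s̃_k(u) to H. Comparing s̃_k(u) with
s̃_k(1) shows u² T_k ⊆ T_k (`sq_mul_mem_coordSubgroup`). Each u is integral over ℤ[u²], so R is
still finite over the ring generated by the squares, and finitely many X_{e_k}(g) suffice.

If R is generated by a finite set G and the rank is at least 2, let H contain the X_{e_k}(m) for the
squarefree monomials m in G. Every node lies on an edge, and the Chevalley relation of that edge
makes T_k large. For a simple bond T_k is closed under products. For a double bond, with i short and
j long, tu ∈ T_i iff t²u ∈ T_j for t ∈ T_i, u ∈ T_j, and any monomial is a square times a squarefree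
one. For a triple bond the long roots form an A₂, so T_j = R; modulo the long root groups the
relation then gives (t² - t)u ∈ T_i for t ∈ T_i and all u, which lowers exponents one at a time.

To be usable, these relations must be verified in Aut 𝔤 with their exact constants. This rests on a
product formula for exponentials of locally nilpotent operators (`expSeries_add`), on Jacobi
computations along root strings, and on a W-invariant quadratic form that limits which mα_i + nα_j
are roots. -/

theorem finsum_eq_sum_range {M : Type*} [AddCommMonoid M] {u : ℕ → M} {N : ℕ}
    (hu : ∀ n, N ≤ n → u n = 0) : ∑ᶠ n, u n = ∑ n ∈ Finset.range N, u n := by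
  apply finsum_eq_sum_of_support_subset
  intro n hn
  by_contra h
  exact hn (hu n (by simpa using h))

theorem finsum_sum_antidiagonal {M : Type*} [AddCommMonoid M] {u : ℕ → ℕ → M} {N : ℕ}
    (hu : ∀ i j, N ≤ i + j → u i j = 0) :
    ∑ᶠ n, ∑ p ∈ Finset.HasAntidiagonal.antidiagonal n, u p.1 p.2 = ∑ᶠ i, ∑ᶠ j, u i j := by
  have h1 : ∀ i, ∑ᶠ j, u i j = ∑ j ∈ Finset.range (N - i), u i j := fun i =>
    finsum_eq_sum_range fun j hj => hu i j (by omega)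
  rw [finsum_eq_sum_range (N := N), finsum_eq_sum_range (N := N)]
  · simp_rw [h1, Finset.Nat.sum_antidiagonal_eq_sum_range_succ_mk]
    exact Finset.sum_range_diag_flip N u
  · intro i hi
    rw [h1, Nat.sub_eq_zero_of_le hi]
    simp
  · intro n hn
    refine Finset.sum_eq_zero fun p hp => hu _ _ ?_
    rw [Finset.HasAntidiagonal.mem_antidiagonal] at hp
    omega

/-- A power series of operators only finitely many of whose coefficients are nonzero on any given
vector. -/
def LocallyFinite (F : PowerSeries (Module.End ℂ V)) : Prop :=
  ∀ v, ∃ N, ∀ n, N ≤ n → PowerSeries.coeff n F v = 0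

/-- The value at `1` of a locally finite power series of operators. -/
noncomputable def sumAt (F : PowerSeries (Module.End ℂ V)) (v : V) : V :=
  ∑ᶠ n, PowerSeries.coeff n F v

/-- Only finitely many `coeff j G v` are nonzero, and each of them is killed by all high
coefficients of `F`, so one bound on `i + j` serves for all. -/
theorem LocallyFinite.mul_aux {F G : PowerSeries (Module.End ℂ V)} (hF : LocallyFinite F)
    (hG : LocallyFinite G) (v : V) : ∃ N, ∀ i j, N ≤ i + j →
      PowerSeries.coeff i F (PowerSeries.coeff j G v) = 0 := by
  obtain ⟨N, hN⟩ := hG v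
  choose M hM using fun j => hF (PowerSeries.coeff j G v)
  refine ⟨N + (Finset.range N).sup M, fun i j hij => ?_⟩
  by_cases hj : N ≤ j
  · rw [hN j hj, map_zero]
  · apply hM
    have : M j ≤ (Finset.range N).sup M := Finset.le_sup (by simpa using hj)
    omega

theorem coeff_mul_apply (F G : PowerSeries (Module.End ℂ V)) (n : ℕ) (v : V) :
    PowerSeries.coeff n (F * G) v = ∑ p ∈ Finset.HasAntidiagonal.antidiagonal n,
      PowerSeries.coeff p.1 F (PowerSeries.coeff p.2 G v) := by
  rw [PowerSeries.coeff_mul, LinearMap.sum_apply]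
  rfl

theorem LocallyFinite.mul {F G : PowerSeries (Module.End ℂ V)} (hF : LocallyFinite F)
    (hG : LocallyFinite G) : LocallyFinite (F * G) := by
  intro v
  obtain ⟨N, hN⟩ := hF.mul_aux hG v
  refine ⟨N, fun n hn => ?_⟩
  rw [coeff_mul_apply]
  refine Finset.sum_eq_zero fun p hp => hN _ _ ?_
  rw [Finset.HasAntidiagonal.mem_antidiagonal] at hp
  omega

theorem sumAt_mul {F G : PowerSeries (Module.End ℂ V)} (hF : LocallyFinite F)
    (hG : LocallyFinite G) (v : V) : sumAt (F * G) v = sumAt F (sumAt G v) := by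
  obtain ⟨N, hN⟩ := hF.mul_aux hG v
  obtain ⟨M, hM⟩ := hG v
  unfold sumAt
  simp_rw [coeff_mul_apply]
  rw [finsum_sum_antidiagonal hN]
  refine finsum_congr fun i => ?_
  rw [finsum_eq_sum_range (N := M) fun j hj => by rw [hM j hj, map_zero],
    finsum_eq_sum_range hM, map_sum]

/-- `x` is locally nilpotent. -/
def LocNil (x : Module.End ℂ V) : Prop := ∀ v, ∃ n, (x ^ n) v = 0

/-- The exponential of a locally nilpotent operator. -/
noncomputable def locExp (x : Module.End ℂ V) (v : V) : V :=
  ∑ᶠ n : ℕ, ((n.factorial : ℂ)⁻¹) • (x ^ n) v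

/-- The divided power `x ^ n / n!`. -/
noncomputable def dpow (x : Module.End ℂ V) (n : ℕ) : Module.End ℂ V :=
  ((n.factorial : ℂ)⁻¹) • x ^ n

/-- The power series `exp (x T)`. -/
noncomputable def expSeries (x : Module.End ℂ V) : PowerSeries (Module.End ℂ V) :=
  PowerSeries.mk (dpow x)

theorem sumAt_expSeries (x : Module.End ℂ V) : sumAt (expSeries x) = locExp x := by
  funext v
  simp [sumAt, expSeries, locExp, dpow]

theorem pow_apply_eq_zero_of_le {x : Module.End ℂ V} {v : V} {n m : ℕ} (h : (x ^ n) v = 0)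
    (hm : n ≤ m) : (x ^ m) v = 0 := by
  obtain ⟨k, rfl⟩ := Nat.exists_eq_add_of_le' hm
  rw [pow_add, Module.End.mul_apply, h, map_zero]

theorem LocNil.locallyFinite {x : Module.End ℂ V} (hx : LocNil x) :
    LocallyFinite (expSeries x) := by
  intro v
  obtain ⟨N, hN⟩ := hx v
  exact ⟨N, fun n hn => by simp [expSeries, dpow, pow_apply_eq_zero_of_le hN hn]⟩

theorem locNil_of_locallyFinite {x : Module.End ℂ V} (hx : LocallyFinite (expSeries x)) :
    LocNil x := by
  intro v
  obtain ⟨N, hN⟩ := hx v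
  refine ⟨N, ?_⟩
  simpa [expSeries, dpow, Nat.factorial_ne_zero] using hN N le_rfl

theorem LocNil.smul {x : Module.End ℂ V} (hx : LocNil x) (t : ℂ) : LocNil (t • x) := by
  intro v
  obtain ⟨n, hn⟩ := hx v
  exact ⟨n, by rw [smul_pow, LinearMap.smul_apply, hn, smul_zero]⟩

theorem LocNil.neg {x : Module.End ℂ V} (hx : LocNil x) : LocNil (-x) := by
  simpa using hx.smul (-1)

theorem locExp_eq_sum {x : Module.End ℂ V} {v : V} {N : ℕ} (h : (x ^ N) v = 0) :
    locExp x v = ∑ n ∈ Finset.range N, ((n.factorial : ℂ)⁻¹) • (x ^ n) v :=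
  finsum_eq_sum_range fun n hn => by rw [pow_apply_eq_zero_of_le h hn, smul_zero]

/-! ### Formal differentiation and the product formula for exponentials. -/

theorem dpow_succ (x : Module.End ℂ V) (n : ℕ) :
    ((n + 1 : ℕ) : ℂ) • dpow x (n + 1) = x * dpow x n := by
  rw [dpow, dpow, smul_smul, pow_succ', mul_smul_comm, Nat.factorial_succ]
  congr 1
  have : ((n + 1 : ℕ) : ℂ) ≠ 0 := by exact_mod_cast Nat.succ_ne_zero n
  have h2 : (n.factorial : ℂ) ≠ 0 := by exact_mod_cast n.factorial_ne_zero
  rw [Nat.cast_mul]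
  field_simp

/-- The formal derivative of a power series with noncommuting coefficients. -/
noncomputable def deriv (F : PowerSeries (Module.End ℂ V)) : PowerSeries (Module.End ℂ V) :=
  PowerSeries.mk fun n => ((n + 1 : ℕ) : ℂ) • PowerSeries.coeff (n + 1) F

theorem deriv_mul (F G : PowerSeries (Module.End ℂ V)) :
    deriv (F * G) = deriv F * G + F * deriv G := by
  ext1 n
  simp only [deriv, PowerSeries.coeff_mk, map_add, PowerSeries.coeff_mul]
  have h1 : ((n + 1 : ℕ) : ℂ) • ∑ p ∈ Finset.HasAntidiagonal.antidiagonal (n + 1),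
        PowerSeries.coeff p.1 F * PowerSeries.coeff p.2 G =
      ∑ p ∈ Finset.HasAntidiagonal.antidiagonal (n + 1),
        ((p.1 : ℂ) • PowerSeries.coeff p.1 F) * PowerSeries.coeff p.2 G +
      ∑ p ∈ Finset.HasAntidiagonal.antidiagonal (n + 1),
        PowerSeries.coeff p.1 F * ((p.2 : ℂ) • PowerSeries.coeff p.2 G) := by
    rw [Finset.smul_sum, ← Finset.sum_add_distrib]
    refine Finset.sum_congr rfl fun p hp => ?_
    rw [Finset.HasAntidiagonal.mem_antidiagonal] at hp
    rw [← hp, smul_mul_assoc, mul_smul_comm, ← add_smul, Nat.cast_add]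
  rw [h1, Finset.Nat.sum_antidiagonal_succ, Finset.Nat.sum_antidiagonal_succ']
  simp

/-- The equation F' = xF fixes the coefficients recursively because n + 1 is invertible in ℂ.
Identities between exponentials thus reduce to differentiating. -/
theorem eq_expSeries {F : PowerSeries (Module.End ℂ V)} {x : Module.End ℂ V}
    (h0 : PowerSeries.coeff 0 F = 1) (h : deriv F = PowerSeries.C x * F) :
    F = expSeries x := by
  ext1 n
  rw [expSeries, PowerSeries.coeff_mk]
  induction n with
  | zero => simp [h0, dpow]
  | succ n ih =>
    have h1 := congrArg (PowerSeries.coeff n) h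
    rw [deriv, PowerSeries.coeff_mk, PowerSeries.coeff_C_mul, ih, ← dpow_succ] at h1
    have : ((n + 1 : ℕ) : ℂ) ≠ 0 := by exact_mod_cast Nat.succ_ne_zero n
    exact smul_right_injective _ this h1

theorem deriv_expSeries (x : Module.End ℂ V) :
    deriv (expSeries x) = PowerSeries.C x * expSeries x := by
  ext1 n
  rw [deriv, PowerSeries.coeff_mk, PowerSeries.coeff_C_mul, expSeries, PowerSeries.coeff_mk,
    PowerSeries.coeff_mk, dpow_succ]

/-- The power series `exp (x T²)`. -/
noncomputable def expSeriesSq (x : Module.End ℂ V) : PowerSeries (Module.End ℂ V) :=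
  PowerSeries.mk fun n => if Even n then dpow x (n / 2) else 0

theorem deriv_expSeriesSq (x : Module.End ℂ V) :
    deriv (expSeriesSq x) = PowerSeries.C ((2 : ℂ) • x) * PowerSeries.X * expSeriesSq x := by
  ext1 n
  rw [mul_assoc, deriv, PowerSeries.coeff_mk, PowerSeries.coeff_C_mul, expSeriesSq,
    PowerSeries.coeff_mk]
  rcases n with _ | n
  · simp
  · rw [PowerSeries.coeff_succ_X_mul, PowerSeries.coeff_mk]
    by_cases hn : Even n
    · obtain ⟨k, rfl⟩ := hn
      have e1 : (k + k + 1 + 1) / 2 = k + 1 := by omega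
      have e2 : (k + k) / 2 = k := by omega
      rw [if_pos (show Even (k + k + 1 + 1) from ⟨k + 1, by ring⟩), if_pos ⟨k, rfl⟩, e1, e2, smul_mul_assoc, ← dpow_succ, smul_smul]
      congr 1
      push_cast
      ring
    · rw [if_neg hn, if_neg (by rw [Nat.even_add_one, Nat.even_add_one, not_not]; exact hn)]
      simp

theorem sumAt_expSeriesSq {x : Module.End ℂ V} (hx : LocNil x) :
    sumAt (expSeriesSq x) = locExp x := by
  funext v
  obtain ⟨N, hN⟩ := hx v
  rw [locExp_eq_sum hN, sumAt, finsum_eq_sum_range (N := 2 * N)]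
  · clear hN
    induction N with
    | zero => simp
    | succ N ih =>
      rw [show 2 * (N + 1) = 2 * N + 1 + 1 by ring, Finset.sum_range_succ, Finset.sum_range_succ, ih,
        Finset.sum_range_succ]
      simp [expSeriesSq, dpow]
  · intro n hn
    rw [expSeriesSq, PowerSeries.coeff_mk]
    split_ifs
    · rw [dpow, LinearMap.smul_apply, pow_apply_eq_zero_of_le hN (by omega), smul_zero]
    · rfl

theorem LocNil.locallyFiniteSq {x : Module.End ℂ V} (hx : LocNil x) :
    LocallyFinite (expSeriesSq x) := by
  intro v
  obtain ⟨N, hN⟩ := hx v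
  refine ⟨2 * N, fun n hn => ?_⟩
  rw [expSeriesSq, PowerSeries.coeff_mk]
  split_ifs
  · rw [dpow, LinearMap.smul_apply, pow_apply_eq_zero_of_le hN (by omega), smul_zero]
  · rfl

/-- The divided-power form of [aⁿ⁺¹, b] = (n + 1) c aⁿ. -/
theorem dpow_mul_eq {a b c : Module.End ℂ V} (hc : a * b = b * a + c) (hac : Commute a c) (n : ℕ) :
    dpow a (n + 1) * b = b * dpow a (n + 1) + c * dpow a n := by
  induction n with
  | zero => simp [dpow, hc]
  | succ n ih =>
    have : ((n + 1 + 1 : ℕ) : ℂ) ≠ 0 := by exact_mod_cast Nat.succ_ne_zero (n + 1)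
    apply smul_right_injective _ this
    simp only
    rw [← smul_mul_assoc, dpow_succ, mul_assoc, ih, mul_add, ← mul_assoc, hc, add_mul, mul_assoc,
      ← dpow_succ a (n + 1), ← mul_assoc a c, hac.eq, mul_assoc c a, ← dpow_succ a n, smul_add,
      mul_smul_comm, mul_smul_comm, add_assoc]
    congr 1
    rw [Nat.cast_succ (n + 1), add_smul, one_smul, add_comm]

theorem expSeries_mul_C {a b c : Module.End ℂ V} (hc : a * b = b * a + c) (hac : Commute a c) :
    expSeries a * PowerSeries.C b =
      (PowerSeries.C b + PowerSeries.C c * PowerSeries.X) * expSeries a := by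
  ext1 n
  rw [PowerSeries.coeff_mul_C, add_mul, map_add, PowerSeries.coeff_C_mul, mul_assoc,
    PowerSeries.coeff_C_mul, expSeries, PowerSeries.coeff_mk]
  rcases n with _ | n
  · simp [dpow]
  · rw [PowerSeries.coeff_succ_X_mul, PowerSeries.coeff_mk, dpow_mul_eq hc hac]

theorem commute_C_expSeries {x y : Module.End ℂ V} (h : Commute x y) :
    Commute (PowerSeries.C x) (expSeries y) := by
  ext1 n
  rw [PowerSeries.coeff_mul_C, PowerSeries.coeff_C_mul, expSeries, PowerSeries.coeff_mk, dpow]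
  exact ((h.pow_right n).smul_right _).eq

/-- Baker–Campbell–Hausdorff in nilpotency class two. Moving b to the left past exp(aT) produces an
extra cT, which the derivative of exp(-cT²/2) cancels; so the product solves F' = (a + b)F. -/
theorem expSeries_add {a b c : Module.End ℂ V} (hc : a * b = b * a + c) (hac : Commute a c)
    (hbc : Commute b c) :
    expSeries a * expSeries b * expSeriesSq (-((2 : ℂ)⁻¹ • c)) = expSeries (a + b) := by
  apply eq_expSeries
  · simp [PowerSeries.coeff_mul, expSeries, expSeriesSq, dpow]
  · rw [deriv_mul, deriv_mul, deriv_expSeries, deriv_expSeries, deriv_expSeriesSq]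
    have e : (2 : ℂ) • -((2 : ℂ)⁻¹ • c) = -c := by
      rw [smul_neg, smul_smul, mul_inv_cancel₀ two_ne_zero, one_smul]
    have k : PowerSeries.C (-c) * PowerSeries.X = -(PowerSeries.C c * PowerSeries.X) := by
      rw [map_neg, neg_mul]
    have k1 : expSeries a * expSeries b * (PowerSeries.C c * PowerSeries.X) =
        PowerSeries.C c * PowerSeries.X * (expSeries a * expSeries b) := by
      have h1 := commute_C_expSeries hac.symm
      have h2 := commute_C_expSeries hbc.symm
      have h3 := (h1.mul_right h2).mul_left (PowerSeries.commute_X (expSeries a * expSeries b)).symm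
      exact h3.eq.symm
    rw [e, k, ← mul_assoc _ (PowerSeries.C b), expSeries_mul_C hc hac, map_add]
    calc _ = PowerSeries.C a * expSeries a * expSeries b * expSeriesSq (-((2 : ℂ)⁻¹ • c)) +
          (PowerSeries.C b + PowerSeries.C c * PowerSeries.X) * expSeries a * expSeries b *
            expSeriesSq (-((2 : ℂ)⁻¹ • c)) -
          expSeries a * expSeries b * (PowerSeries.C c * PowerSeries.X) *
            expSeriesSq (-((2 : ℂ)⁻¹ • c)) := by noncomm_ring
      _ = _ := by rw [k1]; noncomm_ring

theorem locExp_add_of_central {a b c : Module.End ℂ V} (hc : a * b = b * a + c)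
    (hac : Commute a c) (hbc : Commute b c) (ha : LocNil a) (hb : LocNil b) (h : LocNil c) :
    LocNil (a + b) ∧
      locExp (a + b) = locExp a ∘ locExp b ∘ locExp (-((2 : ℂ)⁻¹ • c)) := by
  have hd : LocNil (-((2 : ℂ)⁻¹ • c)) := (h.smul _).neg
  have e := expSeries_add hc hac hbc
  constructor
  -- Local nilpotency of a + b is itself a consequence of the product formula, since products of
  -- locally finite series are locally finite.
  · apply locNil_of_locallyFinite
    rw [← e]
    exact (ha.locallyFinite.mul hb.locallyFinite).mul hd.locallyFiniteSq
  · funext v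
    rw [← sumAt_expSeries, ← e, sumAt_mul (ha.locallyFinite.mul hb.locallyFinite)
      hd.locallyFiniteSq, sumAt_mul ha.locallyFinite hb.locallyFinite, sumAt_expSeriesSq hd,
      sumAt_expSeries, sumAt_expSeries]
    rfl

theorem locExp_zero : locExp (0 : Module.End ℂ V) = id := by
  funext v
  rw [locExp_eq_sum (N := 1) (by simp)]
  simp

theorem locNil_zero : LocNil (0 : Module.End ℂ V) := fun _ => ⟨1, by simp⟩

theorem locExp_add {a b : Module.End ℂ V} (hab : Commute a b) (ha : LocNil a) (hb : LocNil b) :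
    LocNil (a + b) ∧ locExp (a + b) = locExp a ∘ locExp b := by
  have := locExp_add_of_central (a := a) (b := b) (c := 0) (by simpa using hab.eq)
    (Commute.zero_right _) (Commute.zero_right _) ha hb locNil_zero
  simpa [locExp_zero] using this

theorem locExp_neg_self {a : Module.End ℂ V} (ha : LocNil a) (v : V) :
    locExp (-a) (locExp a v) = v := by
  have := (locExp_add (Commute.refl a).neg_left ha.neg ha).2
  rw [neg_add_cancel, locExp_zero] at this
  exact (congrFun this v).symm

theorem locExp_linear_add {a : Module.End ℂ V} (ha : LocNil a) (v w : V) :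
    locExp a (v + w) = locExp a v + locExp a w := by
  obtain ⟨m, hm⟩ := ha v
  obtain ⟨n, hn⟩ := ha w
  have h1 := pow_apply_eq_zero_of_le hm (Nat.le_max_left m n)
  have h2 := pow_apply_eq_zero_of_le hn (Nat.le_max_right m n)
  rw [locExp_eq_sum h1, locExp_eq_sum h2, locExp_eq_sum (N := max m n), ← Finset.sum_add_distrib]
  · simp
  · rw [map_add, h1, h2, add_zero]

theorem locExp_linear_smul {a : Module.End ℂ V} (ha : LocNil a) (c : ℂ) (v : V) :
    locExp a (c • v) = c • locExp a v := by
  obtain ⟨m, hm⟩ := ha v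
  rw [locExp_eq_sum hm, locExp_eq_sum (N := m), Finset.smul_sum]
  · simp [smul_comm c]
  · rw [map_smul, hm, smul_zero]

end LocallyNilpotent

/-! ### Exponentials of locally ad-nilpotent elements of a Lie algebra -/

section Lie

variable {L : Type*} [LieRing L] [LieAlgebra ℂ L]

theorem ad_pow_lie (x y z : L) (n : ℕ) :
    ((LieAlgebra.ad ℂ L x) ^ n) ⁅y, z⁆ = ∑ p ∈ Finset.HasAntidiagonal.antidiagonal n,
      n.choose p.1 • ⁅((LieAlgebra.ad ℂ L x) ^ p.1) y, ((LieAlgebra.ad ℂ L x) ^ p.2) z⁆ := by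
  induction n with
  | zero => simp
  | succ n ih =>
    rw [Finset.sum_antidiagonal_choose_succ_nsmul (M := L) (fun i j =>
      ⁅((LieAlgebra.ad ℂ L x) ^ i) y, ((LieAlgebra.ad ℂ L x) ^ j) z⁆) n, pow_succ',
      Module.End.mul_apply, ih, map_sum, ← Finset.sum_add_distrib]
    refine Finset.sum_congr rfl fun ⟨i, j⟩ hij => ?_
    rw [n.choose_symm_of_eq_add (Finset.HasAntidiagonal.mem_antidiagonal.1 hij).symm, map_nsmul,
      LieAlgebra.ad_apply, leibniz_lie, pow_succ', pow_succ', Module.End.mul_apply,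
      Module.End.mul_apply, LieAlgebra.ad_apply, LieAlgebra.ad_apply, smul_add, add_comm]

/-- The elements on which `ad x` is nilpotent form a subalgebra. -/
def nilSubalgebra (x : L) : LieSubalgebra ℂ L where
  carrier := {y | ∃ n, ((LieAlgebra.ad ℂ L x) ^ n) y = 0}
  zero_mem' := ⟨0, by simp⟩
  add_mem' := by
    rintro y z ⟨m, hm⟩ ⟨n, hn⟩
    exact ⟨max m n, by
      rw [map_add, pow_apply_eq_zero_of_le hm (Nat.le_max_left m n),
        pow_apply_eq_zero_of_le hn (Nat.le_max_right m n), add_zero]⟩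
  smul_mem' := by
    rintro c y ⟨m, hm⟩
    exact ⟨m, by rw [map_smul, hm, smul_zero]⟩
  lie_mem' := by
    rintro y z ⟨m, hm⟩ ⟨n, hn⟩
    refine ⟨m + n, ?_⟩
    rw [ad_pow_lie]
    refine Finset.sum_eq_zero fun p hp => ?_
    rw [Finset.HasAntidiagonal.mem_antidiagonal] at hp
    by_cases h : m ≤ p.1
    · rw [pow_apply_eq_zero_of_le hm h, zero_lie, smul_zero]
    · rw [pow_apply_eq_zero_of_le hn (by omega : n ≤ p.2), lie_zero, smul_zero]

/-- Divided by n!, the Leibniz rule for the n-th power of a derivation becomes a Cauchy product. -/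
theorem locExp_ad_lie {x : L} (hx : LocNil (LieAlgebra.ad ℂ L x)) (y z : L) :
    locExp (LieAlgebra.ad ℂ L x) ⁅y, z⁆ =
      ⁅locExp (LieAlgebra.ad ℂ L x) y, locExp (LieAlgebra.ad ℂ L x) z⁆ := by
  obtain ⟨m, hm⟩ := hx y
  obtain ⟨n, hn⟩ := hx z
  let u : ℕ → ℕ → L := fun i j => ⁅dpow (LieAlgebra.ad ℂ L x) i y, dpow (LieAlgebra.ad ℂ L x) j z⁆
  have hu : ∀ i j, m + n ≤ i + j → u i j = 0 := by
    intro i j hij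
    by_cases h : m ≤ i
    · simp [u, dpow, pow_apply_eq_zero_of_le hm h]
    · simp [u, dpow, pow_apply_eq_zero_of_le hn (by omega : n ≤ j)]
  have key := finsum_sum_antidiagonal hu
  have h1 : ∀ k, ((k.factorial : ℂ)⁻¹) • ((LieAlgebra.ad ℂ L x) ^ k) ⁅y, z⁆ =
      ∑ p ∈ Finset.HasAntidiagonal.antidiagonal k, u p.1 p.2 := by
    intro k
    rw [ad_pow_lie, Finset.smul_sum]
    refine Finset.sum_congr rfl fun p hp => ?_
    rw [Finset.HasAntidiagonal.mem_antidiagonal] at hp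
    simp only [u, dpow, LinearMap.smul_apply, smul_lie, lie_smul, smul_smul]
    rw [← Nat.cast_smul_eq_nsmul ℂ, smul_smul]
    congr 1
    have h3 := Nat.add_choose_mul_factorial_mul_factorial p.1 p.2
    have h4 : (k.factorial : ℂ) = k.choose p.1 * p.1.factorial * p.2.factorial := by
      rw [← Nat.choose_symm_add, hp] at h3
      exact_mod_cast h3.symm
    have f1 : (p.1.factorial : ℂ) ≠ 0 := by exact_mod_cast p.1.factorial_ne_zero
    have f2 : (p.2.factorial : ℂ) ≠ 0 := by exact_mod_cast p.2.factorial_ne_zero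
    have f3 : (k.factorial : ℂ) ≠ 0 := by exact_mod_cast k.factorial_ne_zero
    field_simp
    rw [h4]
    ring
  have h2 : ∀ i, ∑ᶠ j, u i j = ⁅dpow (LieAlgebra.ad ℂ L x) i y, locExp (LieAlgebra.ad ℂ L x) z⁆ := by
    intro i
    rw [finsum_eq_sum_range (N := n) fun j hj => by
      simp [u, dpow, pow_apply_eq_zero_of_le hn hj], locExp_eq_sum hn, lie_sum]
    rfl
  rw [locExp]
  simp_rw [h1]
  rw [key]
  simp_rw [h2]
  rw [finsum_eq_sum_range (N := m) fun j hj => by simp [dpow, pow_apply_eq_zero_of_le hm hj],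
    locExp_eq_sum hm, sum_lie]
  rfl

/-- `exp (ad x)` as an automorphism of the Lie algebra. -/
noncomputable def expEquiv (x : L) (hx : LocNil (LieAlgebra.ad ℂ L x)) : L ≃ₗ⁅ℂ⁆ L where
  toFun := locExp (LieAlgebra.ad ℂ L x)
  map_add' := locExp_linear_add hx
  map_smul' := locExp_linear_smul hx
  map_lie' := locExp_ad_lie hx _ _
  invFun := locExp (LieAlgebra.ad ℂ L (-x))
  left_inv v := by rw [map_neg, locExp_neg_self hx]
  right_inv v := by
    have := locExp_neg_self hx.neg v
    rwa [neg_neg, ← map_neg] at this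

theorem ad_equiv_pow (φ : L ≃ₗ⁅ℂ⁆ L) (x v : L) (n : ℕ) :
    ((LieAlgebra.ad ℂ L (φ x)) ^ n) (φ v) = φ (((LieAlgebra.ad ℂ L x) ^ n) v) := by
  induction n with
  | zero => rfl
  | succ n ih =>
    rw [pow_succ', pow_succ', Module.End.mul_apply, Module.End.mul_apply, ih, LieAlgebra.ad_apply,
      LieAlgebra.ad_apply, LieEquiv.map_lie]

theorem LocNil.equiv {x : L} (hx : LocNil (LieAlgebra.ad ℂ L x)) (φ : L ≃ₗ⁅ℂ⁆ L) :
    LocNil (LieAlgebra.ad ℂ L (φ x)) := by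
  intro v
  obtain ⟨n, hn⟩ := hx (φ.symm v)
  refine ⟨n, ?_⟩
  have := ad_equiv_pow φ x (φ.symm v) n
  rwa [LieEquiv.apply_symm_apply, hn, map_zero] at this

theorem locExp_equiv {x : L} (hx : LocNil (LieAlgebra.ad ℂ L x)) (φ : L ≃ₗ⁅ℂ⁆ L) (v : L) :
    locExp (LieAlgebra.ad ℂ L (φ x)) (φ v) = φ (locExp (LieAlgebra.ad ℂ L x) v) := by
  obtain ⟨n, hn⟩ := hx v
  rw [locExp_eq_sum hn, locExp_eq_sum (N := n) (by rw [ad_equiv_pow, hn, map_zero]), map_sum]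
  simp [ad_equiv_pow]

/-- `exp (ad x) exp (ad y) exp (ad x)⁻¹ = exp (ad (exp (ad x) y))`. -/
theorem locExp_conj {x y : L} (hx : LocNil (LieAlgebra.ad ℂ L x))
    (hy : LocNil (LieAlgebra.ad ℂ L y)) :
    locExp (LieAlgebra.ad ℂ L x) ∘ locExp (LieAlgebra.ad ℂ L y) ∘ locExp (LieAlgebra.ad ℂ L (-x)) =
      locExp (LieAlgebra.ad ℂ L (locExp (LieAlgebra.ad ℂ L x) y)) := by
  funext v
  have := locExp_equiv hy (expEquiv x hx) ((expEquiv x hx).symm v)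
  rw [LieEquiv.apply_symm_apply] at this
  exact this.symm

theorem commute_ad {x y : L} (h : ⁅x, y⁆ = 0) :
    Commute (LieAlgebra.ad ℂ L x) (LieAlgebra.ad ℂ L y) := by
  refine LinearMap.ext fun v => ?_
  rw [Module.End.mul_apply, Module.End.mul_apply, LieAlgebra.ad_apply, LieAlgebra.ad_apply,
    LieAlgebra.ad_apply, LieAlgebra.ad_apply, leibniz_lie, h, zero_lie, zero_add]

theorem locExp_ad_add {x y : L} (h : ⁅x, y⁆ = 0) (hx : LocNil (LieAlgebra.ad ℂ L x))
    (hy : LocNil (LieAlgebra.ad ℂ L y)) :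
    LocNil (LieAlgebra.ad ℂ L (x + y)) ∧ locExp (LieAlgebra.ad ℂ L (x + y)) =
      locExp (LieAlgebra.ad ℂ L x) ∘ locExp (LieAlgebra.ad ℂ L y) := by
  rw [map_add]
  exact locExp_add (commute_ad h) hx hy

theorem locExp_ad_add_of_central {x y z : L} (h : ⁅x, y⁆ = z) (hxz : ⁅x, z⁆ = 0) (hyz : ⁅y, z⁆ = 0)
    (hx : LocNil (LieAlgebra.ad ℂ L x)) (hy : LocNil (LieAlgebra.ad ℂ L y))
    (hz : LocNil (LieAlgebra.ad ℂ L z)) :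
    LocNil (LieAlgebra.ad ℂ L (x + y)) ∧ locExp (LieAlgebra.ad ℂ L (x + y)) =
      locExp (LieAlgebra.ad ℂ L x) ∘ locExp (LieAlgebra.ad ℂ L y) ∘
        locExp (LieAlgebra.ad ℂ L (-((2 : ℂ)⁻¹ • z))) := by
  rw [map_add, map_neg, map_smul]
  refine locExp_add_of_central ?_ (commute_ad hxz) (commute_ad hyz) hx hy hz
  refine LinearMap.ext fun v => ?_
  rw [LinearMap.add_apply, Module.End.mul_apply, Module.End.mul_apply, LieAlgebra.ad_apply,
    LieAlgebra.ad_apply, LieAlgebra.ad_apply, LieAlgebra.ad_apply, LieAlgebra.ad_apply,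
    leibniz_lie, h, add_comm]

/-- `exp (ad x)`. -/
noncomputable def adExp (x : L) : L → L := locExp (LieAlgebra.ad ℂ L x)

/-- `ad x` is locally nilpotent. -/
def AdNil (x : L) : Prop := LocNil (LieAlgebra.ad ℂ L x)

theorem AdNil.smul {x : L} (hx : AdNil x) (t : ℂ) : AdNil (t • x) := by
  rw [AdNil, map_smul]
  exact LocNil.smul hx t

theorem AdNil.neg {x : L} (hx : AdNil x) : AdNil (-x) := by
  rw [AdNil, map_neg]
  exact LocNil.neg hx

theorem adExp_add {x y : L} (h : ⁅x, y⁆ = 0) (hx : AdNil x) (hy : AdNil y) :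
    AdNil (x + y) ∧ ∀ v, adExp (x + y) v = adExp x (adExp y v) :=
  ⟨(locExp_ad_add h hx hy).1, congrFun (locExp_ad_add h hx hy).2⟩

theorem adExp_comm {x y : L} (h : ⁅x, y⁆ = 0) (hx : AdNil x) (hy : AdNil y) (v : L) :
    adExp x (adExp y v) = adExp y (adExp x v) := by
  rw [← (adExp_add h hx hy).2, add_comm,
    (adExp_add (by rw [← lie_skew, h, neg_zero]) hy hx).2]

theorem adExp_add_of_central {x y z : L} (h : ⁅x, y⁆ = (2 : ℂ) • z) (hxz : ⁅x, z⁆ = 0)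
    (hyz : ⁅y, z⁆ = 0) (hx : AdNil x) (hy : AdNil y) (hz : AdNil z) :
    AdNil (x + y) ∧ ∀ v, adExp (x + y) v = adExp x (adExp y (adExp (-z) v)) := by
  have h1 := locExp_ad_add_of_central h (by rw [lie_smul, hxz, smul_zero])
    (by rw [lie_smul, hyz, smul_zero]) hx hy (hz.smul 2)
  rw [smul_smul, inv_mul_cancel₀ two_ne_zero, one_smul] at h1
  exact ⟨h1.1, congrFun h1.2⟩

theorem adExp_of_two {x y z : L} (h1 : ⁅x, y⁆ = z) (h2 : ⁅x, z⁆ = 0) : adExp x y = y + z := by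
  subst h1
  rw [adExp, locExp_eq_sum (N := 2) (by simpa [pow_succ] using h2)]
  simp [Finset.sum_range_succ]

theorem adExp_of_three {x y z w : L} (h1 : ⁅x, y⁆ = z) (h2 : ⁅x, z⁆ = (2 : ℂ) • w)
    (h3 : ⁅x, w⁆ = 0) : adExp x y = y + z + w := by
  subst h1
  rw [adExp, locExp_eq_sum (N := 3) (by simp [pow_succ, h2, h3])]
  simp [Finset.sum_range_succ, pow_succ, h2, Nat.factorial]

theorem adExp_of_four {x y z w v : L} (h1 : ⁅x, y⁆ = z) (h2 : ⁅x, z⁆ = (2 : ℂ) • w)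
    (h3 : ⁅x, w⁆ = (3 : ℂ) • v) (h4 : ⁅x, v⁆ = 0) : adExp x y = y + z + w + v := by
  subst h1
  rw [adExp, locExp_eq_sum (N := 4) (by simp [pow_succ, h2, h3, h4])]
  simp [Finset.sum_range_succ, pow_succ, h2, h3, Nat.factorial, smul_smul]
  norm_num

end Lie

/-! ### The Chevalley generators -/

noncomputable section

section Weights

variable {I : Type*} [Fintype I] {A : Matrix I I ℤ}

/-- The value of the weight `α` on `h_i`. -/
def weightAt (A : Matrix I I ℤ) (i : I) (α : I → ℤ) : ℤ := ∑ j, A i j * α j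

theorem weightAt_sub (i : I) (α β : I → ℤ) :
    weightAt A i (α - β) = weightAt A i α - weightAt A i β := by
  simp [weightAt, mul_sub]

theorem weightAt_add (i : I) (α β : I → ℤ) :
    weightAt A i (α + β) = weightAt A i α + weightAt A i β := by
  simp [weightAt, mul_add, Finset.sum_add_distrib]

theorem weightAt_smul (i : I) (c : ℤ) (α : I → ℤ) :
    weightAt A i (c • α) = c * weightAt A i α := by
  simp [weightAt, Finset.mul_sum, mul_left_comm]

end Weights

variable {I : Type*} [DecidableEq I] (A : Matrix I I ℤ)

/-- The quotient map from the free Lie algebra. -/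
def quotHom : FreeLieAlgebra ℂ (CartanMatrix.Generators I) →ₗ⁅ℂ⁆ 𝔤 A where
  toFun := LieSubmodule.Quotient.mk (N := CartanMatrix.Relations.toIdeal ℂ A)
  map_add' _ _ := rfl
  map_smul' _ _ := rfl
  map_lie' := rfl

theorem quotHom_of (x : CartanMatrix.Generators I) : quotHom A (FreeLieAlgebra.of ℂ x) = gen A x :=
  rfl

theorem quotHom_surjective : Function.Surjective (quotHom A) :=
  LieSubmodule.Quotient.surjective_mk' (CartanMatrix.Relations.toIdeal ℂ A)

theorem quotHom_relation {x : FreeLieAlgebra ℂ (CartanMatrix.Generators I)}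
    (hx : x ∈ CartanMatrix.Relations.toSet ℂ A) : quotHom A x = 0 :=
  (LieSubmodule.Quotient.mk_eq_zero' (N := CartanMatrix.Relations.toIdeal ℂ A)).mpr
    (LieSubmodule.subset_lieSpan hx)

theorem quotHom_ad_pow (x y : FreeLieAlgebra ℂ (CartanMatrix.Generators I)) (n : ℕ) :
    quotHom A (((LieAlgebra.ad ℂ _ x) ^ n) y) =
      ((LieAlgebra.ad ℂ _ (quotHom A x)) ^ n) (quotHom A y) := by
  induction n with
  | zero => rfl
  | succ n ih =>
    rw [pow_succ', pow_succ', Module.End.mul_apply, Module.End.mul_apply, ← ih,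
      LieAlgebra.ad_apply, LieAlgebra.ad_apply, LieHom.map_lie]

theorem lie_h_e (i j : I) : ⁅h A i, e A j⁆ = (A i j : ℂ) • e A j := by
  have := quotHom_relation A (x := CartanMatrix.Relations.HE ℂ A (i, j))
    (by simp [CartanMatrix.Relations.toSet])
  simp only [CartanMatrix.Relations.HE, Function.uncurry, Function.comp, map_sub, LieHom.map_lie,
    quotHom_of, map_zsmul] at this
  rw [Int.cast_smul_eq_zsmul]
  exact sub_eq_zero.mp this

theorem lie_h_f (i j : I) : ⁅h A i, f A j⁆ = -(A i j : ℂ) • f A j := by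
  have := quotHom_relation A (x := CartanMatrix.Relations.HF ℂ A (i, j))
    (by simp [CartanMatrix.Relations.toSet])
  simp only [CartanMatrix.Relations.HF, Function.uncurry, Function.comp, map_add, LieHom.map_lie,
    quotHom_of, map_zsmul] at this
  rw [neg_smul, Int.cast_smul_eq_zsmul, f, lie_neg, smul_neg]
  exact congrArg Neg.neg (eq_neg_of_add_eq_zero_left this)

theorem lie_e_f_self (i : I) : ⁅e A i, f A i⁆ = -h A i := by
  have := quotHom_relation A (x := CartanMatrix.Relations.EF ℂ (i, i))
    (by simp [CartanMatrix.Relations.toSet])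
  simp only [CartanMatrix.Relations.EF, Function.uncurry, Function.comp, map_sub, LieHom.map_lie,
    quotHom_of, if_true] at this
  rw [f, lie_neg]
  exact congrArg Neg.neg (sub_eq_zero.mp this)

theorem lie_e_f_of_ne {i j : I} (hij : i ≠ j) : ⁅e A i, f A j⁆ = 0 := by
  have := quotHom_relation A (x := CartanMatrix.Relations.EF ℂ (i, j))
    (by simp [CartanMatrix.Relations.toSet])
  simp only [CartanMatrix.Relations.EF, Function.uncurry, Function.comp, LieHom.map_lie,
    quotHom_of, if_neg hij] at this
  rw [f, lie_neg]
  exact neg_eq_zero.mpr this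

/-- The Serre relation in the presentation applies `(-A i j).toNat` further powers of ad e_i to
[e_i, e_j]; hence the `+ 1`. When A_ii ≥ 0 the truncation turns the diagonal case into [e_i, e_i] =
0. -/
theorem ad_e_pow (i j : I) : ((LieAlgebra.ad ℂ _ (e A i)) ^ ((-A i j).toNat + 1)) (e A j) = 0 := by
  have := quotHom_relation A (x := CartanMatrix.Relations.adE ℂ A (i, j))
    (by simp [CartanMatrix.Relations.toSet])
  simp only [CartanMatrix.Relations.adE, Function.uncurry, Function.comp, quotHom_ad_pow,
    LieHom.map_lie, quotHom_of] at this
  rw [pow_succ, Module.End.mul_apply]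
  exact this

theorem ad_f_pow (i j : I) : ((LieAlgebra.ad ℂ _ (f A i)) ^ ((-A i j).toNat + 1)) (f A j) = 0 := by
  have := quotHom_relation A (x := CartanMatrix.Relations.adF ℂ A (i, j))
    (by simp [CartanMatrix.Relations.toSet])
  simp only [CartanMatrix.Relations.adF, Function.uncurry, Function.comp, quotHom_ad_pow,
    LieHom.map_lie, quotHom_of] at this
  rw [pow_succ, Module.End.mul_apply, LieAlgebra.ad_apply]
  simp only [f, lie_neg, neg_lie, neg_neg, map_neg]
  rw [neg_pow, Module.End.mul_apply, this, map_zero]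

/-- A subalgebra containing the generators is everything. -/
theorem mem_of_generators (K : LieSubalgebra ℂ (𝔤 A)) (he : ∀ i, e A i ∈ K) (hf : ∀ i, f A i ∈ K)
    (x : 𝔤 A) : x ∈ K := by
  have hh : ∀ i, h A i ∈ K := fun i => by
    have := K.neg_mem (K.lie_mem (he i) (hf i))
    rwa [lie_e_f_self, neg_neg] at this
  have hgen : ∀ g : CartanMatrix.Generators I, gen A g ∈ K := by
    rintro (i | i | i)
    · exact hh i
    · exact he i
    · have := K.neg_mem (hf i)
      rwa [f, neg_neg] at this
  -- The quotient map from the free Lie algebra factors through K, because it does so on the free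
  -- generators.
  let φ : FreeLieAlgebra ℂ (CartanMatrix.Generators I) →ₗ⁅ℂ⁆ K :=
    FreeLieAlgebra.lift ℂ fun g => ⟨gen A g, hgen g⟩
  have hφ : K.incl.comp φ = quotHom A := by
    apply FreeLieAlgebra.hom_ext
    intro g
    simp [φ, quotHom_of]
  obtain ⟨y, rfl⟩ := quotHom_surjective A x
  rw [← hφ]
  exact (φ y).2

variable {A}

theorem lie_f_e_self (i : I) : ⁅f A i, e A i⁆ = h A i := by
  rw [← lie_skew, lie_e_f_self, neg_neg]

theorem lie_f_e_of_ne {i j : I} (hij : i ≠ j) : ⁅f A i, e A j⁆ = 0 := by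
  rw [← lie_skew, lie_e_f_of_ne A hij.symm, neg_zero]

theorem lie_e_h (i j : I) : ⁅e A i, h A j⁆ = -(A j i : ℂ) • e A i := by
  rw [← lie_skew, lie_h_e, neg_smul]

theorem lie_f_h (i j : I) : ⁅f A i, h A j⁆ = (A j i : ℂ) • f A i := by
  rw [← lie_skew, lie_h_f, neg_smul, neg_neg]

/-- Only generators need testing. The Serre relations handle e_j, and f_i is killed by the third
power along f_i ↦ -h_i ↦ multiple of e_i ↦ 0. -/
theorem locNil_e (i : I) : LocNil (LieAlgebra.ad ℂ (𝔤 A) (e A i)) := by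
  refine mem_of_generators A (nilSubalgebra (e A i)) (fun j => ⟨_, ad_e_pow A i j⟩) fun j => ?_
  refine ⟨3, ?_⟩
  by_cases hij : i = j
  · subst hij
    simp [pow_succ, lie_e_f_self, lie_e_h]
  · simp [pow_succ, lie_e_f_of_ne A hij]

theorem locNil_f (i : I) : LocNil (LieAlgebra.ad ℂ (𝔤 A) (f A i)) := by
  refine mem_of_generators A (nilSubalgebra (f A i)) (fun j => ?_) fun j => ⟨_, ad_f_pow A i j⟩
  refine ⟨3, ?_⟩
  by_cases hij : i = j
  · subst hij
    simp [pow_succ, lie_f_e_self, lie_f_h]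
  · simp [pow_succ, lie_f_e_of_ne hij]

theorem expAd_eq (x : 𝔤 A) : expAd x = locExp (LieAlgebra.ad ℂ (𝔤 A) x) := rfl

theorem expAd_of_lie_eq_zero {x y : 𝔤 A} (h1 : ⁅x, y⁆ = 0) : expAd x y = y := by
  rw [expAd_eq, locExp_eq_sum (N := 1) (by simpa using h1)]
  simp

theorem expAd_of_two {x y z : 𝔤 A} (h1 : ⁅x, y⁆ = z) (h2 : ⁅x, z⁆ = 0) : expAd x y = y + z :=
  adExp_of_two h1 h2

theorem expAd_of_three {x y z w : 𝔤 A} (h1 : ⁅x, y⁆ = z) (h2 : ⁅x, z⁆ = (2 : ℂ) • w)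
    (h3 : ⁅x, w⁆ = 0) : expAd x y = y + z + w :=
  adExp_of_three h1 h2 h3

theorem expAd_of_four {x y z w v : 𝔤 A} (h1 : ⁅x, y⁆ = z) (h2 : ⁅x, z⁆ = (2 : ℂ) • w)
    (h3 : ⁅x, w⁆ = (3 : ℂ) • v) (h4 : ⁅x, v⁆ = 0) : expAd x y = y + z + w + v :=
  adExp_of_four h1 h2 h3 h4

/-- The automorphism `s_i^*`. -/
def sEquiv (A : Matrix I I ℤ) (i : I) : 𝔤 A ≃ₗ⁅ℂ⁆ 𝔤 A :=
  ((expEquiv (e A i) (locNil_e i)).trans (expEquiv (f A i) (locNil_f i))).trans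
    (expEquiv (e A i) (locNil_e i))

theorem sEquiv_apply (i : I) (x : 𝔤 A) :
    sEquiv A i x = expAd (e A i) (expAd (f A i) (expAd (e A i) x)) := rfl

theorem coe_sEquiv (i : I) : (sEquiv A i : 𝔤 A → 𝔤 A) = sStar (e A i) (f A i) := rfl

theorem expAd_add (i : I) (x y : 𝔤 A) : expAd (e A i) (x + y) = expAd (e A i) x + expAd (e A i) y :=
  locExp_linear_add (locNil_e i) x y

theorem expAd_e_smul (i : I) (c : ℂ) (x : 𝔤 A) : expAd (e A i) (c • x) = c • expAd (e A i) x :=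
  locExp_linear_smul (locNil_e i) c x

theorem expAd_f_add (i : I) (x y : 𝔤 A) :
    expAd (f A i) (x + y) = expAd (f A i) x + expAd (f A i) y :=
  locExp_linear_add (locNil_f i) x y

theorem expAd_f_smul (i : I) (c : ℂ) (x : 𝔤 A) : expAd (f A i) (c • x) = c • expAd (f A i) x :=
  locExp_linear_smul (locNil_f i) c x

theorem expAd_f_e (hd : ∀ i, A i i = 2) (i : I) : expAd (f A i) (e A i) = e A i + h A i + f A i := by
  refine expAd_of_three (lie_f_e_self i) ?_ (lie_self _)
  rw [lie_f_h, hd]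
  norm_num

theorem expAd_e_f (hd : ∀ i, A i i = 2) (i : I) : expAd (e A i) (f A i) = f A i - h A i + e A i := by
  rw [sub_eq_add_neg]
  refine expAd_of_three (lie_e_f_self A i) ?_ (lie_self _)
  rw [lie_neg, lie_e_h, hd, neg_smul, neg_neg]
  norm_num

theorem expAd_e_h (i j : I) : expAd (e A i) (h A j) = h A j - (A j i : ℂ) • e A i := by
  rw [sub_eq_add_neg, ← neg_smul]
  exact expAd_of_two (lie_e_h i j) (by simp)

theorem expAd_f_h (i j : I) : expAd (f A i) (h A j) = h A j + (A j i : ℂ) • f A i :=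
  expAd_of_two (lie_f_h i j) (by simp)

theorem sEquiv_e (hd : ∀ i, A i i = 2) (i : I) : sEquiv A i (e A i) = f A i := by
  rw [sEquiv_apply, expAd_of_lie_eq_zero (lie_self _), expAd_f_e hd, expAd_add, expAd_add,
    expAd_of_lie_eq_zero (lie_self _), expAd_e_h, expAd_e_f hd, hd, Int.cast_ofNat, two_smul]
  abel

theorem sEquiv_h (hd : ∀ i, A i i = 2) (i j : I) : sEquiv A i (h A j) = h A j - (A j i : ℂ) • h A i := by
  rw [sEquiv_apply, expAd_e_h, sub_eq_add_neg, ← neg_smul, expAd_f_add, expAd_f_smul,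
    expAd_f_h, expAd_f_e hd, expAd_add, expAd_add, expAd_e_smul, expAd_e_smul, expAd_add,
    expAd_add,
    expAd_of_lie_eq_zero (lie_self _), expAd_e_h, expAd_e_h, expAd_e_f hd, hd,
    Int.cast_ofNat]
  module

/-- `s_i^*` as an element of `W*`. -/
def sLin (A : Matrix I I ℤ) (i : I) : 𝔤 A ≃ₗ[ℂ] 𝔤 A := (sEquiv A i).toLinearEquiv

theorem sLin_mem (i : I) : sLin A i ∈ WStar A := Subgroup.subset_closure ⟨i, rfl⟩

/-! ### Root spaces and root vectors under the automorphisms s_i^*. -/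

section RootSpaces

variable [Fintype I]

theorem weightAt_single (i j : I) : weightAt A i (Pi.single j 1) = A i j := by
  simp [weightAt, Pi.single_apply]

theorem simpleReflection_eq (i : I) (v : I → ℤ) :
    simpleReflection A i v = v - weightAt A i v • Pi.single i 1 := rfl

theorem mem_rootSpace {α : I → ℤ} {x : 𝔤 A} :
    x ∈ rootSpace A α ↔ ∀ i, ⁅h A i, x⁆ = (weightAt A i α : ℂ) • x := by
  simp only [rootSpace, Set.mem_ofPred_eq, Int.cast_smul_eq_zsmul]
  rfl

theorem simpleReflection_simpleReflection (hd : ∀ i, A i i = 2) (i : I) (v : I → ℤ) :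
    simpleReflection A i (simpleReflection A i v) = v := by
  simp only [simpleReflection_eq, weightAt_sub, weightAt_smul, weightAt_single, hd]
  module

theorem e_mem_rootSpace (i : I) : e A i ∈ rootSpace A (Pi.single i 1) := by
  rw [mem_rootSpace]
  intro j
  rw [weightAt_single, lie_h_e]

theorem neg_mem_rootSpace {α : I → ℤ} {x : 𝔤 A} (hx : x ∈ rootSpace A α) :
    -x ∈ rootSpace A α := by
  rw [mem_rootSpace] at hx ⊢
  intro j
  rw [lie_neg, hx, smul_neg]

/-- s_i^* sends h_j - A_ji h_i to h_j, and the value of α on the former equals the value of s_i α on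
the latter. -/
theorem sEquiv_mem_rootSpace (hd : ∀ i, A i i = 2) (i : I) {α : I → ℤ} {x : 𝔤 A}
    (hx : x ∈ rootSpace A α) : sEquiv A i x ∈ rootSpace A (simpleReflection A i α) := by
  rw [mem_rootSpace] at hx ⊢
  intro j
  have h1 : sEquiv A i (h A j - (A j i : ℂ) • h A i) = h A j := by
    rw [map_sub, map_smul, sEquiv_h hd, sEquiv_h hd, hd, Int.cast_ofNat]
    module
  rw [← h1, ← LieEquiv.map_lie, sub_lie, smul_lie, hx, hx, ← smul_assoc, ← sub_smul, map_smul,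
    simpleReflection_eq, weightAt_sub, weightAt_smul, weightAt_single]
  push_cast
  rw [smul_eq_mul, mul_comm (A j i : ℂ)]

theorem sEquiv_symm_mem_rootSpace (hd : ∀ i, A i i = 2) (i : I) {α : I → ℤ} {x : 𝔤 A}
    (hx : x ∈ rootSpace A α) : (sEquiv A i).symm x ∈ rootSpace A (simpleReflection A i α) := by
  rw [mem_rootSpace] at hx ⊢
  intro j
  have h1 : (sEquiv A i).symm (h A j - (A j i : ℂ) • h A i) = h A j := by
    rw [← sEquiv_h hd, LieEquiv.symm_apply_apply]
  rw [← h1, ← LieEquiv.map_lie, sub_lie, smul_lie, hx, hx, ← smul_assoc, ← sub_smul, map_smul,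
    simpleReflection_eq, weightAt_sub, weightAt_smul, weightAt_single]
  push_cast
  rw [smul_eq_mul, mul_comm (A j i : ℂ)]

theorem sStar_image_rootSpace (hd : ∀ i, A i i = 2) (i : I) (α : I → ℤ) :
    sStar (e A i) (f A i) '' rootSpace A α = rootSpace A (simpleReflection A i α) := by
  rw [← coe_sEquiv]
  apply Set.Subset.antisymm
  · rintro _ ⟨x, hx, rfl⟩
    exact sEquiv_mem_rootSpace hd i hx
  · intro x hx
    refine ⟨(sEquiv A i).symm x, ?_, LieEquiv.apply_symm_apply _ _⟩
    have := sEquiv_symm_mem_rootSpace hd i hx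
    rwa [simpleReflection_simpleReflection hd] at this

theorem simpleReflection_single_self (hd : ∀ i, A i i = 2) (i : I) :
    simpleReflection A i (Pi.single i 1) = -Pi.single i 1 := by
  rw [simpleReflection_eq, weightAt_single, hd, two_smul]
  abel

namespace RootVec

theorem ext' {a b : RootVec A} (h1 : a.root = b.root) (h2 : a.vec = b.vec) : a = b := by
  cases a; cases b; congr

/-- The root vector `e_i`. -/
def simple (A : Matrix I I ℤ) (i : I) : RootVec A where
  root := Pi.single i 1
  vec := e A i
  root_mem := ⟨[], i, rfl⟩
  vec_mem := e_mem_rootSpace i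
  vec_orbit := ⟨1, one_mem _, i, Or.inl rfl⟩

/-- The negative of a root vector. -/
def neg (b : RootVec A) : RootVec A where
  root := b.root
  vec := -b.vec
  root_mem := b.root_mem
  vec_mem := neg_mem_rootSpace b.vec_mem
  vec_orbit := by
    obtain ⟨φ, hφ, i, h1 | h1⟩ := b.vec_orbit
    · exact ⟨φ, hφ, i, Or.inr (by rw [h1])⟩
    · exact ⟨φ, hφ, i, Or.inl (by rw [h1, neg_neg])⟩

/-- The image of a root vector under `s_i^*`. -/
def reflect (hd : ∀ i, A i i = 2) (i : I) (b : RootVec A) : RootVec A where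
  root := simpleReflection A i b.root
  vec := sEquiv A i b.vec
  root_mem := by
    obtain ⟨w, j, hj⟩ := b.root_mem
    exact ⟨i :: w, j, by rw [hj]; rfl⟩
  vec_mem := sEquiv_mem_rootSpace hd i b.vec_mem
  vec_orbit := by
    obtain ⟨φ, hφ, j, h1⟩ := b.vec_orbit
    refine ⟨sLin A i * φ, mul_mem (sLin_mem i) hφ, j, ?_⟩
    rcases h1 with h1 | h1
    · exact Or.inl (by rw [h1]; rfl)
    · exact Or.inr (by rw [h1, map_neg]; rfl)

/-- The root vector `f_i`. -/
def simpleNeg (hd : ∀ i, A i i = 2) (i : I) : RootVec A := (simple A i).reflect hd i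

theorem simpleNeg_root (hd : ∀ i, A i i = 2) (i : I) :
    (simpleNeg hd i).root = -Pi.single i 1 := simpleReflection_single_self hd i

theorem simpleNeg_vec (hd : ∀ i, A i i = 2) (i : I) : (simpleNeg hd i).vec = f A i :=
  sEquiv_e hd i

/-- The elements of `WStar` are given only as linear maps. Closure induction shows that they
preserve the bracket, so they carry local ad-nilpotency over from e_i. -/
theorem locNil (b : RootVec A) : LocNil (LieAlgebra.ad ℂ (𝔤 A) b.vec) := by
  obtain ⟨φ, hφ, i, h1⟩ := b.vec_orbit
  have key : ∃ ψ : 𝔤 A ≃ₗ⁅ℂ⁆ 𝔤 A, ∀ x, ψ x = φ x := by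
    clear h1
    induction hφ using Subgroup.closure_induction with
    | mem φ hφ =>
      obtain ⟨j, hj⟩ := hφ
      exact ⟨sEquiv A j, fun x => by rw [hj, coe_sEquiv]⟩
    | one => exact ⟨LieEquiv.refl, fun x => rfl⟩
    | mul φ₁ φ₂ _ _ h1 h2 =>
      obtain ⟨ψ₁, h1⟩ := h1
      obtain ⟨ψ₂, h2⟩ := h2
      exact ⟨ψ₂.trans ψ₁, fun x => by rw [LieEquiv.trans_apply, h1, h2]; rfl⟩
    | inv φ _ h1 =>
      obtain ⟨ψ, h1⟩ := h1
      refine ⟨ψ.symm, fun x => ?_⟩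
      apply ψ.injective
      change ψ (ψ.symm x) = ψ (φ.symm x)
      rw [LieEquiv.apply_symm_apply, h1, LinearEquiv.apply_symm_apply]
  obtain ⟨ψ, hψ⟩ := key
  rw [← hψ] at h1
  have h2 := (locNil_e i).equiv ψ
  rcases h1 with h1 | h1
  · rwa [h1]
  · rw [h1, map_neg]
    exact h2.neg

end RootVec

theorem isOpposite_simple (hd : ∀ i, A i i = 2) (i : I) :
    IsOpposite (RootVec.simple A i) (RootVec.simpleNeg hd i) := by
  refine ⟨RootVec.simpleNeg_root hd i, ?_⟩
  rw [RootVec.simpleNeg_vec]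
  change sStar (e A i) (f A i) '' rootSpace A (Pi.single i 1) = rootSpace A (-Pi.single i 1) ∧
    sStar (e A i) (f A i) '' rootSpace A (-Pi.single i 1) = rootSpace A (Pi.single i 1)
  rw [sStar_image_rootSpace hd, sStar_image_rootSpace hd, simpleReflection_single_self hd]
  refine ⟨rfl, ?_⟩
  rw [← simpleReflection_single_self hd, simpleReflection_simpleReflection hd]

end RootSpaces

end

/-! ### Cartan matrices and rank two root subsystems -/

section PairVec

variable {I : Type*} [DecidableEq I]

/-- The combination `m α_i + n α_j`. -/
def pairVec (i j : I) (m n : ℤ) : I → ℤ := m • Pi.single i 1 + n • Pi.single j 1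

theorem pairVec_add (i j : I) (m n m' n' : ℤ) :
    pairVec i j m n + pairVec i j m' n' = pairVec i j (m + m') (n + n') := by
  simp only [pairVec]
  module

theorem nsmul_pairVec (i j : I) (k : ℕ) (m n : ℤ) :
    k • pairVec i j m n = pairVec i j (k * m) (k * n) := by
  simp only [pairVec]
  module

theorem pairVec_injective {i j : I} (hij : i ≠ j) {m n m' n' : ℤ}
    (h : pairVec i j m n = pairVec i j m' n') : m = m' ∧ n = n' := by
  have h1 := congrFun h i
  have h2 := congrFun h j
  simp only [pairVec, Pi.add_apply, Pi.smul_apply, Pi.single_eq_same, Pi.single_eq_of_ne hij,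
    Pi.single_eq_of_ne hij.symm, smul_eq_mul, mul_one, mul_zero, add_zero, zero_add] at h1 h2
  exact ⟨h1, h2⟩

theorem pairVec_one_zero (i j : I) : pairVec i j 1 0 = Pi.single i 1 := by simp [pairVec]

theorem pairVec_zero_one (i j : I) : pairVec i j 0 1 = Pi.single j 1 := by simp [pairVec]

theorem pairVec_nonneg (i j : I) {m n : ℤ} (hm : 0 ≤ m) (hn : 0 ≤ n) : 0 ≤ pairVec i j m n :=
  add_nonneg (smul_nonneg hm (Pi.single_nonneg.mpr zero_le_one))
    (smul_nonneg hn (Pi.single_nonneg.mpr zero_le_one))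

theorem pairVec_nonpos (i j : I) {m n : ℤ} (hm : m ≤ 0) (hn : n ≤ 0) : pairVec i j m n ≤ 0 := by
  have := pairVec_nonneg i j (neg_nonneg.mpr hm) (neg_nonneg.mpr hn)
  have e : pairVec i j (-m) (-n) = -pairVec i j m n := by
    simp only [pairVec]
    module
  rw [e] at this
  exact neg_nonneg.mp this

end PairVec

/-! ### The invariant quadratic form and the positive roots of rank two. -/

section RootCombinatorics

variable {I : Type*} [Fintype I] {A : Matrix I I ℤ}

theorem sum_symmetrized {d : I → ℤ} (hs : ∀ i j, d i * A i j = d j * A j i) (k : I) (v : I → ℤ) :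
    ∑ i, d i * v i * A i k = d k * weightAt A k v := by
  rw [weightAt, Finset.mul_sum]
  refine Finset.sum_congr rfl fun i _ => ?_
  linear_combination (v i) * hs i k

variable [DecidableEq I]

/-- The properties of the Cartan matrices of the ABCDEFG diagrams used below; `p` is the ratio of
the squared lengths of long and short roots, if there are two lengths. -/
structure IsCartanOfRatio (A : Matrix I I ℤ) (p : ℤ) : Prop where
  ratio : p = 2 ∨ p = 3
  diag : ∀ i, A i i = 2
  -- Simply laced diagrams are assigned p = 2. For p = 3 the diagram is G₂, whose only edge is
  -- triple, so simple bonds are confined to p = 2.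
  edge : ∀ i j, i ≠ j → (A i j = 0 ∧ A j i = 0) ∨ (p = 2 ∧ A i j = -1 ∧ A j i = -1) ∨
    (A i j = -1 ∧ A j i = -p) ∨ (A i j = -p ∧ A j i = -1)
  symmetrizable : ∃ d : I → ℤ, (∀ i, d i = 1 ∨ d i = p) ∧ ∀ i j, d i * A i j = d j * A j i
  nonsingular : ∀ v : I → ℤ, (∀ i, weightAt A i v = 0) → v = 0
  connected : ∀ P : I → Prop, (∀ i j, P i → A i j ≠ 0 → P j) → ∀ i j, P i → P j

/-- The quadratic form of a symmetrized Cartan matrix. -/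
def normForm (A : Matrix I I ℤ) (d v : I → ℤ) : ℤ := ∑ i, d i * v i * weightAt A i v

theorem sum_mul_single (g : I → ℤ) (k : I) :
    ∑ i, g i * (Pi.single k 1 : I → ℤ) i = g k := by
  simp [Pi.single_apply]

theorem normForm_add_smul_single {d : I → ℤ} (hd : ∀ i, A i i = 2)
    (hs : ∀ i j, d i * A i j = d j * A j i) (k : I) (c : ℤ) (v : I → ℤ) :
    normForm A d (v + c • Pi.single k 1) =
      normForm A d v + 2 * c * d k * weightAt A k v + 2 * c ^ 2 * d k := by
  have h1 : ∀ i, d i * (v + c • (Pi.single k 1 : I → ℤ)) i * weightAt A i (v + c • Pi.single k 1) =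
      d i * v i * weightAt A i v + c * (d i * v i * A i k) +
        (c * d i * weightAt A i v + c ^ 2 * (d i * A i k)) * (Pi.single k 1 : I → ℤ) i := by
    intro i
    rw [weightAt_add, weightAt_smul, weightAt_single, Pi.add_apply, Pi.smul_apply, smul_eq_mul]
    by_cases hik : i = k
    · subst hik
      rw [Pi.single_eq_same]
      ring
    · rw [Pi.single_eq_of_ne hik]
      ring
  simp only [normForm, h1, Finset.sum_add_distrib, ← Finset.mul_sum, sum_mul_single,
    sum_symmetrized hs, hd]
  ring

theorem normForm_simpleReflection {d : I → ℤ} (hd : ∀ i, A i i = 2)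
    (hs : ∀ i j, d i * A i j = d j * A j i) (k : I) (v : I → ℤ) :
    normForm A d (simpleReflection A k v) = normForm A d v := by
  rw [simpleReflection_eq, sub_eq_add_neg, ← neg_smul, normForm_add_smul_single hd hs]
  ring

theorem normForm_single {d : I → ℤ} (hd : ∀ i, A i i = 2) (k : I) :
    normForm A d (Pi.single k 1) = 2 * d k := by
  have : ∀ i, d i * (Pi.single k 1 : I → ℤ) i * weightAt A i (Pi.single k 1) =
      (d i * A i k) * (Pi.single k 1 : I → ℤ) i := by
    intro i
    rw [weightAt_single]
    ring
  simp only [normForm, this, sum_mul_single, hd]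
  ring

/-- The form is invariant under simple reflections, so on roots it takes only its values at simple
roots. -/
theorem normForm_root {d : I → ℤ} (hd : ∀ i, A i i = 2)
    (hs : ∀ i j, d i * A i j = d j * A j i) {α : I → ℤ} (hα : α ∈ roots A) :
    ∃ k, normForm A d α = 2 * d k := by
  obtain ⟨w, k, rfl⟩ := hα
  refine ⟨k, ?_⟩
  induction w with
  | nil => exact normForm_single hd k
  | cons i w ih =>
    rw [← ih]
    exact normForm_simpleReflection hd hs i _

theorem simpleReflection_pairVec_left (hd : ∀ i, A i i = 2) (i j : I) (m n : ℤ) :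
    simpleReflection A i (pairVec i j m n) = pairVec i j (-m - A i j * n) n := by
  simp only [simpleReflection_eq, pairVec, weightAt_add, weightAt_smul, weightAt_single, hd]
  module

theorem simpleReflection_pairVec_right (hd : ∀ i, A i i = 2) (i j : I) (m n : ℤ) :
    simpleReflection A j (pairVec i j m n) = pairVec i j m (-n - A j i * m) := by
  simp only [simpleReflection_eq, pairVec, weightAt_add, weightAt_smul, weightAt_single, hd]
  module

theorem normForm_pairVec {d : I → ℤ} (hd : ∀ i, A i i = 2)
    (hs : ∀ i j, d i * A i j = d j * A j i) (i j : I) (m n : ℤ) :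
    normForm A d (pairVec i j m n) =
      2 * d i * m ^ 2 + 2 * (d i * A i j) * m * n + 2 * d j * n ^ 2 := by
  have h0 : normForm A d 0 = 0 := by simp [normForm]
  have h1 := normForm_add_smul_single hd hs i m 0
  rw [h0, zero_add] at h1
  rw [pairVec, normForm_add_smul_single hd hs, h1, weightAt_smul, weightAt_single]
  have h2 : weightAt A i 0 = 0 := by simp [weightAt]
  rw [h2]
  linear_combination -2 * n * m * hs i j

namespace IsCartanOfRatio

variable {p : ℤ}

/-- The numbers a, b, c are proportional to squared lengths, and the equation compares the norm of
mα_i + nα_j with that of a simple root. This limits the roots from above; that the remaining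
candidates are roots follows later, from explicit root vectors. -/
theorem norm_cases (hA : IsCartanOfRatio A p) {i j : I} {m n : ℤ}
    (hr : pairVec i j m n ∈ roots A) :
    ∃ a b c : ℤ, (a = 1 ∨ a = p) ∧ (b = 1 ∨ b = p) ∧ (c = 1 ∨ c = p) ∧ a * A i j = b * A j i ∧
      a * m ^ 2 + a * A i j * m * n + b * n ^ 2 = c := by
  obtain ⟨d, hd, hs⟩ := hA.symmetrizable
  obtain ⟨k, hk⟩ := normForm_root hA.diag hs hr
  rw [normForm_pairVec hA.diag hs] at hk
  exact ⟨d i, d j, d k, hd i, hd j, hd k, hs i j, by linarith⟩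

theorem roots_A2 (hA : IsCartanOfRatio A 2) {i j : I} (h1 : A i j = -1) (h2 : A j i = -1)
    {m n : ℕ} (hr : pairVec i j m n ∈ roots A) :
    (m = 1 ∧ n = 0) ∨ (m = 0 ∧ n = 1) ∨ (m = 1 ∧ n = 1) := by
  obtain ⟨a, b, c, ha, hb, hc, hab, h⟩ := hA.norm_cases hr
  rw [h1] at h hab
  rw [h2] at hab
  obtain rfl : a = b := by linarith
  -- The value is c / a with a and c in {1, 2}.
  have hle : (m : ℤ) ^ 2 - m * n + n ^ 2 ≤ 2 := by
    rcases ha with rfl | rfl <;> rcases hc with rfl | rfl <;> nlinarith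
  have hm : m ≤ 1 := by
    by_contra hlt
    have : (2 : ℤ) ≤ m := by omega
    nlinarith [sq_nonneg ((m : ℤ) - 2 * n)]
  have hn : n ≤ 1 := by
    by_contra hlt
    have : (2 : ℤ) ≤ n := by omega
    nlinarith [sq_nonneg ((n : ℤ) - 2 * m)]
  interval_cases m <;> interval_cases n <;> simp at h ⊢ <;> omega

/-- Here α_i is short, and the norm equation reads (m - n)² + n² ∈ {1, 2}. -/
theorem roots_B2 (hA : IsCartanOfRatio A 2) {i j : I} (h1 : A i j = -2) (h2 : A j i = -1)
    {m n : ℕ} (hr : pairVec i j m n ∈ roots A) :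
    (m = 1 ∧ n = 0) ∨ (m = 0 ∧ n = 1) ∨ (m = 1 ∧ n = 1) ∨ (m = 2 ∧ n = 1) := by
  obtain ⟨a, b, c, ha, hb, hc, hab, h⟩ := hA.norm_cases hr
  rw [h1] at h hab
  rw [h2] at hab
  obtain rfl : a = 1 := by omega
  obtain rfl : b = 2 := by omega
  have hle : ((m : ℤ) - n) ^ 2 + n ^ 2 ≤ 2 := by
    rcases hc with rfl | rfl
    all_goals nlinarith
  have hn : n ≤ 1 := by
    by_contra hlt
    have : (2 : ℤ) ≤ n := by omega
    nlinarith [sq_nonneg ((m : ℤ) - n)]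
  have hm : m ≤ 2 := by
    by_contra hlt
    have : (2 : ℤ) ≤ m - n := by omega
    nlinarith
  interval_cases m <;> interval_cases n <;> simp at h ⊢ <;> omega

/-- The norm equation is q = m² - 3mn + 3n² ∈ {1, 3}. Both variables are bounded through 4q = (2m -
3n)² + 3n² = m² + 3(m - 2n)². -/
theorem roots_G2 (hA : IsCartanOfRatio A 3) {i j : I} (h1 : A i j = -3) (h2 : A j i = -1)
    {m n : ℕ} (hr : pairVec i j m n ∈ roots A) :
    (m = 1 ∧ n = 0) ∨ (m = 0 ∧ n = 1) ∨ (m = 1 ∧ n = 1) ∨ (m = 2 ∧ n = 1) ∨ (m = 3 ∧ n = 1) ∨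
      (m = 3 ∧ n = 2) := by
  obtain ⟨a, b, c, ha, hb, hc, hab, h⟩ := hA.norm_cases hr
  rw [h1] at h hab
  rw [h2] at hab
  obtain rfl : a = 1 := by omega
  obtain rfl : b = 3 := by omega
  have hle : (m : ℤ) ^ 2 - 3 * m * n + 3 * n ^ 2 ≤ 3 := by
    rcases hc with rfl | rfl <;> nlinarith
  have hn : n ≤ 2 := by
    by_contra hlt
    have : (3 : ℤ) ≤ n := by omega
    nlinarith [sq_nonneg (2 * (m : ℤ) - 3 * n)]
  have hm : m ≤ 3 := by
    by_contra hlt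
    have : (4 : ℤ) ≤ m := by omega
    nlinarith [sq_nonneg ((m : ℤ) - 2 * n)]
  interval_cases m <;> interval_cases n <;> simp at h ⊢ <;> omega

end IsCartanOfRatio

/-- The empty word makes both roots positive. The words supplied below represent the longest element
of the rank two Weyl group, of length 3, 4 or 6, which makes all positive roots of the subsystem
negative. -/
theorem isPrenilpotent_of_word (i j : I) {m n m' n' k l k' l' : ℤ} (w : List I)
    (h0 : 0 ≤ m ∧ 0 ≤ n) (h0' : 0 ≤ m' ∧ 0 ≤ n')
    (h1 : weylAct A w (pairVec i j m n) = pairVec i j k l)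
    (h2 : weylAct A w (pairVec i j m' n') = pairVec i j k' l') (h3 : k ≤ 0 ∧ l ≤ 0)
    (h4 : k' ≤ 0 ∧ l' ≤ 0) : IsPrenilpotent A (pairVec i j m n) (pairVec i j m' n') :=
  ⟨⟨[], pairVec_nonneg i j h0.1 h0.2, pairVec_nonneg i j h0'.1 h0'.2⟩, w, by
    rw [h1]; exact pairVec_nonpos i j h3.1 h3.2, by rw [h2]; exact pairVec_nonpos i j h4.1 h4.2⟩

theorem isPrenilpotent_A2 (hd : ∀ i, A i i = 2) {i j : I} (h1 : A i j = -1) (h2 : A j i = -1) :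
    IsPrenilpotent A (pairVec i j 1 0) (pairVec i j 0 1) := by
  refine isPrenilpotent_of_word i j [i, j, i] (by simp) (by simp) (k := 0) (l := -1) (k' := -1)
    (l' := 0) ?_ ?_ (by simp) (by simp) <;>
  simp only [weylAct, List.foldr, simpleReflection_pairVec_left hd,
    simpleReflection_pairVec_right hd, h1, h2] <;> norm_num

theorem isPrenilpotent_B2 (hd : ∀ i, A i i = 2) {i j : I} (h1 : A i j = -2) (h2 : A j i = -1) :
    IsPrenilpotent A (pairVec i j 1 0) (pairVec i j 0 1) := by
  refine isPrenilpotent_of_word i j [i, j, i, j] (by simp) (by simp) (k := -1) (l := 0) (k' := 0)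
    (l' := -1) ?_ ?_ (by simp) (by simp) <;>
  simp only [weylAct, List.foldr, simpleReflection_pairVec_left hd,
    simpleReflection_pairVec_right hd, h1, h2] <;> norm_num

theorem isPrenilpotent_G2 (hd : ∀ i, A i i = 2) {i j : I} (h1 : A i j = -3) (h2 : A j i = -1) :
    IsPrenilpotent A (pairVec i j 1 0) (pairVec i j 0 1) := by
  refine isPrenilpotent_of_word i j [i, j, i, j, i, j] (by simp) (by simp) (k := -1) (l := 0)
    (k' := 0) (l' := -1) ?_ ?_ (by simp) (by simp) <;>
  simp only [weylAct, List.foldr, simpleReflection_pairVec_left hd,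
    simpleReflection_pairVec_right hd, h1, h2] <;> norm_num

theorem isPrenilpotent_G2_long (hd : ∀ i, A i i = 2) {i j : I} (h1 : A i j = -3)
    (h2 : A j i = -1) : IsPrenilpotent A (pairVec i j 0 1) (pairVec i j 3 1) := by
  refine isPrenilpotent_of_word i j [i, j, i, j, i, j] (by simp) (by simp) (k := 0) (l := -1)
    (k' := -3) (l' := -1) ?_ ?_ (by simp) (by simp) <;>
  simp only [weylAct, List.foldr, simpleReflection_pairVec_left hd,
    simpleReflection_pairVec_right hd, h1, h2] <;> norm_num

end RootCombinatorics

/-! ### The ABCDEFG Cartan matrices -/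

section Types

theorem IsCartanOfRatio.of_reindex {I J : Type*} [Fintype I] [DecidableEq I] [Fintype J]
    [DecidableEq J] {A : Matrix I I ℤ} (f : I ≃ J) {p : ℤ}
    (h : IsCartanOfRatio (A.reindex f f) p) : IsCartanOfRatio A p where
  ratio := h.ratio
  diag i := by simpa using h.diag (f i)
  edge i j hij := by simpa using h.edge (f i) (f j) (f.injective.ne hij)
  symmetrizable := by
    obtain ⟨d, h1, h2⟩ := h.symmetrizable
    exact ⟨d ∘ f, fun i => h1 _, fun i j => by simpa using h2 (f i) (f j)⟩
  nonsingular v hv := by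
    have h1 := h.nonsingular (v ∘ f.symm) fun i => by
      have := hv (f.symm i)
      rw [weightAt] at this ⊢
      rw [← this, ← f.symm.sum_comp]
      rfl
    funext i
    simpa using congrFun h1 (f i)
  connected P hP i j hi := by
    have := h.connected (P ∘ f.symm) (fun i j hi hij => hP _ _ hi (by simpa using hij)) (f i) (f j)
      (by simpa using hi)
    simpa using this

theorem nonsingular_of_det_ne_zero {I : Type*} [Fintype I] [DecidableEq I] {A : Matrix I I ℤ}
    (h : A.det ≠ 0) (v : I → ℤ) (hv : ∀ i, weightAt A i v = 0) : v = 0 :=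
  Matrix.eq_zero_of_mulVec_eq_zero h (funext hv)

theorem det_ne_zero_of_nonsingular {I : Type*} [Fintype I] [DecidableEq I] {A : Matrix I I ℤ}
    (h : ∀ v : I → ℤ, (∀ i, weightAt A i v = 0) → v = 0) : A.det ≠ 0 := by
  intro h0
  obtain ⟨v, hv, hv0⟩ := Matrix.exists_mulVec_eq_zero_iff.mpr h0
  exact hv (h v fun i => congrFun hv0 i)

/-- Each node other than `o` is joined to one of smaller rank, so induction on the rank gives `P i ↔
P o`. -/
theorem connected_of_rank {I : Type*} {A : Matrix I I ℤ} (o : I) (r : I → ℕ)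
    (h : ∀ i, i ≠ o → ∃ j, r j < r i ∧ A i j ≠ 0 ∧ A j i ≠ 0) (P : I → Prop)
    (hP : ∀ i j, P i → A i j ≠ 0 → P j) (i j : I) (hi : P i) : P j := by
  have key : ∀ n i, r i = n → (P i ↔ P o) := by
    intro n
    induction n using Nat.strong_induction_on with
    | _ n ih =>
      intro i hi
      by_cases hio : i = o
      · rw [hio]
      · obtain ⟨j, hj, h1, h2⟩ := h i hio
        rw [← ih (r j) (hi ▸ hj) j rfl]
        exact ⟨fun h => hP _ _ h h1, fun h => hP _ _ h h2⟩
  exact (key _ j rfl).mpr ((key _ i rfl).mp hi)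

/-- The extension of a vector by zero. -/
def extendZero {n : ℕ} (v : Fin n → ℤ) (k : ℕ) : ℤ := if h : k < n then v ⟨k, h⟩ else 0

theorem extendZero_of_le {n : ℕ} (v : Fin n → ℤ) {k : ℕ} (h : n ≤ k) : extendZero v k = 0 :=
  dif_neg (by omega)

theorem extendZero_coe {n : ℕ} (v : Fin n → ℤ) (i : Fin n) : extendZero v i = v i :=
  dif_pos i.2

theorem weightAt_eq_sum_range {n : ℕ} {M : Matrix (Fin n) (Fin n) ℤ} (i : Fin n) (v : Fin n → ℤ)
    (a : ℕ → ℤ) (ha : ∀ j, M i j = a j) :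
    weightAt M i v = ∑ k ∈ Finset.range n, a k * extendZero v k := by
  rw [← Fin.sum_univ_eq_sum_range fun k => a k * extendZero v k]
  simp [weightAt, ha, extendZero_coe]

theorem sum_range_ite_mul {n : ℕ} (v : Fin n → ℤ) (c : ℤ) (m : ℕ) :
    ∑ k ∈ Finset.range n, (if k = m then c else 0) * extendZero v k = c * extendZero v m := by
  by_cases hm : m < n
  · simp [hm]
  · simp [extendZero_of_le v (not_lt.mp hm), hm]

/-- Solves the kernel equations along an unbranched chain of simple bonds: the entries form an
arithmetic progression that would vanish at index -1. -/
theorem eq_succ_mul_of_recurrence {u : ℕ → ℤ} {N : ℕ} (h0 : 1 ≤ N → 2 * u 0 = u 1)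
    (h : ∀ m, m + 2 ≤ N → 2 * u (m + 1) = u (m + 2) + u m) :
    ∀ k, k ≤ N → u k = (k + 1) * u 0 := by
  intro k
  induction k using Nat.strong_induction_on with
  | _ k ih =>
    intro hk
    match k, ih, hk with
    | 0, _, _ => simp
    | 1, _, hk => rw [← h0 hk]; norm_num
    | m + 2, ih, hk =>
      have h1 := ih (m + 1) (by omega) (by omega)
      have h2 := ih m (by omega) (by omega)
      have h3 := h m hk
      push_cast at *
      linear_combination 2 * h1 - h2 - h3

theorem eq_zero_of_extendZero {n N : ℕ} {v : Fin n → ℤ} (h : ∀ k, k ≤ N →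
    extendZero v k = (k + 1) * extendZero v 0) (h0 : extendZero v 0 = 0)
    (hN : ∀ k, N < k → k < n → extendZero v k = 0) : v = 0 := by
  funext i
  rw [← extendZero_coe v i]
  by_cases hi : i.val ≤ N
  · rw [h _ hi, h0, mul_zero]; rfl
  · exact hN _ (by omega) i.2

theorem isCartanOfRatio_A (n : ℕ) (hn : 1 ≤ n) : IsCartanOfRatio (CartanMatrix.A n) 2 where
  ratio := Or.inl rfl
  diag i := by simp [CartanMatrix.A]
  edge i j hij := by
    simp only [CartanMatrix.A, Matrix.of_apply, if_neg hij, if_neg hij.symm]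
    split_ifs <;> first | omega | simp
  symmetrizable := ⟨fun _ => 1, fun _ => Or.inl rfl, fun i j => by
    simp only [CartanMatrix.A, Matrix.of_apply, Fin.ext_iff]
    split_ifs <;> omega⟩
  connected := connected_of_rank ⟨0, hn⟩ Fin.val fun i hi => by
    have : i.val ≠ 0 := fun h => hi (Fin.ext h)
    refine ⟨⟨i.val - 1, by omega⟩, by simp only; omega, ?_⟩
    simp only [CartanMatrix.A, Matrix.of_apply, Fin.ext_iff]
    split_ifs <;> omega
  nonsingular v hv := by
    have h0 : 2 * extendZero v 0 = extendZero v 1 := by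
      have := hv ⟨0, hn⟩
      rw [weightAt_eq_sum_range _ _ fun k => (if k = 0 then 2 else 0) + (if k = 1 then -1 else 0)]
        at this
      · simp only [add_mul, Finset.sum_add_distrib, sum_range_ite_mul] at this
        linarith
      · intro j
        simp only [CartanMatrix.A, Matrix.of_apply, Fin.ext_iff]
        grind
    have h1 : ∀ m, m + 2 ≤ n →
        2 * extendZero v (m + 1) = extendZero v (m + 2) + extendZero v m := by
      intro m hm
      have := hv ⟨m + 1, by omega⟩
      rw [weightAt_eq_sum_range _ _ fun k => (if k = m + 1 then 2 else 0) +
        (if k = m + 2 then -1 else 0) + (if k = m then -1 else 0)] at this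
      · simp only [add_mul, Finset.sum_add_distrib, sum_range_ite_mul] at this
        linarith
      · intro j
        simp only [CartanMatrix.A, Matrix.of_apply, Fin.ext_iff]
        grind
    have h2 := eq_succ_mul_of_recurrence (fun _ => h0) h1
    refine eq_zero_of_extendZero h2 ?_ fun k _ _ => by omega
    -- Because of the extension by zero, the last row is also an instance of the recurrence; it
    -- yields 0 = (n + 1) v₀.
    have h3 := h2 n le_rfl
    rw [extendZero_of_le v le_rfl] at h3
    have : ((n : ℤ) + 1) ≠ 0 := by omega
    exact (mul_eq_zero.mp h3.symm).resolve_left this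

theorem isCartanOfRatio_B (n : ℕ) (hn : 2 ≤ n) : IsCartanOfRatio (CartanMatrix.B n) 2 where
  ratio := Or.inl rfl
  diag i := by simp
  edge i j hij := by
    simp only [CartanMatrix.B, Matrix.of_apply, if_neg hij, if_neg hij.symm]
    split_ifs <;> first | omega | simp
  symmetrizable := ⟨fun i => if i.val = n - 1 then 2 else 1, fun i => by
      simp only; split_ifs <;> simp, fun i j => by
    simp only [CartanMatrix.B, Matrix.of_apply, Fin.ext_iff]
    split_ifs <;> omega⟩
  connected := connected_of_rank ⟨0, by omega⟩ Fin.val fun i hi => by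
    have : i.val ≠ 0 := fun h => hi (Fin.ext h)
    refine ⟨⟨i.val - 1, by omega⟩, by simp only; omega, ?_⟩
    simp only [CartanMatrix.B, Matrix.of_apply, Fin.ext_iff]
    split_ifs <;> omega
  nonsingular v hv := by
    obtain ⟨N, rfl⟩ := Nat.exists_eq_add_of_le' hn
    have h0 : 1 ≤ N → 2 * extendZero v 0 = extendZero v 1 := by
      intro hN
      have := hv ⟨0, by omega⟩
      rw [weightAt_eq_sum_range _ _ fun k => (if k = 0 then 2 else 0) + (if k = 1 then -1 else 0)]
        at this
      · simp only [add_mul, Finset.sum_add_distrib, sum_range_ite_mul] at this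
        linarith
      · intro j
        simp only [CartanMatrix.B, Matrix.of_apply, Fin.ext_iff]
        grind
    have h1 : ∀ m, m + 2 ≤ N →
        2 * extendZero v (m + 1) = extendZero v (m + 2) + extendZero v m := by
      intro m hm
      have := hv ⟨m + 1, by omega⟩
      rw [weightAt_eq_sum_range _ _ fun k => (if k = m + 1 then 2 else 0) +
        (if k = m + 2 then -1 else 0) + (if k = m then -1 else 0)] at this
      · simp only [add_mul, Finset.sum_add_distrib, sum_range_ite_mul] at this
        linarith
      · intro j
        simp only [CartanMatrix.B, Matrix.of_apply, Fin.ext_iff]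
        grind
    have h2 := eq_succ_mul_of_recurrence h0 h1
    have h3 : 2 * extendZero v (N + 1) = extendZero v N := by
      have := hv ⟨N + 1, by omega⟩
      rw [weightAt_eq_sum_range _ _ fun k => (if k = N + 1 then 2 else 0) +
        (if k = N then -1 else 0)] at this
      · simp only [add_mul, Finset.sum_add_distrib, sum_range_ite_mul] at this
        linarith
      · intro j
        simp only [CartanMatrix.B, Matrix.of_apply, Fin.ext_iff]
        grind
    -- This is the row containing the entry -2. For N = 0 it has no left neighbour and must be
    -- treated apart.
    have h4 : 2 * extendZero v (N + 1) = (N + 2) * extendZero v 0 := by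
      have := hv ⟨N, by omega⟩
      rcases N with _ | N
      · rw [weightAt_eq_sum_range _ _ fun k => (if k = 0 then 2 else 0) +
          (if k = 1 then -2 else 0)] at this
        · simp only [add_mul, Finset.sum_add_distrib, sum_range_ite_mul] at this
          norm_num
          linarith
        · intro j
          simp only [CartanMatrix.B, Matrix.of_apply, Fin.ext_iff]
          grind
      · rw [weightAt_eq_sum_range _ _ fun k => (if k = N + 1 then 2 else 0) +
          (if k = N + 2 then -2 else 0) + (if k = N then -1 else 0)] at this
        · simp only [add_mul, Finset.sum_add_distrib, sum_range_ite_mul] at this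
          have h5 := h2 N (by omega)
          have h6 := h2 (N + 1) (by omega)
          push_cast at *
          linear_combination -this + 2 * h6 - h5
        · intro j
          simp only [CartanMatrix.B, Matrix.of_apply, Fin.ext_iff]
          grind
    have h5 := h2 N le_rfl
    have h6 : extendZero v 0 = 0 := by linarith
    refine eq_zero_of_extendZero h2 h6 fun k h7 h8 => ?_
    obtain rfl : k = N + 1 := by omega
    rw [h6, mul_zero] at h4
    linarith

theorem isCartanOfRatio_C (n : ℕ) (hn : 2 ≤ n) : IsCartanOfRatio (CartanMatrix.C n) 2 where
  ratio := Or.inl rfl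
  diag i := by simp
  edge i j hij := by
    simp only [CartanMatrix.C, Matrix.of_apply, if_neg hij, if_neg hij.symm]
    split_ifs <;> first | omega | simp
  symmetrizable := ⟨fun i => if i.val = n - 1 then 1 else 2, fun i => by
      simp only; split_ifs <;> simp, fun i j => by
    simp only [CartanMatrix.C, Matrix.of_apply, Fin.ext_iff]
    split_ifs <;> omega⟩
  connected := connected_of_rank ⟨0, by omega⟩ Fin.val fun i hi => by
    have : i.val ≠ 0 := fun h => hi (Fin.ext h)
    refine ⟨⟨i.val - 1, by omega⟩, by simp only; omega, ?_⟩
    simp only [CartanMatrix.C, Matrix.of_apply, Fin.ext_iff]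
    split_ifs <;> omega
  nonsingular := by
    apply nonsingular_of_det_ne_zero
    rw [← CartanMatrix.B_transpose, Matrix.det_transpose]
    exact det_ne_zero_of_nonsingular (isCartanOfRatio_B n hn).nonsingular

theorem isCartanOfRatio_D (n : ℕ) (hn : 4 ≤ n) : IsCartanOfRatio (CartanMatrix.D n) 2 where
  ratio := Or.inl rfl
  diag i := by simp
  edge i j hij := by
    simp only [CartanMatrix.D, Matrix.of_apply, if_neg hij, if_neg hij.symm]
    split_ifs <;> first | omega | simp
  symmetrizable := ⟨fun _ => 1, fun _ => Or.inl rfl, fun i j => by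
    simp only [CartanMatrix.D, Matrix.of_apply, Fin.ext_iff]
    split_ifs <;> omega⟩
  connected := connected_of_rank ⟨0, by omega⟩ Fin.val fun i hi => by
    have : i.val ≠ 0 := fun h => hi (Fin.ext h)
    by_cases hl : i.val + 1 = n
    · refine ⟨⟨n - 3, by omega⟩, by simp only; omega, ?_⟩
      simp only [CartanMatrix.D, Matrix.of_apply, Fin.ext_iff]
      split_ifs <;> omega
    · refine ⟨⟨i.val - 1, by omega⟩, by simp only; omega, ?_⟩
      simp only [CartanMatrix.D, Matrix.of_apply, Fin.ext_iff]
      split_ifs <;> omega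
  nonsingular v hv := by
    obtain ⟨N, rfl⟩ := Nat.exists_eq_add_of_le' hn
    have h0 : 2 * extendZero v 0 = extendZero v 1 := by
      have := hv ⟨0, by omega⟩
      rw [weightAt_eq_sum_range _ _ fun k => (if k = 0 then 2 else 0) + (if k = 1 then -1 else 0)]
        at this
      · simp only [add_mul, Finset.sum_add_distrib, sum_range_ite_mul] at this
        linarith
      · intro j
        simp only [CartanMatrix.D, Matrix.of_apply, Fin.ext_iff]
        grind
    have h1 : ∀ m, m + 2 ≤ N + 1 →
        2 * extendZero v (m + 1) = extendZero v (m + 2) + extendZero v m := by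
      intro m hm
      have := hv ⟨m + 1, by omega⟩
      rw [weightAt_eq_sum_range _ _ fun k => (if k = m + 1 then 2 else 0) +
        (if k = m + 2 then -1 else 0) + (if k = m then -1 else 0)] at this
      · simp only [add_mul, Finset.sum_add_distrib, sum_range_ite_mul] at this
        linarith
      · intro j
        simp only [CartanMatrix.D, Matrix.of_apply, Fin.ext_iff]
        grind
    have h2 := eq_succ_mul_of_recurrence (fun _ => h0) h1
    have h3 : 2 * extendZero v (N + 2) = extendZero v (N + 1) := by
      have := hv ⟨N + 2, by omega⟩
      rw [weightAt_eq_sum_range _ _ fun k => (if k = N + 2 then 2 else 0) +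
        (if k = N + 1 then -1 else 0)] at this
      · simp only [add_mul, Finset.sum_add_distrib, sum_range_ite_mul] at this
        linarith
      · intro j
        simp only [CartanMatrix.D, Matrix.of_apply, Fin.ext_iff]
        grind
    have h4 : 2 * extendZero v (N + 3) = extendZero v (N + 1) := by
      have := hv ⟨N + 3, by omega⟩
      rw [weightAt_eq_sum_range _ _ fun k => (if k = N + 3 then 2 else 0) +
        (if k = N + 1 then -1 else 0)] at this
      · simp only [add_mul, Finset.sum_add_distrib, sum_range_ite_mul] at this
        linarith
      · intro j
        simp only [CartanMatrix.D, Matrix.of_apply, Fin.ext_iff]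
        grind
    -- N + 1 is the branch node. Each of the leaves N + 2 and N + 3 carries half its value, so this
    -- row forces (N + 2) v₀ = (N + 1) v₀.
    have h5 : 2 * extendZero v (N + 1) = extendZero v N + extendZero v (N + 2) +
        extendZero v (N + 3) := by
      have := hv ⟨N + 1, by omega⟩
      rw [weightAt_eq_sum_range _ _ fun k => (if k = N + 1 then 2 else 0) +
        (if k = N then -1 else 0) + (if k = N + 2 then -1 else 0) +
        (if k = N + 3 then -1 else 0)] at this
      · simp only [add_mul, Finset.sum_add_distrib, sum_range_ite_mul] at this
        linarith
      · intro j
        simp only [CartanMatrix.D, Matrix.of_apply, Fin.ext_iff]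
        grind
    have h6 := h2 (N + 1) le_rfl
    have h7 := h2 N (by omega)
    push_cast at h6
    have h8 : extendZero v 0 = 0 := by linarith
    refine eq_zero_of_extendZero h2 h8 fun k h9 h10 => ?_
    rw [h8, mul_zero] at h6
    obtain rfl | rfl : k = N + 2 ∨ k = N + 3 := by omega
    · linarith
    · linarith

theorem isCartanOfRatio_E6 : IsCartanOfRatio CartanMatrix.E₆ 2 where
  ratio := Or.inl rfl
  diag := by decide
  edge i := by fin_cases i <;> decide
  symmetrizable := ⟨fun _ => 1, fun _ => Or.inl rfl, by decide⟩
  connected := connected_of_rank 5 (fun i => 5 - i.val) (by intro i; fin_cases i <;> decide)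
  nonsingular := nonsingular_of_det_ne_zero (by rw [CartanMatrix.E₆_det]; norm_num)

theorem isCartanOfRatio_E7 : IsCartanOfRatio CartanMatrix.E₇ 2 where
  ratio := Or.inl rfl
  diag := by decide
  edge i := by fin_cases i <;> decide
  symmetrizable := ⟨fun _ => 1, fun _ => Or.inl rfl, by decide⟩
  connected := connected_of_rank 6 (fun i => 6 - i.val) (by intro i; fin_cases i <;> decide)
  nonsingular := nonsingular_of_det_ne_zero (by rw [CartanMatrix.E₇_det]; norm_num)

theorem isCartanOfRatio_E8 : IsCartanOfRatio CartanMatrix.E₈ 2 where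
  ratio := Or.inl rfl
  diag := by decide
  edge i := by fin_cases i <;> decide
  symmetrizable := ⟨fun _ => 1, fun _ => Or.inl rfl, by decide⟩
  connected := connected_of_rank 7 (fun i => 7 - i.val) (by intro i; fin_cases i <;> decide)
  nonsingular := nonsingular_of_det_ne_zero (by rw [CartanMatrix.E₈_det]; norm_num)

theorem isCartanOfRatio_F4 : IsCartanOfRatio CartanMatrix.F₄ 2 where
  ratio := Or.inl rfl
  diag := by decide
  edge i := by fin_cases i <;> decide
  symmetrizable := ⟨![1, 1, 2, 2], by decide, by decide⟩
  connected := connected_of_rank 3 (fun i => 3 - i.val) (by intro i; fin_cases i <;> decide)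
  nonsingular := nonsingular_of_det_ne_zero (by rw [CartanMatrix.F₄_det]; norm_num)

theorem isCartanOfRatio_G2 : IsCartanOfRatio CartanMatrix.G₂ 3 where
  ratio := Or.inr rfl
  diag := by decide
  edge i := by fin_cases i <;> decide
  symmetrizable := ⟨![1, 3], by decide, by decide⟩
  connected := connected_of_rank 1 (fun i => 1 - i.val) (by intro i; fin_cases i <;> decide)
  nonsingular := nonsingular_of_det_ne_zero (by rw [CartanMatrix.G₂_det]; norm_num)

theorem IsABCDEFG.exists_ratio {I : Type*} [Fintype I] [DecidableEq I] {A : Matrix I I ℤ}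
    (hA : IsABCDEFG A) : ∃ p, IsCartanOfRatio A p := by
  obtain ⟨n, hn, f, h⟩ | ⟨n, hn, f, h⟩ | ⟨n, hn, f, h⟩ | ⟨n, hn, f, h⟩ | ⟨f, h⟩ | ⟨f, h⟩ |
    ⟨f, h⟩ | ⟨f, h⟩ | ⟨f, h⟩ := hA
  · exact ⟨2, .of_reindex f (h ▸ isCartanOfRatio_A n hn)⟩
  · exact ⟨2, .of_reindex f (h ▸ isCartanOfRatio_B n hn)⟩
  · exact ⟨2, .of_reindex f (h ▸ isCartanOfRatio_C n hn)⟩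
  · exact ⟨2, .of_reindex f (h ▸ isCartanOfRatio_D n hn)⟩
  · exact ⟨2, .of_reindex f (h ▸ isCartanOfRatio_E6)⟩
  · exact ⟨2, .of_reindex f (h ▸ isCartanOfRatio_E7)⟩
  · exact ⟨2, .of_reindex f (h ▸ isCartanOfRatio_E8)⟩
  · exact ⟨2, .of_reindex f (h ▸ isCartanOfRatio_F4)⟩
  · exact ⟨3, .of_reindex f (h ▸ isCartanOfRatio_G2)⟩

end Types

/-! ### Relations in the Steinberg group and the action of `W*` -/

noncomputable section

variable {I : Type*} [Fintype I] [DecidableEq I] {A : Matrix I I ℤ} {R : Type*} [CommRing R]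

/-- The element `X_b(t)` of the Steinberg group. -/
def xg (b : RootVec A) (t : R) : St A R := PresentedGroup.of (b, t)

/-- The element `s̃_e(r)` of the Steinberg group. -/
def sg (a b : RootVec A) (r : Rˣ) : St A R := xg a (r : R) * xg b ((r⁻¹ : Rˣ) : R) * xg a (r : R)

theorem mk_X (b : RootVec A) (t : R) :
    PresentedGroup.mk {x | IsRelator A R x} (X b t) = xg b t := rfl

theorem mk_relator {x : FreeGroup (RootVec A × R)} (hx : IsRelator A R x) :
    PresentedGroup.mk {x | IsRelator A R x} x = 1 :=
  (QuotientGroup.eq_one_iff _).mpr (Subgroup.subset_normalClosure hx)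

theorem mk_sTilde (a b : RootVec A) (r : Rˣ) :
    PresentedGroup.mk {x | IsRelator A R x} (sTilde a b r) = sg a b r := by
  simp only [sTilde, map_mul, mk_X, sg]

theorem xg_add (b : RootVec A) (t u : R) : xg b (t + u) = xg b t * xg b u := by
  have := mk_relator (IsRelator.add b t u)
  rw [map_mul, map_mul, map_inv, mk_X, mk_X, mk_X] at this
  exact (mul_inv_eq_one.mp this).symm

theorem xg_zero (b : RootVec A) : xg b (0 : R) = 1 := by
  have := xg_add b (0 : R) 0
  rwa [add_zero, left_eq_mul] at this

theorem xg_neg (b : RootVec A) (t : R) : xg b (-t) = (xg b t)⁻¹ := by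
  rw [eq_inv_iff_mul_eq_one, ← xg_add, neg_add_cancel, xg_zero]

theorem xg_neg_vec (b : RootVec A) (t : R) : xg b.neg t = (xg b t)⁻¹ := by
  have := mk_relator (IsRelator.neg b b.neg rfl rfl t)
  rw [map_mul, map_inv, mk_X, mk_X] at this
  rw [mul_inv_eq_one.mp this, xg_neg]

theorem xg_chevalley {a b : RootVec A} {L : List (ChevalleyTerm A)} (hL : IsChevalley a b L)
    (t u : R) : xg a t * xg b u * (xg a t)⁻¹ * (xg b u)⁻¹ =
      (L.map fun k => xg k.vec ((k.C : R) * t ^ k.m * u ^ k.n)).prod := by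
  have := mk_relator (IsRelator.chevalley a b L hL t u)
  rw [map_mul, map_mul, map_mul, map_mul, map_inv, map_inv, map_inv, mk_X, mk_X, map_list_prod,
    List.map_map] at this
  exact mul_inv_eq_one.mp this

theorem pairing_single (i : I) (v : I → ℤ) : pairing A (Pi.single i 1) v = weightAt A i v := by
  simp [pairing, weightAt, Pi.single_apply]

/-- The exponent is negated because the relator uses ⟨α_i^∨, s_i β⟩ = -⟨α_i^∨, β⟩. -/
theorem sg_conj (hd : ∀ i, A i i = 2) (i : I) (b : RootVec A) (r : Rˣ) (t : R) :
    sg (RootVec.simple A i) (RootVec.simpleNeg hd i) r * xg b t *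
      (sg (RootVec.simple A i) (RootVec.simpleNeg hd i) r)⁻¹ =
    xg (b.reflect hd i) (((r ^ (-weightAt A i b.root) : Rˣ) : R) * t) := by
  have := mk_relator (IsRelator.conj (RootVec.simple A i) (RootVec.simpleNeg hd i)
    (isOpposite_simple hd i) (Pi.single i 1) ⟨[], i, rfl, rfl⟩ b (b.reflect hd i)
    (by rw [pairing_single]; rfl) (by rw [RootVec.simpleNeg_vec]; rfl) r t)
  rw [map_mul, map_mul, map_mul, map_inv, map_inv, mk_X, mk_X, mk_sTilde, pairing_single] at this
  have e : weightAt A i (b.reflect hd i).root = -weightAt A i b.root := by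
    change weightAt A i (simpleReflection A i b.root) = _
    rw [simpleReflection_eq, weightAt_sub, weightAt_smul, weightAt_single, hd]
    ring
  rw [e] at this
  exact mul_inv_eq_one.mp this

/-! ### Transport of root groups by elements of H. -/

/-- The subgroup `H` contains the same elements of the root groups of `b` and of `b'`. -/
def SameIn (H : Subgroup (St A R)) (b b' : RootVec A) : Prop :=
  ∀ t : R, xg b t ∈ H ↔ xg b' t ∈ H

theorem SameIn.symm {H : Subgroup (St A R)} {b b' : RootVec A} (h : SameIn H b b') :
    SameIn H b' b := fun t => (h t).symm

theorem SameIn.trans {H : Subgroup (St A R)} {b b' b'' : RootVec A} (h : SameIn H b b')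
    (h' : SameIn H b' b'') : SameIn H b b'' := fun t => (h t).trans (h' t)

theorem sameIn_neg (H : Subgroup (St A R)) (b : RootVec A) : SameIn H b.neg b := fun t => by
  rw [xg_neg_vec, inv_mem_iff]

/-- For r = 1 the torus factor is trivial, so conjugation by an element of H matches the two root
groups parameter by parameter. -/
theorem sameIn_reflect {H : Subgroup (St A R)} {hd : ∀ i, A i i = 2} {i : I}
    (hH : sg (RootVec.simple A i) (RootVec.simpleNeg hd i) 1 ∈ H) (b : RootVec A) :
    SameIn H (b.reflect hd i) b := fun t => by
  have := sg_conj hd i b 1 t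
  rw [one_zpow, Units.val_one, one_mul] at this
  rw [← this, Subgroup.mul_mem_cancel_right _ (inv_mem hH), Subgroup.mul_mem_cancel_left _ hH]

theorem weylAct_append (w w' : List I) (v : I → ℤ) :
    weylAct A (w ++ w') v = weylAct A w (weylAct A w' v) := by
  simp [weylAct]

/-- The automorphism `φ` is compatible with the Weyl group element represented by `w`. -/
structure Covers (H : Subgroup (St A R)) (φ : 𝔤 A ≃ₗ[ℂ] 𝔤 A) (w : List I) : Prop where
  map : ∀ b : RootVec A, ∃ b' : RootVec A,
    b'.root = weylAct A w b.root ∧ b'.vec = φ b.vec ∧ SameIn H b' b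

/-- The inverse is carried along so that the closure induction can pass through inverses. -/
theorem exists_covers {H : Subgroup (St A R)} {hd : ∀ i, A i i = 2}
    (hH : ∀ i, sg (RootVec.simple A i) (RootVec.simpleNeg hd i) 1 ∈ H) {φ : 𝔤 A ≃ₗ[ℂ] 𝔤 A}
    (hφ : φ ∈ WStar A) : ∃ w, Covers H φ w ∧ Covers H φ⁻¹ w.reverse := by
  have inv_one : ∀ i, Covers H (sLin A i)⁻¹ [i] := fun i => ⟨fun b => by
    refine ⟨⟨simpleReflection A i b.root, (sEquiv A i).symm b.vec, ?_,
      sEquiv_symm_mem_rootSpace hd i b.vec_mem, ?_⟩, rfl, rfl, ?_⟩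
    · obtain ⟨w, j, hj⟩ := b.root_mem
      exact ⟨i :: w, j, by rw [hj]; rfl⟩
    · obtain ⟨ψ, hψ, j, h1⟩ := b.vec_orbit
      refine ⟨(sLin A i)⁻¹ * ψ, mul_mem (inv_mem (sLin_mem i)) hψ, j, ?_⟩
      rcases h1 with h1 | h1
      · exact Or.inl (by rw [h1]; rfl)
      · exact Or.inr (by rw [h1, map_neg]; rfl)
    · refine (sameIn_reflect (hH i) _).symm.trans ?_
      rw [RootVec.ext' (a := RootVec.reflect hd i _) (b := b)]
      · exact fun t => Iff.rfl
      · exact simpleReflection_simpleReflection hd i _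
      · exact LieEquiv.apply_symm_apply _ _⟩
  induction hφ using Subgroup.closure_induction with
  | mem φ hφ =>
    obtain ⟨i, hi⟩ := hφ
    obtain rfl : φ = sLin A i := LinearEquiv.ext fun x => congrFun hi x
    exact ⟨[i], ⟨fun b => ⟨b.reflect hd i, rfl, rfl, sameIn_reflect (hH i) b⟩⟩, inv_one i⟩
  | one => exact ⟨[], ⟨fun b => ⟨b, rfl, rfl, fun t => Iff.rfl⟩⟩,
      ⟨fun b => ⟨b, rfl, rfl, fun t => Iff.rfl⟩⟩⟩
  | mul φ ψ _ _ h1 h2 =>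
    obtain ⟨w, h1, h1'⟩ := h1
    obtain ⟨v, h2, h2'⟩ := h2
    refine ⟨w ++ v, ⟨fun b => ?_⟩, ⟨fun b => ?_⟩⟩
    · obtain ⟨b', e1, e2, e3⟩ := h2.map b
      obtain ⟨b'', e4, e5, e6⟩ := h1.map b'
      exact ⟨b'', by rw [e4, e1, weylAct_append], by rw [e5, e2]; rfl, e6.trans e3⟩
    · obtain ⟨b', e1, e2, e3⟩ := h1'.map b
      obtain ⟨b'', e4, e5, e6⟩ := h2'.map b'
      exact ⟨b'', by rw [e4, e1, List.reverse_append, weylAct_append],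
        by rw [e5, e2, mul_inv_rev]; rfl, e6.trans e3⟩
  | inv φ _ h1 =>
    obtain ⟨w, h1, h1'⟩ := h1
    exact ⟨w.reverse, h1', by rwa [inv_inv, List.reverse_reverse]⟩

/-- Serves the degenerate case of a zero vector, which does not determine its root; the root has to
be followed by a word. -/
theorem exists_covers_word {H : Subgroup (St A R)} {hd : ∀ i, A i i = 2}
    (hH : ∀ i, sg (RootVec.simple A i) (RootVec.simpleNeg hd i) 1 ∈ H) (w : List I)
    (b : RootVec A) : ∃ b' : RootVec A,
      b'.root = weylAct A w b.root ∧ (b.vec = 0 → b'.vec = 0) ∧ SameIn H b' b := by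
  induction w with
  | nil => exact ⟨b, rfl, id, fun t => Iff.rfl⟩
  | cons i w ih =>
    obtain ⟨b', h1, h2, h3⟩ := ih
    refine ⟨b'.reflect hd i, ?_, fun h0 => ?_, (sameIn_reflect (hH i) b').trans h3⟩
    · change simpleReflection A i b'.root = _
      rw [h1]
      rfl
    · change sEquiv A i b'.vec = 0
      rw [h2 h0, map_zero]

/-- If e_i = 0 then h_i = -[e_i, f_i] = 0, hence A_ij e_j = [h_i, e_j] = 0; the vanishing spreads
along the edges of the connected diagram. -/
theorem eq_zero_of_e_eq_zero {p : ℤ} (hA : IsCartanOfRatio A p) {i : I} (hi : e A i = 0) (j : I) :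
    e A j = 0 := by
  refine hA.connected (fun i => e A i = 0) (fun i j hi hij => ?_) i j hi
  have h1 : h A i = 0 := by
    have := lie_e_f_self A i
    rwa [hi, zero_lie, eq_comm, neg_eq_zero] at this
  have h2 := lie_h_e A i j
  rw [h1, zero_lie, eq_comm, smul_eq_zero] at h2
  exact h2.resolve_left (by exact_mod_cast hij)

/-- A nonzero vector determines its weight on every h_i, and nonsingularity of A recovers the root.
-/
theorem root_eq_of_mem_rootSpace {p : ℤ} (hA : IsCartanOfRatio A p) {α β : I → ℤ} {x : 𝔤 A}
    (hx : x ≠ 0) (hα : x ∈ rootSpace A α) (hβ : x ∈ rootSpace A β) : α = β := by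
  rw [mem_rootSpace] at hα hβ
  rw [← sub_eq_zero]
  refine hA.nonsingular _ fun i => ?_
  have h1 := (hα i).symm.trans (hβ i)
  have h2 : (weightAt A i α : ℂ) = weightAt A i β := smul_left_injective ℂ hx h1
  rw [weightAt_sub, sub_eq_zero]
  exact_mod_cast h2

/-- Every root group is conjugate to one of the root groups of the simple roots. -/
theorem exists_sameIn_simple {p : ℤ} (hA : IsCartanOfRatio A p) {H : Subgroup (St A R)}
    (hH : ∀ i, sg (RootVec.simple A i) (RootVec.simpleNeg hA.diag i) 1 ∈ H) (b : RootVec A) :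
    ∃ k, SameIn H b (RootVec.simple A k) := by
  obtain ⟨φ, hφ, k, hk⟩ := b.vec_orbit
  -- Treating a zero vector separately avoids having to prove e_k ≠ 0. If it occurs, all e_i vanish,
  -- and a root vector is then determined by its root alone.
  by_cases h0 : b.vec = 0
  · have h1 : e A k = 0 := by
      rcases hk with hk | hk
      · rw [h0] at hk
        exact (LinearEquiv.map_eq_zero_iff φ).mp hk.symm
      · rw [h0, eq_comm, neg_eq_zero] at hk
        exact (LinearEquiv.map_eq_zero_iff φ).mp hk
    obtain ⟨w, l, hl⟩ := b.root_mem
    obtain ⟨b', h2, h3, h4⟩ := exists_covers_word hH w (RootVec.simple A l)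
    refine ⟨l, ?_⟩
    rwa [RootVec.ext' (a := b) (b := b') (hl.trans h2.symm)
      (h0.trans (h3 (eq_zero_of_e_eq_zero hA h1 l)).symm)]
  · obtain ⟨w, h1, -⟩ := exists_covers hH hφ
    obtain ⟨b', h2, h3, h4⟩ := h1.map (RootVec.simple A k)
    refine ⟨k, ?_⟩
    have h5 := b'.vec_mem
    rw [h3] at h5
    rcases hk with hk | hk
    · have h6 : b.vec = b'.vec := hk.trans h3.symm
      rwa [RootVec.ext' (a := b) (b := b')
        (root_eq_of_mem_rootSpace hA h0 b.vec_mem (h6 ▸ b'.vec_mem)) h6]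
    · have h6 : b.vec = b'.neg.vec := hk.trans (congrArg Neg.neg h3.symm)
      rw [RootVec.ext' (a := b) (b := b'.neg)
        (root_eq_of_mem_rootSpace hA h0 b.vec_mem (h6 ▸ b'.neg.vec_mem)) h6]
      exact (sameIn_neg H b').trans h4

theorem fg_of_simple_mem {p : ℤ} (hA : IsCartanOfRatio A p) {H : Subgroup (St A R)} (hfg : H.FG)
    (hH : ∀ i, sg (RootVec.simple A i) (RootVec.simpleNeg hA.diag i) 1 ∈ H)
    (hx : ∀ (k : I) (t : R), xg (RootVec.simple A k) t ∈ H) : Group.FG (St A R) := by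
  have : H = ⊤ := by
    rw [eq_top_iff, ← PresentedGroup.closure_range_of, Subgroup.closure_le]
    rintro _ ⟨⟨b, t⟩, rfl⟩
    obtain ⟨k, hk⟩ := exists_sameIn_simple hA hH b
    exact (hk t).mpr (hx k t)
  exact ⟨this ▸ hfg⟩

/-- The set of the `t` with `X_b(t) ∈ H`. -/
def coordSubgroup (H : Subgroup (St A R)) (b : RootVec A) : AddSubgroup R where
  carrier := {t | xg b t ∈ H}
  zero_mem' := by
    change xg b 0 ∈ H
    rw [xg_zero]
    exact one_mem H
  add_mem' {t u} ht hu := by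
    change xg b (t + u) ∈ H
    rw [xg_add]
    exact mul_mem ht hu
  neg_mem' {t} ht := by
    change xg b (-t) ∈ H
    rw [xg_neg]
    exact inv_mem ht

/-- Conjugation by s̃_i(r) takes X_{e_i}(r²t) to X_{f_i}(t), and s̃_i(1) relates the latter to
X_{e_i}(t). -/
theorem sq_mul_mem_coordSubgroup {hd : ∀ i, A i i = 2} {H : Subgroup (St A R)} {i : I} {r : Rˣ}
    (h1 : sg (RootVec.simple A i) (RootVec.simpleNeg hd i) 1 ∈ H)
    (hr : sg (RootVec.simple A i) (RootVec.simpleNeg hd i) r ∈ H) {t : R}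
    (ht : t ∈ coordSubgroup H (RootVec.simple A i)) :
    (r : R) ^ 2 * t ∈ coordSubgroup H (RootVec.simple A i) := by
  have h2 := sg_conj hd i (RootVec.simple A i) r ((r : R) ^ 2 * t)
  have e : weightAt A i (RootVec.simple A i).root = 2 := by
    change weightAt A i (Pi.single i 1) = 2
    rw [weightAt_single, hd]
  have e2 : ((r ^ (-2 : ℤ) : Rˣ) : R) * ((r : R) ^ 2 * t) = t := by
    rw [← mul_assoc, ← Units.val_pow_eq_pow_val, ← Units.val_mul, ← zpow_natCast, ← zpow_add]
    simp
  rw [e, e2] at h2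
  have h3 : xg ((RootVec.simple A i).reflect hd i) t ∈ H := (sameIn_reflect h1 _ t).mpr ht
  rwa [← h2, Subgroup.mul_mem_cancel_right _ (inv_mem hr), Subgroup.mul_mem_cancel_left _ hr] at h3

end

/-! ### Rings that are finite over a subring generated by units -/

section Algebra

variable {R : Type*} [CommRing R]

/-- Each x in U is a root of X² - x², so adjoining U to the ring generated by the squares is a
finite extension. It contains S, over which R is finite. -/
theorem finite_adjoin_sq {S : Subring R} {U : Finset R} (hS : S = Subring.closure (U : Set R))
    (hfin : Module.Finite S R) :
    Module.Finite (Algebra.adjoin ℤ ((fun x : R => x ^ 2) '' (U : Set R))) R := by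
  set S₁ := Algebra.adjoin ℤ ((fun x : R => x ^ 2) '' (U : Set R))
  let S₂ := Algebra.adjoin S₁ (U : Set R)
  have h1 : Module.Finite S₁ S₂ := by
    refine Algebra.finite_adjoin_of_finite_of_isIntegral U.finite_toSet fun x hx => ?_
    refine IsIntegral.of_pow two_pos ?_
    exact isIntegral_algebraMap (x := (⟨x ^ 2, Algebra.subset_adjoin ⟨x, hx, rfl⟩⟩ : S₁))
  have hle : ∀ x ∈ S, x ∈ S₂ := by
    intro x hx
    rw [hS] at hx
    have : Subring.closure (U : Set R) ≤ S₂.toSubring :=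
      Subring.closure_le.mpr fun y hy => Algebra.subset_adjoin hy
    exact this hx
  have h2 : Module.Finite S₂ R := by
    obtain ⟨G, hG⟩ := hfin.fg_top
    refine ⟨⟨G, ?_⟩⟩
    rw [eq_top_iff]
    intro x _
    have hx : x ∈ Submodule.span S (G : Set R) := hG ▸ Submodule.mem_top
    induction hx using Submodule.span_induction with
    | mem x hx => exact Submodule.subset_span hx
    | zero => exact zero_mem _
    | add x y _ _ hx hy => exact add_mem (hx trivial) (hy trivial)
    | smul c x _ hx => exact Submodule.smul_mem _ (⟨c, hle c c.2⟩ : S₂) (hx trivial)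
  exact Module.Finite.trans S₂ R

theorem exists_finset_of_finite_over_units {S : Subring R} {U : Finset Rˣ}
    (hS : S = Subring.closure ((fun u : Rˣ => (u : R)) '' (U : Set Rˣ)))
    (hfin : Module.Finite S R) : ∃ G : Finset R, ∀ T : AddSubgroup R,
      (∀ x ∈ G, x ∈ T) → (∀ u ∈ U, ∀ x ∈ T, (u : R) ^ 2 * x ∈ T) → ∀ x, x ∈ T := by
  classical
  have h1 := finite_adjoin_sq (U := U.image fun u : Rˣ => (u : R)) (by rw [hS, Finset.coe_image])
    hfin
  obtain ⟨G, hG⟩ := h1.fg_top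
  refine ⟨G, fun T hGT hUT x => ?_⟩
  have hmul : ∀ c ∈ Algebra.adjoin ℤ ((fun x : R => x ^ 2) ''
      (U.image fun u : Rˣ => (u : R) : Set R)), ∀ x ∈ T, c * x ∈ T := by
    intro c hc
    induction hc using Algebra.adjoin_induction with
    | mem c hc =>
      obtain ⟨y, hy, rfl⟩ := hc
      obtain ⟨u, hu, rfl⟩ := Finset.mem_image.mp (Finset.mem_coe.mp hy)
      exact hUT u hu
    | algebraMap n =>
      intro x hx
      rw [eq_intCast, ← zsmul_eq_mul]
      exact zsmul_mem hx n
    | add c d _ _ hc hd => exact fun x hx => by rw [add_mul]; exact add_mem (hc x hx) (hd x hx)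
    | mul c d _ _ hc hd => exact fun x hx => by rw [mul_assoc]; exact hc _ (hd x hx)
  have hx : x ∈ Submodule.span _ (G : Set R) := hG ▸ Submodule.mem_top
  induction hx using Submodule.span_induction with
  | mem x hx => exact hGT x hx
  | zero => exact zero_mem _
  | add x y _ _ hx hy => exact add_mem hx hy
  | smul c x _ hx => exact hmul c c.2 x hx

/-! ### Additive subgroups containing all monomials. -/

/-- The products of distinct elements of a finite set. -/
noncomputable def squarefreeMonomials (G : Finset R) : Finset R := by
  classical exact G.powerset.image fun B => ∏ x ∈ B, x

theorem prod_mem_squarefreeMonomials {G B : Finset R} (h : B ⊆ G) :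
    ∏ x ∈ B, x ∈ squarefreeMonomials G := by
  classical
  exact Finset.mem_image.mpr ⟨B, Finset.mem_powerset.mpr h, rfl⟩

theorem mem_of_monomials {G : Finset R} (hG : Algebra.adjoin ℤ (G : Set R) = ⊤)
    (T : AddSubgroup R) (h : ∀ a : R → ℕ, ∏ x ∈ G, x ^ a x ∈ T) (x : R) : x ∈ T := by
  have hx : x ∈ Subalgebra.toSubmodule (Algebra.adjoin ℤ (G : Set R)) := by
    rw [hG]
    exact trivial
  rw [Algebra.adjoin_eq_span] at hx
  induction hx using Submodule.span_induction with
  | mem x hx =>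
    obtain ⟨a, -, rfl⟩ := Submonoid.mem_closure_finset.mp hx
    exact h a
  | zero => exact zero_mem _
  | add x y _ _ hx hy => exact add_mem hx hy
  | smul c x _ hx => exact zsmul_mem hx c

theorem prod_pow_mem_of_le_one {G : Finset R} {a : R → ℕ} (ha : ∀ x ∈ G, a x ≤ 1) :
    ∏ x ∈ G, x ^ a x ∈ squarefreeMonomials G := by
  classical
  have : ∏ x ∈ G, x ^ a x = ∏ x ∈ G.filter fun x => a x = 1, x := by
    rw [Finset.prod_filter]
    refine Finset.prod_congr rfl fun x hx => ?_
    split_ifs with h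
    · rw [h, pow_one]
    · rw [show a x = 0 by have := ha x hx; omega, pow_zero]
  rw [this]
  exact prod_mem_squarefreeMonomials (Finset.filter_subset _ _)

/-- The algebra behind the relations of type `A₂`. -/
theorem mem_of_mul_mem {G : Finset R} (hG : Algebra.adjoin ℤ (G : Set R) = ⊤) {T : AddSubgroup R}
    (hT : ∀ m ∈ squarefreeMonomials G, m ∈ T) (h : ∀ t ∈ T, ∀ u ∈ T, t * u ∈ T) (x : R) :
    x ∈ T := by
  have h1 : (1 : R) ∈ T := hT 1 (by simpa using prod_mem_squarefreeMonomials (Finset.empty_subset G))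
  have h2 : ∀ x ∈ G, x ∈ T := fun x hx =>
    hT x (by simpa using prod_mem_squarefreeMonomials (Finset.singleton_subset_iff.mpr hx))
  let T' : Subring R := { T with
    one_mem' := h1
    mul_mem' := fun {t u} ht hu => h t ht u hu }
  refine mem_of_monomials hG T (fun a => ?_) x
  exact Subring.prod_mem T' fun x hx => Subring.pow_mem T' (h2 x hx) _

/-- The algebra behind the relations of type `B₂`. -/
theorem mem_of_mul_mem_iff {G : Finset R} (hG : Algebra.adjoin ℤ (G : Set R) = ⊤)
    {T₁ T₂ : AddSubgroup R} (h1 : ∀ m ∈ squarefreeMonomials G, m ∈ T₁)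
    (h2 : ∀ m ∈ squarefreeMonomials G, m ∈ T₂)
    (h : ∀ t ∈ T₁, ∀ u ∈ T₂, t * u ∈ T₁ ↔ t ^ 2 * u ∈ T₂) (x : R) : x ∈ T₁ ∧ x ∈ T₂ := by
  have h0 : (1 : R) ∈ T₁ :=
    h1 1 (by simpa using prod_mem_squarefreeMonomials (Finset.empty_subset G))
  have hle : ∀ u ∈ T₂, u ∈ T₁ := fun u hu => by
    have := (h 1 h0 u hu).mpr (by simpa using hu)
    simpa using this
  have key : ∀ n, ∀ a : R → ℕ, ∑ x ∈ G, a x = n → ∏ x ∈ G, x ^ a x ∈ T₂ := by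
    intro n
    induction n using Nat.strong_induction_on with
    | _ n ih =>
      intro a ha
      by_cases hsq : ∀ x ∈ G, a x ≤ 1
      · exact h2 _ (prod_pow_mem_of_le_one hsq)
      · push Not at hsq
        obtain ⟨y, hy, hy1⟩ := hsq
        -- Write the monomial as t²u, with exponents ⌊a/2⌋ in t and a mod 2 in u. Since some
        -- exponent is at least 2, both t and tu have smaller degree; induction puts them in T₂ ⊆
        -- T₁, and the hypothesis then gives t²u ∈ T₂.
        have hb : ∑ x ∈ G, a x / 2 < n := by
          rw [← ha]
          exact Finset.sum_lt_sum (fun x _ => Nat.div_le_self _ _) ⟨y, hy, by omega⟩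
        have hc : ∑ x ∈ G, (a x / 2 + a x % 2) < n := by
          rw [← ha]
          exact Finset.sum_lt_sum (fun x _ => by omega) ⟨y, hy, by omega⟩
        have e1 := hle _ (ih _ hb _ rfl)
        have e2 := hle _ (ih _ hc _ rfl)
        have e3 := h2 _ (prod_pow_mem_of_le_one (G := G) (a := fun x => a x % 2)
          fun x _ => by omega)
        have e4 := h _ e1 _ e3
        rw [← Finset.prod_mul_distrib, ← Finset.prod_pow, ← Finset.prod_mul_distrib] at e4
        simp only [← pow_add, ← pow_mul] at e4
        have e5 := e4.mp e2
        convert e5 using 4 with x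
        omega
  have h3 := mem_of_monomials hG T₂ (fun a => key _ a rfl) x
  exact ⟨hle x h3, h3⟩

/-- The algebra behind the relations of type `G₂`. -/
theorem mem_of_sq_sub_mul_mem {G : Finset R} (hG : Algebra.adjoin ℤ (G : Set R) = ⊤)
    {T : AddSubgroup R} (hT : ∀ m ∈ squarefreeMonomials G, m ∈ T)
    (h : ∀ t ∈ T, ∀ u, (t ^ 2 - t) * u ∈ T) (x : R) : x ∈ T := by
  classical
  have key : ∀ n, ∀ a : R → ℕ, ∑ x ∈ G, a x = n → ∏ x ∈ G, x ^ a x ∈ T := by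
    intro n
    induction n using Nat.strong_induction_on with
    | _ n ih =>
      intro a ha
      by_cases hsq : ∀ x ∈ G, a x ≤ 1
      · exact hT _ (prod_pow_mem_of_le_one hsq)
      · push Not at hsq
        obtain ⟨y, hy, hy1⟩ := hsq
        have hyT : y ∈ T :=
          hT y (by simpa using prod_mem_squarefreeMonomials (Finset.singleton_subset_iff.mpr hy))
        -- Lowering the exponent of y by one changes the monomial by (y² - y) times a ring element,
        -- which lies in T by hypothesis.
        let b : R → ℕ := Function.update a y (a y - 1)
        have hb : ∑ x ∈ G, b x < n := by
          rw [← ha]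
          refine Finset.sum_lt_sum (fun x _ => ?_) ⟨y, hy, by simp [b]; omega⟩
          by_cases hxy : x = y
          · subst hxy
            simp [b]
          · simp [b, hxy]
        have e1 := ih _ hb b rfl
        have e2 := h y hyT (y ^ (a y - 2) * ∏ x ∈ G.erase y, x ^ a x)
        have e3 : ∏ x ∈ G, x ^ b x = y ^ (a y - 1) * ∏ x ∈ G.erase y, x ^ a x := by
          rw [← Finset.mul_prod_erase G _ hy]
          congr 1
          · simp [b]
          · refine Finset.prod_congr rfl fun x hx => ?_
            simp [b, Finset.ne_of_mem_erase hx]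
        have e4 : ∏ x ∈ G, x ^ a x = ∏ x ∈ G, x ^ b x +
            (y ^ 2 - y) * (y ^ (a y - 2) * ∏ x ∈ G.erase y, x ^ a x) := by
          rw [e3, ← Finset.mul_prod_erase G _ hy]
          obtain ⟨k, hk⟩ : ∃ k, a y = k + 2 := ⟨a y - 2, by omega⟩
          rw [hk, Nat.add_sub_cancel, show k + 2 - 1 = k + 1 by omega]
          ring
        rw [e4]
        exact add_mem e1 e2
  exact mem_of_monomials hG T (fun a => key _ a rfl) x

end Algebra

section Units

variable {I : Type*} [Fintype I] [DecidableEq I] {A : Matrix I I ℤ} {R : Type*} [CommRing R]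

theorem fg_of_finite_over_units {p : ℤ} (hA : IsCartanOfRatio A p) {S : Subring R} {U : Finset Rˣ}
    (hS : S = Subring.closure ((fun u : Rˣ => (u : R)) '' (U : Set Rˣ)))
    (hfin : Module.Finite S R) : Group.FG (St A R) := by
  obtain ⟨G, hG⟩ := exists_finset_of_finite_over_units hS hfin
  let gens : Set (St A R) :=
    (fun q : I × R => xg (RootVec.simple A q.1) q.2) '' (Set.univ ×ˢ (G : Set R)) ∪
    (fun q : I × Rˣ => sg (RootVec.simple A q.1) (RootVec.simpleNeg hA.diag q.1) q.2) ''
      (Set.univ ×ˢ (insert 1 (U : Set Rˣ)))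
  have hfin : gens.Finite :=
    ((Set.finite_univ.prod G.finite_toSet).image _).union
      ((Set.finite_univ.prod (U.finite_toSet.insert 1)).image _)
  have hs : ∀ i, ∀ r ∈ insert 1 (U : Set Rˣ),
      sg (RootVec.simple A i) (RootVec.simpleNeg hA.diag i) r ∈ Subgroup.closure gens :=
    fun i r hr => Subgroup.subset_closure (Or.inr ⟨(i, r), ⟨trivial, hr⟩, rfl⟩)
  refine fg_of_simple_mem hA (H := Subgroup.closure gens)
    ((Subgroup.fg_iff _).mpr ⟨gens, rfl, hfin⟩) (fun i => hs i 1 (Or.inl rfl)) fun k t => ?_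
  refine hG (coordSubgroup (Subgroup.closure gens) (RootVec.simple A k)) (fun x hx => ?_)
    (fun u hu x hx => ?_) t
  · exact Subgroup.subset_closure (Or.inl ⟨(k, x), ⟨trivial, hx⟩, rfl⟩)
  · exact sq_mul_mem_coordSubgroup (hs k 1 (Or.inl rfl)) (hs k u (Or.inr hu)) hx

end Units

/-! ### Chevalley relations in rank two -/

section Lie

variable {L : Type*} [LieRing L] [LieAlgebra ℂ L]

theorem lie_string_two {x y₀ y₁ y₂ : L} (h₀ : ⁅x, y₀⁆ = y₁) (h₁ : ⁅x, y₁⁆ = (2 : ℂ) • y₂)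
    (h₂ : ⁅y₀, y₁⁆ = 0) : ⁅y₀, y₂⁆ = 0 := by
  have := leibniz_lie x y₀ y₁
  rw [h₂, h₀, h₁, lie_zero, lie_self, zero_add, lie_smul, eq_comm, smul_eq_zero] at this
  exact this.resolve_left two_ne_zero

theorem lie_string_three {x y₀ y₁ y₂ w : L} {c : ℂ} (h₀ : ⁅x, y₀⁆ = y₁) (h₂ : ⁅x, y₂⁆ = c • w)
    (h₃ : ⁅y₀, y₂⁆ = 0) : ⁅y₁, y₂⁆ = -(c • ⁅y₀, w⁆) := by
  have := leibniz_lie x y₀ y₂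
  rw [h₃, h₀, h₂, lie_zero, lie_smul, eq_comm] at this
  exact eq_neg_of_add_eq_zero_left this

/-- These are the brackets along the G₂ string. Vanishing is derived from Jacobi alone: for example,
ad x applied to [y₁, y₂] = -3z gives -3[y₁, y₃] = 3[y₁, y₃]. No knowledge of which root spaces
vanish is needed. -/
theorem lie_string_four {x y₀ y₁ y₂ y₃ z : L} (h₀ : ⁅x, y₀⁆ = y₁) (h₁ : ⁅x, y₁⁆ = (2 : ℂ) • y₂)
    (h₂ : ⁅x, y₂⁆ = (3 : ℂ) • y₃) (h₃ : ⁅x, y₃⁆ = 0) (h₄ : ⁅y₀, y₁⁆ = 0) (hz : ⁅y₀, y₃⁆ = z) :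
    ⁅y₁, y₂⁆ = -((3 : ℂ) • z) ∧ ⁅y₁, y₃⁆ = 0 ∧ ⁅y₂, y₃⁆ = 0 ∧ ⁅x, z⁆ = 0 ∧ ⁅y₀, z⁆ = 0 := by
  have a1 := lie_string_two h₀ h₁ h₄
  have a2 := lie_string_three h₀ h₂ a1
  rw [hz] at a2
  have a3 : ⁅x, z⁆ = ⁅y₁, y₃⁆ := by
    rw [← hz, leibniz_lie, h₀, h₃, lie_zero, add_zero]
  have a4 : ⁅y₁, y₃⁆ = 0 := by
    have := leibniz_lie x y₁ y₂
    rw [a2, h₁, h₂, smul_lie, lie_self, smul_zero, zero_add, lie_neg, lie_smul, lie_smul, a3,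
      eq_comm, ← sub_eq_zero, sub_neg_eq_add, ← add_smul, smul_eq_zero] at this
    exact this.resolve_left (by norm_num)
  have a5 : ⁅y₂, y₃⁆ = 0 := by
    have := leibniz_lie x y₁ y₃
    rw [a4, h₁, h₃, lie_zero, lie_zero, add_zero, smul_lie, eq_comm, smul_eq_zero] at this
    exact this.resolve_left two_ne_zero
  refine ⟨a2, a4, a5, a3.trans a4, ?_⟩
  have := leibniz_lie y₀ y₁ y₂
  rw [a1, h₄, a2, lie_zero, zero_lie, add_zero, lie_neg, neg_eq_zero, lie_smul, smul_eq_zero] at this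
  exact this.resolve_left (by norm_num)

/-- Since exp(a) exp(b) exp(-a) is the exponential of ad(exp(ad a) b), a commutator formula amounts
to splitting that one exponential as F times exp(b). -/
theorem commutator_adExp {a b : L} (ha : AdNil a) (hb : AdNil b) {F : L → L}
    (h : ∀ v, adExp (adExp a b) v = F (adExp b v)) (v : L) :
    adExp a (adExp b (adExp (-a) (adExp (-b) v))) = F v := by
  have h1 : adExp a (adExp b (adExp (-a) (adExp (-b) v))) = adExp (adExp a b) (adExp (-b) v) :=
    congrFun (locExp_conj ha hb) _
  have h2 := (adExp_add (x := b) (y := -b) (by rw [lie_neg, lie_self, neg_zero]) hb hb.neg).2 v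
  rw [h1, h, ← h2, add_neg_cancel, adExp, map_zero, locExp_zero, id]

theorem commutator_A2 {a b c : L} (ha : AdNil a) (hb : AdNil b) (hc : AdNil c)
    (h₁ : ⁅a, b⁆ = c) (h₂ : ⁅a, c⁆ = 0) (h₃ : ⁅b, c⁆ = 0) (t u : ℂ) (v : L) :
    adExp (t • a) (adExp (u • b) (adExp (-(t • a)) (adExp (-(u • b)) v))) =
      adExp ((t * u) • c) v := by
  refine commutator_adExp (F := adExp ((t * u) • c)) (ha.smul t) (hb.smul u) (fun v => ?_) v
  have h4 : adExp (t • a) (u • b) = u • b + (t * u) • c :=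
    adExp_of_two (by rw [smul_lie, lie_smul, h₁, smul_smul])
      (by rw [smul_lie, lie_smul, h₂, smul_zero, smul_zero])
  rw [h4, add_comm]
  exact (adExp_add (by rw [smul_lie, lie_smul, ← lie_skew, h₃]; simp) (hc.smul _) (hb.smul _)).2 v

theorem commutator_B2 {a b y₁ y₂ : L} (ha : AdNil a) (hb : AdNil b) (hy₁ : AdNil y₁)
    (hy₂ : AdNil y₂)
    (h₀ : ⁅a, b⁆ = y₁) (h₁ : ⁅a, y₁⁆ = (2 : ℂ) • y₂) (h₂ : ⁅a, y₂⁆ = 0) (h₃ : ⁅b, y₁⁆ = 0)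
    (t u : ℂ) (v : L) :
    adExp (t • a) (adExp (u • b) (adExp (-(t • a)) (adExp (-(u • b)) v))) =
      adExp ((t * u) • y₁) (adExp ((t ^ 2 * u) • y₂) v) := by
  have h4 := lie_string_two h₀ h₁ h₃
  have h5 := lie_string_three (c := 0) (w := 0) h₀ (by rw [h₂, smul_zero]) h4
  rw [zero_smul, neg_zero] at h5
  refine commutator_adExp (F := fun v => adExp ((t * u) • y₁) (adExp ((t ^ 2 * u) • y₂) v))
    (ha.smul t) (hb.smul u) (fun v => ?_) v
  have h6 : adExp (t • a) (u • b) = u • b + (t * u) • y₁ + (t ^ 2 * u) • y₂ :=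
    adExp_of_three (by rw [smul_lie, lie_smul, h₀, smul_smul])
      (by rw [smul_lie, lie_smul, h₁]; module)
      (by rw [smul_lie, lie_smul, h₂, smul_zero, smul_zero])
  have h7 := adExp_add (x := (t ^ 2 * u) • y₂) (y := u • b)
    (by rw [smul_lie, lie_smul, ← lie_skew, h4]; simp) (hy₂.smul _) (hb.smul _)
  have h8 := (adExp_add (x := (t * u) • y₁) (y := (t ^ 2 * u) • y₂ + u • b)
    (by
      rw [lie_add, smul_lie, lie_smul, h5, smul_lie, lie_smul, ← lie_skew, h₃]
      simp) (hy₁.smul _) h7.1).2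
  rw [h6, show u • b + (t * u) • y₁ + (t ^ 2 * u) • y₂ =
    (t * u) • y₁ + ((t ^ 2 * u) • y₂ + u • b) by module, h8, h7.2]

/-- The coefficient 2 of z collects two half-commutators from the product formula: 3/2 from [y₁, y₂]
= -3z and 1/2 from [y₃, b] = -z. -/
theorem commutator_G2 {a b y₁ y₂ y₃ z : L} (ha : AdNil a) (hb : AdNil b) (hy₁ : AdNil y₁)
    (hy₂ : AdNil y₂) (hy₃ : AdNil y₃) (hz : AdNil z)
    (h₀ : ⁅a, b⁆ = y₁) (h₁ : ⁅a, y₁⁆ = (2 : ℂ) • y₂) (h₂ : ⁅a, y₂⁆ = (3 : ℂ) • y₃)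
    (h₃ : ⁅a, y₃⁆ = 0) (h₄ : ⁅b, y₁⁆ = 0) (h₅ : ⁅b, y₃⁆ = z) (t u : ℂ) (v : L) :
    adExp (t • a) (adExp (u • b) (adExp (-(t • a)) (adExp (-(u • b)) v))) =
      adExp ((t * u) • y₁) (adExp ((t ^ 2 * u) • y₂) (adExp ((t ^ 3 * u) • y₃)
        (adExp ((2 * t ^ 3 * u ^ 2) • z) v))) := by
  have k0 := lie_string_two h₀ h₁ h₄
  obtain ⟨k1, k2, k3, k4, k5⟩ := lie_string_four h₀ h₁ h₂ h₃ h₄ h₅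
  have z1 : ⁅y₁, z⁆ = 0 := by
    rw [← h₀, lie_lie, k4, k5, lie_zero, lie_zero, sub_zero]
  have z2 : ⁅y₂, z⁆ = 0 := by
    have : ⁅(2 : ℂ) • y₂, z⁆ = 0 := by
      rw [← h₁, lie_lie, k4, z1, lie_zero, lie_zero, sub_zero]
    rw [smul_lie, smul_eq_zero] at this
    exact this.resolve_left two_ne_zero
  have z3 : ⁅y₃, z⁆ = 0 := by
    have : ⁅(3 : ℂ) • y₃, z⁆ = 0 := by
      rw [← h₂, lie_lie, k4, z2, lie_zero, lie_zero, sub_zero]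
    rw [smul_lie, smul_eq_zero] at this
    exact this.resolve_left three_ne_zero
  have k6 : ⁅y₃, b⁆ = -z := by rw [← lie_skew, h₅]
  have k7 : ⁅y₂, b⁆ = 0 := by rw [← lie_skew, k0, neg_zero]
  have k8 : ⁅y₁, b⁆ = 0 := by rw [← lie_skew, h₄, neg_zero]
  refine commutator_adExp (F := fun v => adExp ((t * u) • y₁) (adExp ((t ^ 2 * u) • y₂)
    (adExp ((t ^ 3 * u) • y₃) (adExp ((2 * t ^ 3 * u ^ 2) • z) v))))
    (ha.smul t) (hb.smul u) (fun v => ?_) v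
  have e1 : adExp (t • a) (u • b) =
      u • b + (t * u) • y₁ + (t ^ 2 * u) • y₂ + (t ^ 3 * u) • y₃ :=
    adExp_of_four (by rw [smul_lie, lie_smul, h₀, smul_smul])
      (by rw [smul_lie, lie_smul, h₁]; module) (by rw [smul_lie, lie_smul, h₂]; module)
      (by rw [smul_lie, lie_smul, h₃, smul_zero, smul_zero])
  have s1 := adExp_add_of_central (x := (t * u) • y₁) (y := (t ^ 2 * u) • y₂)
    (z := (-2⁻¹ * 3 * t ^ 3 * u ^ 2) • z) (by rw [smul_lie, lie_smul, k1]; module)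
    (by rw [smul_lie, lie_smul, z1]; simp) (by rw [smul_lie, lie_smul, z2]; simp)
    (hy₁.smul _) (hy₂.smul _) (hz.smul _)
  have s2 := adExp_add (x := (t * u) • y₁ + (t ^ 2 * u) • y₂) (y := (t ^ 3 * u) • y₃)
    (by
      rw [add_lie, smul_lie, lie_smul, smul_lie, lie_smul, k2, k3]
      simp) s1.1 (hy₃.smul _)
  have s3 := adExp_add_of_central
    (x := (t * u) • y₁ + (t ^ 2 * u) • y₂ + (t ^ 3 * u) • y₃) (y := u • b)
    (z := (-2⁻¹ * t ^ 3 * u ^ 2) • z)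
    (by
      simp only [add_lie, smul_lie, lie_smul, k6, k7, k8]
      module)
    (by
      simp only [add_lie, smul_lie, lie_smul, z1, z2, z3]
      simp)
    (by simp only [smul_lie, lie_smul, k5]; simp) s2.1 (hb.smul _) (hz.smul _)
  have c1 := fun v => adExp_comm (x := u • b) (y := (2⁻¹ * t ^ 3 * u ^ 2) • z)
    (by simp only [smul_lie, lie_smul, k5]; simp) (hb.smul _) (hz.smul _) v
  have c2 := fun v => adExp_comm (x := (t ^ 3 * u) • y₃) (y := (2⁻¹ * 3 * t ^ 3 * u ^ 2) • z)
    (by simp only [smul_lie, lie_smul, z3]; simp) (hy₃.smul _) (hz.smul _) v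
  have c3 := (adExp_add (x := (2⁻¹ * 3 * t ^ 3 * u ^ 2) • z) (y := (2⁻¹ * t ^ 3 * u ^ 2) • z)
    (by simp only [smul_lie, lie_smul, lie_self]; simp) (hz.smul _) (hz.smul _)).2
  have r1 : -((-2⁻¹ * 3 * t ^ 3 * u ^ 2) • z) = (2⁻¹ * 3 * t ^ 3 * u ^ 2) • z := by module
  have r2 : -((-2⁻¹ * t ^ 3 * u ^ 2) • z) = (2⁻¹ * t ^ 3 * u ^ 2) • z := by module
  have r3 : (2⁻¹ * 3 * t ^ 3 * u ^ 2) • z + (2⁻¹ * t ^ 3 * u ^ 2) • z =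
      (2 * t ^ 3 * u ^ 2) • z := by module
  rw [e1, show u • b + (t * u) • y₁ + (t ^ 2 * u) • y₂ + (t ^ 3 * u) • y₃ =
    (t * u) • y₁ + (t ^ 2 * u) • y₂ + (t ^ 3 * u) • y₃ + u • b by module, s3.2, s2.2, s1.2, r1, r2,
    c1, ← c2, ← c3, r3]

end Lie

/-! ### The action of s_i^* on root strings. -/

noncomputable section

variable {I : Type*} [DecidableEq I] {A : Matrix I I ℤ}

/-- In this and the next two lemmas s_i^* reverses a root string. The vectors are divided powers of
ad e_i on the lowest one, which makes the image of the lowest vector exactly the highest; the minus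
signs come from [e_i, f_i] = -h_i. -/
theorem sEquiv_string_one {i : I} {y₀ y₁ : 𝔤 A} (h₀ : ⁅e A i, y₀⁆ = y₁) (h₁ : ⁅e A i, y₁⁆ = 0)
    (k₀ : ⁅f A i, y₀⁆ = 0) (k₁ : ⁅f A i, y₁⁆ = -y₀) : sEquiv A i y₀ = y₁ := by
  rw [sEquiv_apply, expAd_of_two h₀ h₁, expAd_f_add, expAd_of_lie_eq_zero k₀,
    expAd_of_two k₁ (by rw [lie_neg, k₀, neg_zero])]
  rw [add_neg_cancel_comm_assoc, expAd_of_lie_eq_zero h₁]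

theorem sEquiv_string_two {i : I} {y₀ y₁ y₂ : 𝔤 A} (h₀ : ⁅e A i, y₀⁆ = y₁)
    (h₁ : ⁅e A i, y₁⁆ = (2 : ℂ) • y₂) (h₂ : ⁅e A i, y₂⁆ = 0) (k₀ : ⁅f A i, y₀⁆ = 0)
    (k₁ : ⁅f A i, y₁⁆ = (-2 : ℂ) • y₀) (k₂ : ⁅f A i, y₂⁆ = -y₁) : sEquiv A i y₀ = y₂ := by
  rw [sEquiv_apply, expAd_of_three h₀ h₁ h₂, expAd_f_add, expAd_f_add, expAd_of_lie_eq_zero k₀,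
    expAd_of_two k₁ (by rw [lie_smul, k₀, smul_zero]),
    expAd_of_three (w := y₀) k₂ (by rw [lie_neg, k₁]; module) k₀]
  -- y₂ is fixed by exp(ad e_i), so it is enough to compare the arguments of the outer exponential.
  rw [← expAd_of_lie_eq_zero h₂]
  congr 1
  rw [expAd_of_lie_eq_zero h₂]
  module

theorem sEquiv_string_three {i : I} {y₀ y₁ y₂ y₃ : 𝔤 A} (h₀ : ⁅e A i, y₀⁆ = y₁)
    (h₁ : ⁅e A i, y₁⁆ = (2 : ℂ) • y₂) (h₂ : ⁅e A i, y₂⁆ = (3 : ℂ) • y₃) (h₃ : ⁅e A i, y₃⁆ = 0)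
    (k₀ : ⁅f A i, y₀⁆ = 0) (k₁ : ⁅f A i, y₁⁆ = (-3 : ℂ) • y₀) (k₂ : ⁅f A i, y₂⁆ = (-2 : ℂ) • y₁)
    (k₃ : ⁅f A i, y₃⁆ = -y₂) : sEquiv A i y₀ = y₃ ∧ sEquiv A i y₁ = -y₂ := by
  have f₁ : expAd (f A i) y₁ = y₁ + (-3 : ℂ) • y₀ :=
    expAd_of_two k₁ (by rw [lie_smul, k₀, smul_zero])
  have f₂ : expAd (f A i) y₂ = y₂ + (-2 : ℂ) • y₁ + (3 : ℂ) • y₀ :=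
    expAd_of_three k₂ (by rw [lie_smul, k₁]; module) (by rw [lie_smul, k₀, smul_zero])
  have f₃ : expAd (f A i) y₃ = y₃ + -y₂ + y₁ + -y₀ :=
    expAd_of_four k₃ (by rw [lie_neg, k₂]; module) (by rw [k₁]; module)
      (by rw [lie_neg, k₀, neg_zero])
  constructor
  · rw [sEquiv_apply, expAd_of_four h₀ h₁ h₂ h₃, expAd_f_add, expAd_f_add, expAd_f_add,
      expAd_of_lie_eq_zero k₀, f₁, f₂, f₃]
    have : y₀ + (y₁ + (-3 : ℂ) • y₀) + (y₂ + (-2 : ℂ) • y₁ + (3 : ℂ) • y₀) +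
        (y₃ + -y₂ + y₁ + -y₀) = y₃ := by module
    rw [this, expAd_of_lie_eq_zero h₃]
  · rw [sEquiv_apply, expAd_of_three (w := (3 : ℂ) • y₃) h₁ (by rw [lie_smul, h₂])
      (by rw [lie_smul, h₃, smul_zero]), expAd_f_add, expAd_f_add, expAd_f_smul, expAd_f_smul,
      f₁, f₂, f₃]
    have : y₁ + (-3 : ℂ) • y₀ + (2 : ℂ) • (y₂ + (-2 : ℂ) • y₁ + (3 : ℂ) • y₀) +
        (3 : ℂ) • (y₃ + -y₂ + y₁ + -y₀) = (3 : ℂ) • y₃ + (-1 : ℂ) • y₂ := by module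
    rw [this, expAd_add, expAd_e_smul, expAd_e_smul, expAd_of_lie_eq_zero h₃,
      expAd_of_two h₂ (by rw [lie_smul, h₃, smul_zero])]
    module

theorem lie_f_string {i : I} {y₀ y₁ : 𝔤 A} {c d : ℂ} (h₀ : ⁅e A i, y₀⁆ = y₁)
    (hw : ⁅h A i, y₀⁆ = c • y₀) (k₀ : ⁅e A i, ⁅f A i, y₀⁆⁆ = d • y₀) :
    ⁅f A i, y₁⁆ = (c + d) • y₀ := by
  rw [← h₀, leibniz_lie, lie_f_e_self, hw, k₀, add_smul]

theorem lie_h_e_lie (hd : ∀ i, A i i = 2) {i : I} {y : 𝔤 A} {c : ℂ} (hw : ⁅h A i, y⁆ = c • y) :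
    ⁅h A i, ⁅e A i, y⁆⁆ = (2 + c) • ⁅e A i, y⁆ := by
  rw [leibniz_lie, lie_h_e, hd, hw, lie_smul, smul_lie, ← add_smul, Int.cast_ofNat]

theorem lie_e_e_of_eq_neg_one {i j : I} (h : A j i = -1) : ⁅e A j, ⁅e A i, e A j⁆⁆ = 0 := by
  have := ad_e_pow A j i
  rw [h] at this
  have h2 : ⁅e A j, ⁅e A j, e A i⁆⁆ = 0 := this
  rw [← lie_skew (e A i) (e A j), lie_neg, h2, neg_zero]

end

/-! ### Edges of the Dynkin diagram -/

noncomputable section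

variable {I : Type*} [Fintype I] [DecidableEq I] {A : Matrix I I ℤ}

theorem adNil_vec (b : RootVec A) : AdNil b.vec := b.locNil

theorem foldr_comp_expAd (L : List (ChevalleyTerm A)) (t u : ℂ) (v : 𝔤 A) :
    (L.map fun k => expAd (((k.C : ℂ) * t ^ k.m * u ^ k.n) • k.vec.vec)).foldr (· ∘ ·) id v =
      L.foldr (fun k x => adExp (((k.C : ℂ) * t ^ k.m * u ^ k.n) • k.vec.vec) x) v := by
  induction L with
  | nil => rfl
  | cons k L ih => exact congrArg _ ih

/-- Expresses the conditions on roots in coordinates with respect to α_i, α_j, where they become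
finite checks on integer pairs, and the exponential identity pointwise. -/
theorem isChevalley_of_coords {i j : I} (hij : i ≠ j) {a b : RootVec A} {α β : ℤ × ℤ}
    (ha : a.root = pairVec i j α.1 α.2) (hb : b.root = pairVec i j β.1 β.2)
    (hpre : IsPrenilpotent A (pairVec i j α.1 α.2) (pairVec i j β.1 β.2))
    {L : List (ChevalleyTerm A)} (Lc : List (ℤ × ℤ))
    (hL : (L.map fun k => k.vec.root) = Lc.map fun c => pairVec i j c.1 c.2) (hnd : Lc.Nodup)
    (hα : α ∉ Lc) (hβ : β ∉ Lc)
    (hroot : ∀ m n : ℕ, pairVec i j (m * α.1 + n * β.1) (m * α.2 + n * β.2) ∈ roots A →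
      ((m * α.1 + n * β.1, m * α.2 + n * β.2) : ℤ × ℤ) ∈ α :: β :: Lc)
    (hcoord : ∀ k ∈ L,
      k.vec.root = pairVec i j (k.m * α.1 + k.n * β.1) (k.m * α.2 + k.n * β.2))
    (holds : ∀ (t u : ℂ) (v : 𝔤 A),
      adExp (t • a.vec) (adExp (u • b.vec) (adExp (-(t • a.vec)) (adExp (-(u • b.vec)) v))) =
        L.foldr (fun k x => adExp (((k.C : ℂ) * t ^ k.m * u ^ k.n) • k.vec.vec) x) v) :
    IsChevalley a b L := by
  have hcomb : ∀ m n : ℕ, m • a.root + n • b.root =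
      pairVec i j (m * α.1 + n * β.1) (m * α.2 + n * β.2) := fun m n => by
    rw [ha, hb, nsmul_pairVec, nsmul_pairVec, pairVec_add]
  have hinj : Function.Injective fun c : ℤ × ℤ => pairVec i j c.1 c.2 := fun c d h =>
    Prod.ext (pairVec_injective hij h).1 (pairVec_injective hij h).2
  refine ⟨by rwa [ha, hb], ?_, fun γ => ⟨fun hγ => ?_, fun hγ => ?_⟩, fun k hk => ?_, fun t u => ?_⟩
  · rw [hL]
    exact hnd.map hinj
  · have h1 := hγ
    rw [List.mem_map] at h1
    obtain ⟨k, hk, rfl⟩ := h1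
    rw [hL, List.mem_map] at hγ
    obtain ⟨c, hc, hck⟩ := hγ
    refine ⟨⟨k.vec.root_mem, k.m, k.n, by rw [hcomb, hcoord k hk]⟩, ?_⟩
    rw [Set.mem_insert_iff, Set.mem_singleton_iff, ← hck, ha, hb, not_or]
    exact ⟨fun h => hα (hinj h ▸ hc), fun h => hβ (hinj h ▸ hc)⟩
  · obtain ⟨⟨h1, m, n, rfl⟩, h2⟩ := hγ
    rw [hcomb] at h1 h2 ⊢
    have h3 := hroot m n h1
    rw [List.mem_cons, List.mem_cons] at h3
    rw [hL]
    rcases h3 with h3 | h3 | h3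
    · exact absurd (Or.inl (by rw [ha]; exact congrArg (fun c : ℤ × ℤ => pairVec i j c.1 c.2) h3)) h2
    · exact absurd (Or.inr (by
        rw [Set.mem_singleton_iff, hb]
        exact congrArg (fun c : ℤ × ℤ => pairVec i j c.1 c.2) h3)) h2
    · exact List.mem_map_of_mem h3
  · rw [hcomb, hcoord k hk]
  · funext v
    rw [foldr_comp_expAd, ← holds]
    rfl

variable {R : Type*} [CommRing R]

theorem commutator_mem {H : Subgroup (St A R)} {a b : RootVec A} {L : List (ChevalleyTerm A)}
    (hL : IsChevalley a b L) {t u : R} (ht : xg a t ∈ H) (hu : xg b u ∈ H) :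
    (L.map fun k => xg k.vec ((k.C : R) * t ^ k.m * u ^ k.n)).prod ∈ H := by
  rw [← xg_chevalley hL]
  exact mul_mem (mul_mem (mul_mem ht hu) (inv_mem ht)) (inv_mem hu)

theorem simple_root_left (i j : I) : (RootVec.simple A i).root = pairVec i j 1 0 :=
  (pairVec_one_zero i j).symm

theorem simple_root_right (i j : I) : (RootVec.simple A j).root = pairVec i j 0 1 :=
  (pairVec_zero_one i j).symm

/-- The vector `[e_i, e_j]` when `A_ji = -1`. -/
theorem exists_first {hd : ∀ i, A i i = 2} {i j : I} (hij : i ≠ j) (h : A j i = -1)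
    {H : Subgroup (St A R)} (hH : sg (RootVec.simple A j) (RootVec.simpleNeg hd j) 1 ∈ H) :
    ∃ b : RootVec A, b.root = pairVec i j 1 1 ∧ b.vec = ⁅e A i, e A j⁆ ∧
      SameIn H b (RootVec.simple A i) := by
  -- [e_i, e_j] = -s_j^*(e_i), because the e_j-string through e_i has just two members.
  refine ⟨((RootVec.simple A i).reflect hd j).neg, ?_, ?_,
    (sameIn_neg H _).trans (sameIn_reflect hH _)⟩
  · change simpleReflection A j (RootVec.simple A i).root = _
    rw [simple_root_left i j, simpleReflection_pairVec_right hd, h]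
    norm_num
  · change -sEquiv A j (e A i) = _
    have h0 : ⁅e A j, ⁅e A j, e A i⁆⁆ = 0 := by
      rw [← lie_skew (e A j) (e A i), lie_neg, lie_e_e_of_eq_neg_one h, neg_zero]
    have k1 := lie_f_string (i := j) (y₀ := e A i) (c := -1) (d := 0) rfl
      (by rw [lie_h_e, h]; norm_num) (by rw [lie_f_e_of_ne hij.symm]; simp)
    rw [sEquiv_string_one rfl h0 (lie_f_e_of_ne hij.symm) (by rw [k1]; module), lie_skew]

theorem isChevalley_A2 (hA : IsCartanOfRatio A 2) {i j : I} (hij : i ≠ j) (h1 : A i j = -1)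
    (h2 : A j i = -1) {c : RootVec A} (hc : c.root = pairVec i j 1 1)
    (hv : c.vec = ⁅e A i, e A j⁆) :
    IsChevalley (RootVec.simple A i) (RootVec.simple A j) [⟨c, 1, 1, 1⟩] := by
  refine isChevalley_of_coords hij (α := (1, 0)) (β := (0, 1)) (simple_root_left i j)
    (simple_root_right i j) (isPrenilpotent_A2 hA.diag h1 h2) [(1, 1)] (by simp [hc])
    (by simp) (by simp) (by simp) (fun m n h => ?_) (by simp [hc]) fun t u v => ?_
  · simp only [mul_one, mul_zero, add_zero, zero_add] at h ⊢
    rcases hA.roots_A2 h1 h2 h with ⟨rfl, rfl⟩ | ⟨rfl, rfl⟩ | ⟨rfl, rfl⟩ <;> simp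
  · have h3 : ⁅e A i, ⁅e A i, e A j⁆⁆ = 0 := by
      rw [← lie_skew (e A i) (e A j), lie_neg, lie_e_e_of_eq_neg_one h1, neg_zero]
    have := commutator_A2 (adNil_vec (RootVec.simple A i)) (adNil_vec (RootVec.simple A j))
      (adNil_vec c) hv.symm (by rw [hv]; exact h3) (by rw [hv]; exact lie_e_e_of_eq_neg_one h2) t u v
    simpa using this

/-- The string of root vectors from `e_j` to `ad (e_i)² e_j / 2` when `A_ij = -2`. -/
theorem exists_string_two {hd : ∀ i, A i i = 2} {i j : I} (hij : i ≠ j) (h1 : A i j = -2)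
    {H : Subgroup (St A R)} (hH : sg (RootVec.simple A i) (RootVec.simpleNeg hd i) 1 ∈ H) :
    ∃ b : RootVec A, b.root = pairVec i j 2 1 ∧ ⁅e A i, ⁅e A i, e A j⁆⁆ = (2 : ℂ) • b.vec ∧
      ⁅e A i, b.vec⁆ = 0 ∧ SameIn H b (RootVec.simple A j) := by
  set y := (2 : ℂ)⁻¹ • ⁅e A i, ⁅e A i, e A j⁆⁆ with hy
  have e1 : ⁅e A i, ⁅e A i, e A j⁆⁆ = (2 : ℂ) • y := by rw [hy]; module
  have e2 : ⁅e A i, y⁆ = 0 := by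
    have := ad_e_pow A i j
    rw [h1] at this
    have h3 : ⁅e A i, ⁅e A i, ⁅e A i, e A j⁆⁆⁆ = 0 := this
    rw [hy, lie_smul, h3, smul_zero]
  have w0 : ⁅h A i, e A j⁆ = (-2 : ℂ) • e A j := by rw [lie_h_e, h1]; norm_num
  have w1 := lie_h_e_lie hd w0
  have k0 := lie_f_e_of_ne (A := A) hij
  have k1 := lie_f_string (i := i) (d := 0) rfl w0 (by rw [k0]; simp)
  have k2 : ⁅f A i, y⁆ = -⁅e A i, e A j⁆ := by
    have := lie_f_string (i := i) (d := -2) rfl w1 (by rw [k1, lie_smul]; norm_num)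
    rw [hy, lie_smul, this]
    module
  have key : sEquiv A i (e A j) = y :=
    sEquiv_string_two rfl e1 e2 k0 (by rw [k1]; module) k2
  refine ⟨(RootVec.simple A j).reflect hd i, ?_, ?_, ?_, sameIn_reflect hH _⟩
  · change simpleReflection A i (RootVec.simple A j).root = _
    rw [simple_root_right i j, simpleReflection_pairVec_left hd, h1]
    norm_num
  · rw [e1]
    exact congrArg _ key.symm
  · rw [← e2]
    exact congrArg _ key

theorem isChevalley_B2 (hA : IsCartanOfRatio A 2) {i j : I} (hij : i ≠ j) (h1 : A i j = -2)
    (h2 : A j i = -1) {c d : RootVec A} (hc : c.root = pairVec i j 1 1)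
    (hcv : c.vec = ⁅e A i, e A j⁆) (hd : d.root = pairVec i j 2 1)
    (hdv : ⁅e A i, ⁅e A i, e A j⁆⁆ = (2 : ℂ) • d.vec) (hdz : ⁅e A i, d.vec⁆ = 0) :
    IsChevalley (RootVec.simple A i) (RootVec.simple A j) [⟨c, 1, 1, 1⟩, ⟨d, 2, 1, 1⟩] := by
  refine isChevalley_of_coords hij (α := (1, 0)) (β := (0, 1)) (simple_root_left i j)
    (simple_root_right i j) (isPrenilpotent_B2 hA.diag h1 h2) [(1, 1), (2, 1)] (by simp [hc, hd])
    (by simp) (by simp) (by simp) (fun m n h => ?_) (by simp [hc, hd]) fun t u v => ?_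
  · simp only [mul_one, mul_zero, add_zero, zero_add] at h ⊢
    rcases hA.roots_B2 h1 h2 h with ⟨rfl, rfl⟩ | ⟨rfl, rfl⟩ | ⟨rfl, rfl⟩ | ⟨rfl, rfl⟩ <;> simp
  · have := commutator_B2 (adNil_vec (RootVec.simple A i)) (adNil_vec (RootVec.simple A j))
      (adNil_vec c) (adNil_vec d) hcv.symm (by rw [hcv]; exact hdv) hdz
      (by rw [hcv]; exact lie_e_e_of_eq_neg_one h2) t u v
    simpa using this

/-- The string of root vectors from `e_j` to `ad (e_i)³ e_j / 6` when `A_ij = -3`, and the vector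
for the highest root. -/
theorem exists_string_three {hd : ∀ i, A i i = 2} {i j : I} (hij : i ≠ j) (h1 : A i j = -3)
    (h2 : A j i = -1) {H : Subgroup (St A R)}
    (hi : sg (RootVec.simple A i) (RootVec.simpleNeg hd i) 1 ∈ H)
    (hj : sg (RootVec.simple A j) (RootVec.simpleNeg hd j) 1 ∈ H) :
    ∃ b₂ b₃ c : RootVec A, b₂.root = pairVec i j 2 1 ∧ b₃.root = pairVec i j 3 1 ∧
      c.root = pairVec i j 3 2 ∧ ⁅e A i, ⁅e A i, e A j⁆⁆ = (2 : ℂ) • b₂.vec ∧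
      ⁅e A i, b₂.vec⁆ = (3 : ℂ) • b₃.vec ∧ ⁅e A i, b₃.vec⁆ = 0 ∧ ⁅e A j, b₃.vec⁆ = c.vec ∧
      SameIn H b₂ (RootVec.simple A i) ∧ SameIn H b₃ (RootVec.simple A j) ∧
      SameIn H c (RootVec.simple A j) := by
  set y₂ := (2 : ℂ)⁻¹ • ⁅e A i, ⁅e A i, e A j⁆⁆ with hy₂
  set y₃ := (3 : ℂ)⁻¹ • ⁅e A i, y₂⁆ with hy₃
  have e1 : ⁅e A i, ⁅e A i, e A j⁆⁆ = (2 : ℂ) • y₂ := by rw [hy₂]; module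
  have e2 : ⁅e A i, y₂⁆ = (3 : ℂ) • y₃ := by rw [hy₃]; module
  have e3 : ⁅e A i, y₃⁆ = 0 := by
    have := ad_e_pow A i j
    rw [h1] at this
    have h3 : ⁅e A i, ⁅e A i, ⁅e A i, ⁅e A i, e A j⁆⁆⁆⁆ = 0 := this
    rw [hy₃, hy₂, lie_smul, lie_smul, lie_smul, h3, smul_zero, smul_zero]
  have w0 : ⁅h A i, e A j⁆ = (-3 : ℂ) • e A j := by rw [lie_h_e, h1]; norm_num
  have w1 := lie_h_e_lie hd w0
  have w2 := lie_h_e_lie hd w1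
  have k0 := lie_f_e_of_ne (A := A) hij
  have k1 := lie_f_string (i := i) (d := 0) rfl w0 (by rw [k0]; simp)
  have k2' := lie_f_string (i := i) (d := -3) rfl w1 (by rw [k1, lie_smul]; norm_num)
  have k2 : ⁅f A i, y₂⁆ = (-2 : ℂ) • ⁅e A i, e A j⁆ := by
    rw [hy₂, lie_smul, k2']
    module
  have k3 : ⁅f A i, y₃⁆ = -y₂ := by
    have h3 := lie_f_string (i := i) (d := -4) rfl w2 (by rw [k2', lie_smul]; norm_num)
    rw [hy₃, hy₂, lie_smul, lie_smul, lie_smul, h3]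
    module
  -- Thus y₃ = s_i^*(e_j) lies in the orbit of e_j, and y₂ = -s_i^*([e_i, e_j]) in that of e_i up to
  -- sign.
  obtain ⟨s0, s1⟩ := sEquiv_string_three rfl e1 e2 e3 k0 (by rw [k1]; module) k2 k3
  obtain ⟨b₁, hb₁, hb₁v, hb₁H⟩ := exists_first hij h2 hj
  let b₃ := (RootVec.simple A j).reflect hd i
  have hb₃ : b₃.root = pairVec i j 3 1 := by
    change simpleReflection A i (RootVec.simple A j).root = _
    rw [simple_root_right i j, simpleReflection_pairVec_left hd, h1]
    norm_num
  have hb₃v : b₃.vec = y₃ := s0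
  have hb₂v : (b₁.reflect hd i).neg.vec = y₂ := by
    change -sEquiv A i b₁.vec = y₂
    rw [hb₁v, s1, neg_neg]
  -- The vector of the highest root is a reflection of y₃: the e_j-string through y₃ has two
  -- members.
  have hcv : sEquiv A j y₃ = ⁅e A j, y₃⁆ := by
    have hz := (lie_string_four rfl e1 e2 e3 (lie_e_e_of_eq_neg_one h2) rfl).2.2.2.2
    have f0 := lie_f_e_of_ne (A := A) hij.symm
    have f1 : ⁅f A j, ⁅e A i, e A j⁆⁆ = e A i := by
      rw [leibniz_lie, f0, zero_lie, zero_add, lie_f_e_self, lie_e_h, h2]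
      norm_num
    have f2 : ⁅f A j, y₂⁆ = 0 := by
      rw [hy₂, lie_smul, leibniz_lie, f0, f1, zero_lie, lie_self, add_zero, smul_zero]
    have f3 : ⁅f A j, y₃⁆ = 0 := by
      rw [hy₃, lie_smul, leibniz_lie, f0, f2, zero_lie, lie_zero, add_zero, smul_zero]
    refine sEquiv_string_one rfl hz f3 ?_
    have hw := mem_rootSpace.mp b₃.vec_mem j
    rw [hb₃v, hb₃, pairVec, weightAt_add, weightAt_smul, weightAt_smul, weightAt_single,
      weightAt_single, hd, h2] at hw
    rw [lie_f_string (c := -1) (d := 0) rfl (by rw [hw]; norm_num) (by rw [f3]; simp)]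
    module
  refine ⟨(b₁.reflect hd i).neg, b₃, b₃.reflect hd j, ?_, hb₃, ?_, ?_, ?_, ?_, ?_,
    (sameIn_neg H _).trans ((sameIn_reflect hi _).trans hb₁H), sameIn_reflect hi _,
    (sameIn_reflect hj _).trans (sameIn_reflect hi _)⟩
  · change simpleReflection A i b₁.root = _
    rw [hb₁, simpleReflection_pairVec_left hd, h1]
    norm_num
  · change simpleReflection A j b₃.root = _
    rw [hb₃, simpleReflection_pairVec_right hd, h2]
    norm_num
  · rw [hb₂v, e1]
  · rw [hb₂v, hb₃v, e2]
  · rw [hb₃v, e3]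
  · change _ = sEquiv A j b₃.vec
    rw [hb₃v, hcv]

theorem isChevalley_G2 (hA : IsCartanOfRatio A 3) {i j : I} (hij : i ≠ j) (h1 : A i j = -3)
    (h2 : A j i = -1) {b₁ b₂ b₃ c : RootVec A} (r₁ : b₁.root = pairVec i j 1 1)
    (r₂ : b₂.root = pairVec i j 2 1) (r₃ : b₃.root = pairVec i j 3 1)
    (rc : c.root = pairVec i j 3 2) (v₁ : b₁.vec = ⁅e A i, e A j⁆)
    (v₂ : ⁅e A i, ⁅e A i, e A j⁆⁆ = (2 : ℂ) • b₂.vec) (v₃ : ⁅e A i, b₂.vec⁆ = (3 : ℂ) • b₃.vec)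
    (v₄ : ⁅e A i, b₃.vec⁆ = 0) (vc : ⁅e A j, b₃.vec⁆ = c.vec) :
    IsChevalley (RootVec.simple A i) (RootVec.simple A j)
      [⟨b₁, 1, 1, 1⟩, ⟨b₂, 2, 1, 1⟩, ⟨b₃, 3, 1, 1⟩, ⟨c, 3, 2, 2⟩] := by
  refine isChevalley_of_coords hij (α := (1, 0)) (β := (0, 1)) (simple_root_left i j)
    (simple_root_right i j) (isPrenilpotent_G2 hA.diag h1 h2) [(1, 1), (2, 1), (3, 1), (3, 2)]
    (by simp [r₁, r₂, r₃, rc]) (by simp) (by simp) (by simp) (fun m n h => ?_)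
    (by simp [r₁, r₂, r₃, rc]) fun t u v => ?_
  · simp only [mul_one, mul_zero, add_zero, zero_add] at h ⊢
    rcases hA.roots_G2 h1 h2 h with ⟨rfl, rfl⟩ | ⟨rfl, rfl⟩ | ⟨rfl, rfl⟩ | ⟨rfl, rfl⟩ |
      ⟨rfl, rfl⟩ | ⟨rfl, rfl⟩ <;> simp
  · have := commutator_G2 (adNil_vec (RootVec.simple A i)) (adNil_vec (RootVec.simple A j))
      (adNil_vec b₁) (adNil_vec b₂) (adNil_vec b₃) (adNil_vec c) v₁.symm (by rw [v₁]; exact v₂) v₃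
      v₄ (by rw [v₁]; exact lie_e_e_of_eq_neg_one h2) vc t u v
    simpa using this

/-- The long roots α_j, 3α_i + α_j and their sum 3α_i + 2α_j behave as in A₂. -/
theorem isChevalley_G2_long (hA : IsCartanOfRatio A 3) {i j : I} (hij : i ≠ j) (h1 : A i j = -3)
    (h2 : A j i = -1) {b₂ b₃ c : RootVec A} (r₃ : b₃.root = pairVec i j 3 1)
    (rc : c.root = pairVec i j 3 2)
    (v₂ : ⁅e A i, ⁅e A i, e A j⁆⁆ = (2 : ℂ) • b₂.vec) (v₃ : ⁅e A i, b₂.vec⁆ = (3 : ℂ) • b₃.vec)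
    (v₄ : ⁅e A i, b₃.vec⁆ = 0) (vc : ⁅e A j, b₃.vec⁆ = c.vec) :
    IsChevalley (RootVec.simple A j) b₃ [⟨c, 1, 1, 1⟩] := by
  obtain ⟨-, k1, k2, k3, k4⟩ := lie_string_four rfl v₂ v₃ v₄ (lie_e_e_of_eq_neg_one h2) vc
  have k5 : ⁅b₃.vec, c.vec⁆ = 0 := by
    have h3 : ⁅b₂.vec, c.vec⁆ = 0 := by
      have : ⁅(2 : ℂ) • b₂.vec, c.vec⁆ = 0 := by
        rw [← v₂, lie_lie, lie_lie, k3, k4]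
        simp
      rw [smul_lie, smul_eq_zero] at this
      exact this.resolve_left two_ne_zero
    have : ⁅(3 : ℂ) • b₃.vec, c.vec⁆ = 0 := by
      rw [← v₃, lie_lie, k3, h3, lie_zero, lie_zero, sub_zero]
    rw [smul_lie, smul_eq_zero] at this
    exact this.resolve_left three_ne_zero
  refine isChevalley_of_coords hij (α := (0, 1)) (β := (3, 1)) (simple_root_right i j)
    r₃ (isPrenilpotent_G2_long hA.diag h1 h2) [(3, 2)]
    (by simp [rc]) (by simp) (by simp) (by simp) (fun m n h => ?_)
    (by simp [rc]) fun t u v => ?_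
  -- The combination is 3nα_i + (m + n)α_j, and divisibility of the first coordinate by 3 leaves
  -- only three of the six roots.
  · have h3 : pairVec i j ((n * 3 : ℕ) : ℤ) ((m + n : ℕ) : ℤ) ∈ roots A := by
      convert h using 2 <;> simp
    have h4 := hA.roots_G2 h1 h2 h3
    obtain ⟨rfl, rfl⟩ | ⟨rfl, rfl⟩ | ⟨rfl, rfl⟩ :
      (m = 1 ∧ n = 0) ∨ (m = 0 ∧ n = 1) ∨ (m = 1 ∧ n = 1) := by omega
    all_goals simp
  · have := commutator_A2 (adNil_vec (RootVec.simple A j)) (adNil_vec b₃) (adNil_vec c) vc k4 k5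
      t u v
    simpa using this

end

/-! ### Finitely generated rings -/

section FiniteType

variable {I : Type*} [Fintype I] [DecidableEq I] {A : Matrix I I ℤ} {R : Type*} [CommRing R]

/-- [e_i, e_j] and [e_j, e_i] differ by a sign and lie in the orbits of e_i and e_j respectively. So
the two simple root groups meet H in the same parameters, and the commutator relation makes this set
closed under products. -/
theorem edge_A2 (hA : IsCartanOfRatio A 2) {H : Subgroup (St A R)}
    (hH : ∀ i, sg (RootVec.simple A i) (RootVec.simpleNeg hA.diag i) 1 ∈ H) {G : Finset R}
    (hG : Algebra.adjoin ℤ (G : Set R) = ⊤)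
    (hm : ∀ k, ∀ m ∈ squarefreeMonomials G, xg (RootVec.simple A k) m ∈ H) {i j : I} (hij : i ≠ j)
    (h1 : A i j = -1) (h2 : A j i = -1) (t : R) : xg (RootVec.simple A i) t ∈ H := by
  obtain ⟨c, hc, hcv, hcH⟩ := exists_first hij h2 (hH j)
  obtain ⟨d, hd, hdv, hdH⟩ := exists_first hij.symm h1 (hH i)
  have hcd : c = d.neg := by
    refine RootVec.ext' ?_ ?_
    · change c.root = d.root
      rw [hc, hd, pairVec, pairVec, add_comm]
    · change c.vec = -d.vec
      rw [hcv, hdv, lie_skew]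
  have hji : SameIn H (RootVec.simple A i) (RootVec.simple A j) :=
    hcH.symm.trans (hcd ▸ (sameIn_neg H d).trans hdH)
  refine mem_of_mul_mem hG (T := coordSubgroup H (RootVec.simple A i)) (hm i)
    (fun t ht u hu => ?_) t
  have := commutator_mem (isChevalley_A2 hA hij h1 h2 hc hcv) ht ((hji u).mp hu)
  exact (hcH _).mp (by simpa using this)

/-- The commutator X_{α_i+α_j}(tu) X_{2α_i+α_j}(t²u) lies in H, so either factor lies in H iff the
other does; the first root is conjugate to α_i, the second to α_j. -/
theorem edge_B2 (hA : IsCartanOfRatio A 2) {H : Subgroup (St A R)}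
    (hH : ∀ i, sg (RootVec.simple A i) (RootVec.simpleNeg hA.diag i) 1 ∈ H) {G : Finset R}
    (hG : Algebra.adjoin ℤ (G : Set R) = ⊤)
    (hm : ∀ k, ∀ m ∈ squarefreeMonomials G, xg (RootVec.simple A k) m ∈ H) {i j : I} (hij : i ≠ j)
    (h1 : A i j = -2) (h2 : A j i = -1) (t : R) :
    xg (RootVec.simple A i) t ∈ H ∧ xg (RootVec.simple A j) t ∈ H := by
  obtain ⟨c, hc, hcv, hcH⟩ := exists_first hij h2 (hH j)
  obtain ⟨d, hd, hdv, hdz, hdH⟩ := exists_string_two hij h1 (hH i)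
  refine mem_of_mul_mem_iff hG (T₁ := coordSubgroup H (RootVec.simple A i))
    (T₂ := coordSubgroup H (RootVec.simple A j)) (hm i) (hm j) (fun t ht u hu => ?_) t
  have := commutator_mem (isChevalley_B2 hA hij h1 h2 hc hcv hd hdv hdz) ht hu
  simp only [List.map_cons, List.map_nil, List.prod_cons, List.prod_nil, mul_one, Int.cast_one,
    one_mul, pow_one] at this
  refine (hcH _).symm.trans (Iff.trans ⟨fun h => ?_, fun h => ?_⟩ (hdH _))
  · exact (Subgroup.mul_mem_cancel_left _ h).mp this
  · exact (Subgroup.mul_mem_cancel_right _ h).mp this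

theorem edge_G2 (hA : IsCartanOfRatio A 3) {H : Subgroup (St A R)}
    (hH : ∀ i, sg (RootVec.simple A i) (RootVec.simpleNeg hA.diag i) 1 ∈ H) {G : Finset R}
    (hG : Algebra.adjoin ℤ (G : Set R) = ⊤)
    (hm : ∀ k, ∀ m ∈ squarefreeMonomials G, xg (RootVec.simple A k) m ∈ H) {i j : I} (hij : i ≠ j)
    (h1 : A i j = -3) (h2 : A j i = -1) (t : R) :
    xg (RootVec.simple A i) t ∈ H ∧ xg (RootVec.simple A j) t ∈ H := by
  obtain ⟨b₁, r₁, v₁, m₁⟩ := exists_first hij h2 (hH j)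
  obtain ⟨b₂, b₃, c, r₂, r₃, rc, v₂, v₃, v₄, vc, m₂, m₃, mc⟩ :=
    exists_string_three hij h1 h2 (hH i) (hH j)
  have hj : ∀ t, xg (RootVec.simple A j) t ∈ H := by
    refine mem_of_mul_mem hG (T := coordSubgroup H (RootVec.simple A j)) (hm j)
      fun t ht u hu => ?_
    have := commutator_mem (isChevalley_G2_long hA hij h1 h2 r₃ rc v₂ v₃ v₄ vc) ht ((m₃ u).mpr hu)
    exact (mc _).mp (by simpa using this)
  refine ⟨?_, hj t⟩
  -- All long root groups already lie in H, so the two long factors of the commutator can be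
  -- cancelled.
  have key : ∀ t, xg (RootVec.simple A i) t ∈ H → ∀ u, xg b₁ (t * u) * xg b₂ (t ^ 2 * u) ∈ H := by
    intro t ht u
    have := commutator_mem (isChevalley_G2 hA hij h1 h2 r₁ r₂ r₃ rc v₁ v₂ v₃ v₄ vc) ht (hj u)
    simp only [List.map_cons, List.map_nil, List.prod_cons, List.prod_nil, mul_one, Int.cast_one,
      one_mul, pow_one, ← mul_assoc] at this
    exact (Subgroup.mul_mem_cancel_right _ ((m₃ _).mpr (hj _))).mp
      ((Subgroup.mul_mem_cancel_right _ ((mc _).mpr (hj _))).mp this)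
  refine mem_of_sq_sub_mul_mem hG (T := coordSubgroup H (RootVec.simple A i)) (hm i)
    (fun t ht u => ?_) t
  -- The parameter pairs (1, tu) and (t, u) give the same factor at the root α_i + α_j. Dividing one
  -- product by the other leaves X_{b₂}((t² - t)u).
  have h3 := key 1 (hm i 1 (by
    simpa using prod_mem_squarefreeMonomials (Finset.empty_subset G))) (t * u)
  have h4 := mul_mem (inv_mem h3) (key t ht u)
  rw [one_pow, one_mul, mul_inv_rev, ← xg_neg, ← xg_neg, mul_assoc, ← mul_assoc (xg b₁ _),
    ← xg_add, neg_add_cancel, xg_zero, one_mul, ← xg_add] at h4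
  refine (m₂ _).mp ?_
  convert h4 using 2
  ring

theorem fg_of_finiteType {p : ℤ} (hA : IsCartanOfRatio A p) (hI : 2 ≤ Fintype.card I)
    (hR : Algebra.FiniteType ℤ R) : Group.FG (St A R) := by
  obtain ⟨G, hG⟩ := hR.out
  let gens : Set (St A R) :=
    (fun q : I × R => xg (RootVec.simple A q.1) q.2) ''
      (Set.univ ×ˢ (squarefreeMonomials G : Set R)) ∪
    Set.range fun i => sg (RootVec.simple A i) (RootVec.simpleNeg hA.diag i) 1
  have hfin : gens.Finite :=
    ((Set.finite_univ.prod (squarefreeMonomials G).finite_toSet).image _).union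
      (Set.finite_range _)
  have hH : ∀ i, sg (RootVec.simple A i) (RootVec.simpleNeg hA.diag i) 1 ∈
      Subgroup.closure gens := fun i => Subgroup.subset_closure (Or.inr ⟨i, rfl⟩)
  have hm : ∀ k, ∀ m ∈ squarefreeMonomials G,
      xg (RootVec.simple A k) m ∈ Subgroup.closure gens :=
    fun k m hm => Subgroup.subset_closure (Or.inl ⟨(k, m), ⟨trivial, hm⟩, rfl⟩)
  refine fg_of_simple_mem hA (H := Subgroup.closure gens)
    ((Subgroup.fg_iff _).mpr ⟨gens, rfl, hfin⟩) hH fun k t => ?_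
  -- A node without neighbours would by itself be closed under adjacency, against connectedness in
  -- rank at least 2.
  obtain ⟨j, hkj, hne⟩ : ∃ j, k ≠ j ∧ A k j ≠ 0 := by
    by_contra! hcon
    obtain ⟨j, hj⟩ := Fintype.exists_ne_of_one_lt_card (by omega : 1 < Fintype.card I) k
    refine hj (hA.connected (fun i => i = k) (fun i j hi hij => ?_) k j rfl)
    subst hi
    by_contra hji
    exact hij (hcon j fun h => hji h.symm)
  rcases hA.edge k j hkj with ⟨h1, -⟩ | ⟨rfl, h1, h2⟩ | ⟨h1, h2⟩ | ⟨h1, h2⟩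
  · exact absurd h1 hne
  · exact edge_A2 hA hH hG hm hkj h1 h2 t
  · rcases hA.ratio with rfl | rfl
    · exact (edge_B2 hA hH hG hm hkj.symm h2 h1 t).2
    · exact (edge_G2 hA hH hG hm hkj.symm h2 h1 t).2
  · rcases hA.ratio with rfl | rfl
    · exact (edge_B2 hA hH hG hm hkj h1 h2 t).1
    · exact (edge_G2 hA hH hG hm hkj h1 h2 t).1

end FiniteType

end SteinbergGroup

theorem mainTheorem11 {I : Type*} [Fintype I] [DecidableEq I] (A : Matrix I I ℤ)
    (hA : SteinbergGroup.IsABCDEFG A) (R : Type*) [CommRing R]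
    (h : (2 ≤ Fintype.card I ∧ Algebra.FiniteType ℤ R) ∨
      (1 ≤ Fintype.card I ∧
        ∃ (U : Finset Rˣ) (S : Subring R),
          S = Subring.closure ((fun u : Rˣ => (u : R)) '' (U : Set Rˣ)) ∧ Module.Finite S R)) :
    Group.FG (SteinbergGroup.St A R) := by
  obtain ⟨p, hp⟩ := hA.exists_ratio
  rcases h with ⟨hI, hR⟩ | ⟨-, U, S, hS, hfin⟩
  · exact SteinbergGroup.fg_of_finiteType hp hI hR
  · exact SteinbergGroup.fg_of_finite_over_units hp hS hfin
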